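/- Let $p>2$ be a prime, $k$ a perfect field of characteristic $p$, $d\ge 0$ and $r\ge 1$ integers. Put $F=\operatorname{Frac}W(k)$, $F_s=F(\mu_{p^s})$, $F_\infty=\bigcup_s F_s$, $\Gamma_s=\operatorname{Gal}(F_\infty/F_s)$, and let $\chi:\Gamma_0\to\mathbf Z_p^*$ be the $p$-adic cyclotomic character. Let $\mathfrak S=W(k)[[u,t_1,\dots,t_d]]$, with the endomorphism $\varphi$ that extends the Frobenius of $W(k)$ by $\varphi(1+u)=(1+u)^p$, $\varphi(t_i)=t_i^p$, and with the $W(k)$-linear action of $\Gamma_0$ given by $\gamma(1+u)=(1+u)^{\chi(\gamma)}$, $\gamma(t_i)=t_i$. Put $E_r=\varphi^r(u)/\varphi^{r-1}(u)$ and $R_r=\mathfrak S/E_r\mathfrak S\cong\mathcal O_{F_r}[[t_1,\dots,t_d]]$. Let $S_r$ be the $p$-adic completion of the divided power envelope of the ideal $E_r\mathfrak S\subset\mathfrak S$; it carries the induced Frobenius $\varphi$ and action of $\Gamma_0$. Let $\operatorname{Fil}^1S_r=\ker(S_r\to R_r)$ and $\varphi_1=p^{-1}\varphi:\operatorname{Fil}^1S_r\to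 S_r$. Let $\Omega_0=\mathfrak S\,du$, and let $\nabla_{S_r,0}:S_r\to S_r\otimes_{\mathfrak S}\Omega_0$ be the natural extension of the derivation $f\mapsto (\partial f/\partial u)\,du$ of $\mathfrak S$. An $\underline S_r$-window $\underline M=(M,\operatorname{Fil}^1M,\Phi,\Phi_1)$ consists of a finite projective $S_r$-module $M$, a submodule $\operatorname{Fil}^1M$ and $\varphi$-linear maps $\Phi:M\to M$, $\Phi_1:\operatorname{Fil}^1M\to M$ such that there is a decomposition $M=L\oplus N$ with $\operatorname{Fil}^1M=L\oplus(\operatorname{Fil}^1S_r)N$; $\Phi_1(sm)=\varphi_1(s)\Phi(m)$ for $s\in\operatorname{Fil}^1S_r$, $m\in M$; $\Phi=p\Phi_1$ on $\operatorname{Fil}^1M$; and $\Phi_1(\operatorname{Fil}^1M)+\Phi(M)$ generates $M$. Homomorphisms of windows are the $S_r$-linear maps that preserve $\operatorname{Fil}^1$ and commute with $\Phi$ and $\Phi_1$. Let $\operatorname{Win}(\underline S_r)^{\Gamma_r}$ be the category of $\underline S_r$-windows with a strict action of $\Gamma_r$, i.e. an action of $\Gamma_r$ on $M$ that is semilinear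 over its action on $S_r$, preserves $\operatorname{Fil}^1M$, commutes with $\Phi$ and $\Phi_1$, and is trivial on $M\otimes_{S_r}\mathfrak S/u\mathfrak S$, where $S_r\to\mathfrak S/u\mathfrak S$ is the homomorphism extending the projection of $\mathfrak S$; morphisms are the equivariant homomorphisms of windows. Let $\operatorname{Win}(\underline S_r)^{\nabla_0,\Gamma_r}$ be the category of objects $\underline M$ of $\operatorname{Win}(\underline S_r)^{\Gamma_r}$ equipped with a connection $\nabla_0:M\to M\otimes_{\mathfrak S}\Omega_0$ over $\nabla_{S_r,0}$ such that $\nabla_0\circ\Phi=(\Phi\otimes d\varphi)\circ\nabla_0$ and $\nabla_0\circ\gamma=(\gamma\otimes d\gamma)\circ\nabla_0$ for all $\gamma\in\Gamma_r$; morphisms are the equivariant homomorphisms of windows that are compatible with the connections. Then the forgetful functor $$\operatorname{Win}(\underline S_r)^{\nabla_0,\Gamma_r}\longrightarrow\operatorname{Win}(\underline S_r)^{\Gamma_r}$$ is an equivalence of categories. -/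

import Mathlib

universe u

open CategoryTheory

noncomputable section

namespace CycWin

set_option linter.unusedSectionVars false

/-! ### Power series rings with the cyclotomic Frobenius and the cyclotomic action -/

section PowerSeriesRings

variable (p : ℕ) [Fact p.Prime] (d : ℕ)

/-- `C[[u, t_1, …, t_d]]`, written as `C[[t_1, …, t_d]][[u]]`; the variable `u` is `PowerSeries.X`. -/
abbrev PS (C : Type u) [CommRing C] : Type u := PowerSeries (MvPowerSeries (Fin d) C)

variable {C : Type u} [CommRing C]

theorem constantCoeff_frobSeries {A : Type u} [CommRing A] :
    PowerSeries.constantCoeff ((1 + PowerSeries.X) ^ p - 1 : PowerSeries A) = 0 := by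
  simp

/-- The ring endomorphism of `C[[u, t_1, …, t_d]]` that is `σ` on the coefficients and sends
`t_i` to `t_i ^ p` and `1 + u` to `(1 + u) ^ p`. -/
def frob (σ : C →+* C) : PS d C →+* PS d C :=
  (PowerSeries.substAlgHom (R := MvPowerSeries (Fin d) C)
    (PowerSeries.HasSubst.of_constantCoeff_zero'
      (constantCoeff_frobSeries p (A := MvPowerSeries (Fin d) C)))).toRingHom.comp
    (PowerSeries.map ((MvPowerSeries.expand p (Fact.out : p.Prime).ne_zero).toRingHom.comp
      (MvPowerSeries.map σ)))

variable {p}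

/-- The power series `(1 + u) ^ a` for a `p`-adic integer `a`, over a ring `C` that receives a
homomorphism from `ℤ_p`. -/
def onePlusPow (ι : ℤ_[p] →+* C) (a : ℤ_[p]) : PS d C :=
  PowerSeries.map (MvPowerSeries.C.comp ι) (PowerSeries.binomialSeries ℤ_[p] a)

theorem constantCoeff_onePlusPow (ι : ℤ_[p] →+* C) (a : ℤ_[p]) :
    PowerSeries.constantCoeff (onePlusPow d ι a - 1) = 0 := by
  rw [map_sub, onePlusPow, ← PowerSeries.coeff_zero_eq_constantCoeff_apply, PowerSeries.coeff_map]
  simp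

/-- The `C[[t_1, …, t_d]]`-algebra endomorphism of `C[[u, t_1, …, t_d]]` with
`1 + u ↦ (1 + u) ^ a`. -/
def cyc (ι : ℤ_[p] →+* C) (a : ℤ_[p]) : PS d C →+* PS d C :=
  (PowerSeries.substAlgHom (R := MvPowerSeries (Fin d) C)
    (PowerSeries.HasSubst.of_constantCoeff_zero' (constantCoeff_onePlusPow d ι a))).toRingHom

theorem frob_X (σ : C →+* C) :
    frob p d σ PowerSeries.X = (1 + PowerSeries.X) ^ p - 1 := by
  simp only [frob, RingHom.comp_apply, PowerSeries.map_X]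
  exact PowerSeries.substAlgHom_X _

theorem cyc_X (ι : ℤ_[p] →+* C) (a : ℤ_[p]) :
    cyc d ι a PowerSeries.X = onePlusPow d ι a - 1 :=
  PowerSeries.substAlgHom_X _

variable {C' : Type u} [CommRing C']

/-- Change of coefficients `C[[u, t_1, …, t_d]] → C'[[u, t_1, …, t_d]]`. -/
abbrev psMap (f : C →+* C') : PS d C →+* PS d C' := PowerSeries.map (MvPowerSeries.map f)

theorem psMap_frob (f : C →+* C') (σ : C →+* C) (σ' : C' →+* C') (h : ∀ x, f (σ x) = σ' (f x))
    (x : PS d C) : psMap d f (frob p d σ x) = frob p d σ' (psMap d f x) := by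
  have h1 : PowerSeries.HasSubst ((1 + PowerSeries.X) ^ p - 1 : PS d C) :=
    PowerSeries.HasSubst.of_constantCoeff_zero' (constantCoeff_frobSeries p)
  have e := PowerSeries.map_subst (h := MvPowerSeries.map f) h1
    (PowerSeries.map ((MvPowerSeries.expand p (Fact.out : p.Prime).ne_zero).toRingHom.comp
      (MvPowerSeries.map σ)) x)
  have c1 : ∀ y, frob p d σ y = PowerSeries.subst ((1 + PowerSeries.X) ^ p - 1 : PS d C)
    (PowerSeries.map ((MvPowerSeries.expand p (Fact.out : p.Prime).ne_zero).toRingHom.comp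
      (MvPowerSeries.map σ)) y) := fun y => by
    rw [← PowerSeries.coe_substAlgHom h1]; rfl
  have h2 : PowerSeries.HasSubst ((1 + PowerSeries.X) ^ p - 1 : PS d C') :=
    PowerSeries.HasSubst.of_constantCoeff_zero' (constantCoeff_frobSeries p)
  have c2 : ∀ y, frob p d σ' y = PowerSeries.subst ((1 + PowerSeries.X) ^ p - 1 : PS d C')
    (PowerSeries.map ((MvPowerSeries.expand p (Fact.out : p.Prime).ne_zero).toRingHom.comp
      (MvPowerSeries.map σ')) y) := fun y => by
    rw [← PowerSeries.coe_substAlgHom h2]; rfl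
  rw [c1, c2]
  refine e.trans ?_
  have e1 : (MvPowerSeries.map (MvPowerSeries.map f) ((1 + PowerSeries.X) ^ p - 1 : PS d C)
      : PS d C') = (1 + PowerSeries.X) ^ p - 1 := by
    change PowerSeries.map (MvPowerSeries.map f) _ = _
    simp
  rw [e1]
  congr 1
  ext n : 1
  simp only [PowerSeries.coeff_map, RingHom.comp_apply, AlgHom.toRingHom_eq_coe, RingHom.coe_coe,
    MvPowerSeries.map_expand]
  congr 1
  ext m
  simp [MvPowerSeries.coeff_map, h]

theorem psMap_onePlusPow (f : C →+* C') (ι : ℤ_[p] →+* C) (a : ℤ_[p]) :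
    psMap d f (onePlusPow d ι a) = onePlusPow d (f.comp ι) a := by
  ext n : 1
  simp [onePlusPow]

theorem psMap_cyc (f : C →+* C') (ι : ℤ_[p] →+* C) (a : ℤ_[p]) (x : PS d C) :
    psMap d f (cyc d ι a x) = cyc d (f.comp ι) a (psMap d f x) := by
  have h1 := PowerSeries.HasSubst.of_constantCoeff_zero' (constantCoeff_onePlusPow d ι a)
  have h2 := PowerSeries.HasSubst.of_constantCoeff_zero' (constantCoeff_onePlusPow d (f.comp ι) a)
  have e := PowerSeries.map_subst (h := MvPowerSeries.map f) h1 x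
  have c1 : ∀ y, cyc d ι a y = PowerSeries.subst (onePlusPow d ι a - 1) y := fun y => by
    rw [← PowerSeries.coe_substAlgHom h1]; rfl
  have c2 : ∀ y, cyc d (f.comp ι) a y = PowerSeries.subst (onePlusPow d (f.comp ι) a - 1) y :=
    fun y => by rw [← PowerSeries.coe_substAlgHom h2]; rfl
  rw [c1, c2]
  refine e.trans ?_
  have e1 : (MvPowerSeries.map (MvPowerSeries.map f) (onePlusPow d ι a - 1) : PS d C') =
      onePlusPow d (f.comp ι) a - 1 := by
    change PowerSeries.map (MvPowerSeries.map f) _ = _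
    rw [map_sub, map_one, psMap_onePlusPow]
  rw [e1]

theorem psMap_derivative (f : C →+* C') (x : PS d C) :
    psMap d f (PowerSeries.derivative _ x) = PowerSeries.derivative _ (psMap d f x) := by
  ext n : 1
  simp [PowerSeries.coeff_derivative]

/-- `E_r = φ^r(u) / φ^{r-1}(u)` for `r ≥ 1`, that is,
`((1 + u)^{p^r} - 1) / ((1 + u)^{p^{r-1}} - 1)`. -/
def cycE (p : ℕ) (C : Type u) [CommRing C] (r : ℕ) : PS d C :=
  ∑ i ∈ Finset.range p, ((1 + PowerSeries.X) ^ p ^ (r - 1)) ^ i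

theorem frob_iterate_X (σ : C →+* C) (n : ℕ) :
    (frob p d σ)^[n] PowerSeries.X = (1 + PowerSeries.X) ^ p ^ n - 1 := by
  induction n with
  | zero => simp
  | succ n ih =>
    rw [Function.iterate_succ_apply', ih, map_sub, map_pow, map_add, map_one, frob_X]
    ring

/-- The defining property of `E_r`. -/
theorem cycE_mul (σ : C →+* C) (r : ℕ) (hr : 1 ≤ r) :
    cycE d p C r * (frob p d σ)^[r - 1] PowerSeries.X = (frob p d σ)^[r] PowerSeries.X := by
  obtain ⟨s, rfl⟩ := Nat.exists_eq_add_of_le' hr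
  rw [frob_iterate_X, frob_iterate_X, cycE, geom_sum_mul]
  simp [pow_succ, pow_mul]

theorem map_cycE (f : PS d C →+* PS d C') (r : ℕ) :
    f (cycE d p C r) = ∑ i ∈ Finset.range p, ((1 + f PowerSeries.X) ^ p ^ (r - 1)) ^ i := by
  simp [cycE]

/-- Modulo `p`, the sum `1 + y + … + y^{p-1}` with `y = (1 + x)^q`, `q = p^n`, is `x^{q(p-1)}`. -/
theorem dvd_geom_sub {B : Type u} [CommRing B] (n : ℕ) (x : B) :
    (p : B) ∣ (∑ i ∈ Finset.range p, ((1 + x) ^ p ^ n) ^ i) - x ^ (p ^ n * (p - 1)) := by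
  -- reduce to the polynomial ring
  have key : (p : Polynomial ℤ) ∣
      (∑ i ∈ Finset.range p, ((1 + Polynomial.X : Polynomial ℤ) ^ p ^ n) ^ i) -
        Polynomial.X ^ (p ^ n * (p - 1)) := by
    have hk : ∀ f : Polynomial ℤ, f.map (Int.castRingHom (ZMod p)) = 0 → (p : Polynomial ℤ) ∣ f := by
      intro f hf
      have : (Polynomial.C (p : ℤ)) ∣ f := by
        rw [Polynomial.C_dvd_iff_dvd_coeff]
        intro i
        have := congrArg (fun g => g.coeff i) hf
        simpa [ZMod.intCast_zmod_eq_zero_iff_dvd, ZMod.intCast_zmod_eq_zero_iff_dvd] using this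
      simpa using this
    apply hk
    have hx : (Polynomial.X : Polynomial (ZMod p)) ^ p ^ n ≠ 0 := by simp
    apply mul_right_cancel₀ hx
    simp only [Polynomial.map_sub, Polynomial.map_sum, Polynomial.map_pow, Polynomial.map_add,
      Polynomial.map_one, Polynomial.map_X, zero_mul]
    have h1 : (1 + Polynomial.X : Polynomial (ZMod p)) ^ p ^ n = 1 + Polynomial.X ^ p ^ n := by
      rw [add_pow_char_pow]; simp
    rw [h1, sub_mul]
    have h2 := geom_sum_mul (1 + Polynomial.X ^ p ^ n : Polynomial (ZMod p)) p
    rw [add_sub_cancel_left] at h2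
    rw [h2, add_pow_char, one_pow, add_sub_cancel_left, ← pow_mul, ← pow_add, ← Nat.mul_succ,
      Nat.succ_eq_add_one, Nat.sub_add_cancel (Fact.out : p.Prime).one_le, sub_self]
  have := map_dvd (Polynomial.aeval x) key
  simpa using this

end PowerSeriesRings

/-! ### Divided power envelopes inside a `ℚ`-algebra -/

section Hull

variable {B B' : Type u} [CommRing B] [CommRing B'] [Algebra ℚ B']

/-- The divided power `x ^ n / n!` in a `ℚ`-algebra. -/
def dp (n : ℕ) (x : B') : B' := (n.factorial : ℚ)⁻¹ • x ^ n

/-- For a homomorphism `i` from a ring `B` to a `ℚ`-algebra and an ideal `J` of `B`, the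
`B`-subalgebra generated by the divided powers `a ^ n / n!` with `a ∈ J` and `n ≥ 0`. -/
def pdHull (i : B →+* B') (J : Ideal B) : Subring B' :=
  Subring.closure (Set.range i ∪ {x | ∃ (n : ℕ) (a : B), a ∈ J ∧ x = dp n (i a)})

/-- The ideal of `pdHull i J` generated by the divided powers `a ^ n / n!` with `a ∈ J` and
`n ≥ 1`. -/
def pdHullIdeal (i : B →+* B') (J : Ideal B) : Ideal (pdHull i J) :=
  Ideal.span {x | ∃ (n : ℕ) (a : B), n ≠ 0 ∧ a ∈ J ∧ (x : B') = dp n (i a)}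

theorem natCast_mul_cancel {n : ℕ} (hn : n ≠ 0) {x y : B'} (h : (n : B') * x = n * y) :
    x = y := by
  have h2 : ∀ z : B', (n : ℚ)⁻¹ • ((n : B') * z) = z := fun z => by
    have : (n : B') = algebraMap ℚ B' (n : ℚ) := by simp
    rw [this, ← Algebra.smul_def, smul_smul, inv_mul_cancel₀ (Nat.cast_ne_zero.2 hn), one_smul]
  rw [← h2 x, h, h2]

theorem factorial_mul_dp (n : ℕ) (x : B') : (n.factorial : B') * dp n x = x ^ n := by
  have : (n.factorial : B') = algebraMap ℚ B' (n.factorial : ℚ) := by simp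
  rw [dp, this, ← Algebra.smul_def, smul_smul,
    mul_inv_cancel₀ (Nat.cast_ne_zero.2 n.factorial_ne_zero), one_smul]

theorem dp_eq {n : ℕ} {x y : B'} (h : (n.factorial : B') * y = x ^ n) : y = dp n x :=
  natCast_mul_cancel n.factorial_ne_zero (h.trans (factorial_mul_dp n x).symm)

theorem map_dp {B'' : Type u} [CommRing B''] [Algebra ℚ B''] (f : B' →+* B'') (n : ℕ) (x : B') :
    f (dp n x) = dp n (f x) := by
  apply dp_eq
  rw [← map_natCast f, ← map_mul, factorial_mul_dp, map_pow]

theorem dp_mul (n : ℕ) (c x : B') : dp n (c * x) = c ^ n * dp n x := by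
  rw [dp, dp, mul_pow, mul_smul_comm]

theorem dp_zero (x : B') : dp 0 x = 1 := by simp [dp]

theorem dp_add (n : ℕ) (x y : B') :
    dp n (x + y) = ∑ ij ∈ Finset.HasAntidiagonal.antidiagonal n, dp ij.1 x * dp ij.2 y := by
  symm
  apply dp_eq
  rw [Finset.mul_sum, (Commute.all x y).add_pow']
  refine Finset.sum_congr rfl fun ij h => ?_
  rw [Finset.HasAntidiagonal.mem_antidiagonal] at h
  have h1 : n.choose ij.1 * ij.1.factorial * ij.2.factorial = n.factorial := by
    rw [← h, mul_assoc, mul_comm (ij.1.factorial), ← mul_assoc, add_comm ij.1,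
      Nat.add_choose_mul_factorial_mul_factorial]
  rw [← factorial_mul_dp ij.1 x, ← factorial_mul_dp ij.2 y, ← h1, nsmul_eq_mul]
  push_cast
  ring

/-- The element `p ^ n / n!` exists in `B`, and is divisible by `p` when `n ≥ 1`. -/
def HasPPowDivFactorial (p : ℕ) (B : Type u) [CommRing B] : Prop :=
  ∀ n : ℕ, ∃ z : B, (n.factorial : B) * z = (p : B) ^ n ∧ (n ≠ 0 → (p : B) ∣ z)

theorem hasPPowDivFactorial (p : ℕ) [Fact p.Prime] (f : ℤ_[p] →+* B) : HasPPowDivFactorial p B := by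
  intro n
  have hp : (p : ℤ_[p]) ∈ Ideal.span {(p : ℤ_[p])} := Ideal.mem_span_singleton_self _
  refine ⟨f ((PadicInt.dividedPowers p).dpow n p), ?_, fun hn => ?_⟩
  · rw [← map_natCast f, ← map_mul, (PadicInt.dividedPowers p).factorial_mul_dpow_eq_pow hp]
    simp
  · have := map_dvd f (Ideal.mem_span_singleton.1 ((PadicInt.dividedPowers p).dpow_mem hn hp))
    simpa using this

variable (i : B →+* B') {p : ℕ}

theorem exists_dp_p (hB : HasPPowDivFactorial p B) (n : ℕ) (y : B) :
    ∃ z : B, dp n (i (p * y)) = i z ∧ (n ≠ 0 → (p : B) ∣ z) := by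
  obtain ⟨z, hz, hz'⟩ := hB n
  refine ⟨z * y ^ n, ?_, fun hn => (hz' hn).mul_right _⟩
  symm
  apply dp_eq
  have := congrArg (fun x => i (x * y ^ n)) hz
  simp only [map_mul, map_pow, map_natCast] at this ⊢
  rw [mul_pow, ← this]; ring

variable {i} {J : Ideal B}

theorem map_mem_pdHull' (x : B) : i x ∈ pdHull i J :=
  Subring.subset_closure (Or.inl ⟨x, rfl⟩)

theorem dp_mem (n : ℕ) {a : B} (ha : a ∈ J) : dp n (i a) ∈ pdHull i J :=
  Subring.subset_closure (Or.inr ⟨n, a, ha, rfl⟩)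

theorem dp_mem_of_add (hB : HasPPowDivFactorial p B) (n : ℕ) {a : B} (ha : a ∈ J) (y : B) :
    dp n (i (a + p * y)) ∈ pdHull i J := by
  rw [map_add, dp_add]
  refine Subring.sum_mem _ fun ij _ => Subring.mul_mem _ (dp_mem _ ha) ?_
  obtain ⟨z, hz, -⟩ := exists_dp_p i hB ij.2 y
  rw [hz]
  exact map_mem_pdHull' z

/-- An endomorphism `g` of the `ℚ`-algebra that comes from an endomorphism `f` of `B` with
`f (J) ⊆ J + p B` preserves `pdHull i J`. -/
theorem map_mem_pdHull (hB : HasPPowDivFactorial p B) (f : B →+* B) (g : B' →+* B')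
    (hfg : ∀ x, i (f x) = g (i x)) (hJ : ∀ a ∈ J, ∃ b ∈ J, (p : B) ∣ f a - b)
    {x : B'} (hx : x ∈ pdHull i J) : g x ∈ pdHull i J := by
  induction hx using Subring.closure_induction with
  | mem x hx =>
    rcases hx with ⟨s, rfl⟩ | ⟨n, a, ha, rfl⟩
    · rw [← hfg]; exact map_mem_pdHull' _
    · rw [map_dp, ← hfg]
      obtain ⟨b, hb, y, hy⟩ := hJ a ha
      rw [eq_add_of_sub_eq' hy]
      exact dp_mem_of_add hB n hb _
  | zero => rw [map_zero]; exact Subring.zero_mem _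
  | one => rw [map_one]; exact Subring.one_mem _
  | add x y _ _ hx hy => rw [map_add]; exact Subring.add_mem _ hx hy
  | neg x _ hx => rw [map_neg]; exact Subring.neg_mem _ hx
  | mul x y _ _ hx hy => rw [map_mul]; exact Subring.mul_mem _ hx hy

/-- The endomorphism of `pdHull i J` induced by `g`. -/
def mapHull (g : B' →+* B') (hg : ∀ x ∈ pdHull i J, g x ∈ pdHull i J) : pdHull i J →+* pdHull i J :=
  (g.comp (pdHull i J).subtype).codRestrict (pdHull i J) fun x => hg x x.2

/-- If every `a ∈ J` satisfies `f a ≡ b ^ p c` modulo `p` for some `b ∈ J` and `c ∈ B`, then the endomorphism induced by `g`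
sends the ideal of `pdHull i J` into the multiples of `p`. -/
theorem dvd_mapHull (hp : p.Prime) (hB : HasPPowDivFactorial p B) (f : B →+* B) (g : B' →+* B')
    (hfg : ∀ x, i (f x) = g (i x)) (hJ : ∀ a ∈ J, ∃ b ∈ J, ∃ c, (p : B) ∣ f a - b ^ p * c)
    (hg : ∀ x ∈ pdHull i J, g x ∈ pdHull i J) {x : pdHull i J} (hx : x ∈ pdHullIdeal i J) :
    (p : pdHull i J) ∣ mapHull g hg x := by
  have key : ∀ (n : ℕ) (a : B), n ≠ 0 → a ∈ J →
      ∃ z ∈ pdHull i J, g (dp n (i a)) = p * z := by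
    intro n a hn ha
    obtain ⟨b, hb, c, y, hy⟩ := hJ a ha
    rw [map_dp, ← hfg, eq_add_of_sub_eq' hy, map_add, dp_add]
    have : ∀ ij ∈ Finset.HasAntidiagonal.antidiagonal n, ∃ z ∈ pdHull i J,
        dp ij.1 (i (b ^ p * c)) * dp ij.2 (i (p * y)) = p * z := by
      intro ij hij
      rw [Finset.HasAntidiagonal.mem_antidiagonal] at hij
      obtain ⟨z, hz, hz'⟩ := exists_dp_p i hB ij.2 y
      have hpow : ∃ m : ℕ, dp ij.1 (i (b ^ p * c)) = i c ^ ij.1 * m * dp (p * ij.1) (i b) ∧ (ij.1 ≠ 0 → p ∣ m) := by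
        rcases Nat.eq_zero_or_pos ij.1 with h0 | h0
        · exact ⟨1, by simp [h0, dp_zero], fun h => absurd h0 h⟩
        · have h1 : ∃ m, (p * ij.1).factorial = ij.1.factorial * (p * m) := by
            obtain ⟨l, hl⟩ := Nat.exists_eq_succ_of_ne_zero h0.ne'
            have h2 : p * ij.1 ≠ 0 := (Nat.mul_pos hp.pos h0).ne'
            have h3 : l ≤ p * ij.1 - 1 := by
              have := Nat.le_mul_of_pos_left ij.1 hp.pos
              omega
            obtain ⟨m, hm⟩ := Nat.factorial_dvd_factorial h3
            refine ⟨m, ?_⟩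
            rw [← Nat.mul_factorial_pred h2, hm, hl, Nat.succ_eq_add_one, Nat.factorial_succ]
            ring
          obtain ⟨m, hm⟩ := h1
          refine ⟨p * m, ?_, fun _ => dvd_mul_right _ _⟩
          rw [mul_comm (b ^ p), map_mul, dp_mul, mul_assoc]
          congr 1
          symm
          apply dp_eq
          rw [← mul_assoc, ← Nat.cast_mul, ← hm, factorial_mul_dp, map_pow, ← pow_mul]
      obtain ⟨m, hm, hm'⟩ := hpow
      rcases Nat.eq_zero_or_pos ij.1 with h0 | h0
      · obtain ⟨w, rfl⟩ := hz' (by omega)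
        refine ⟨i c ^ ij.1 * m * dp (p * ij.1) (i b) * i w, ?_, ?_⟩
        · exact Subring.mul_mem _ (Subring.mul_mem _ (Subring.mul_mem _
            (Subring.pow_mem _ (map_mem_pdHull' _) _) (natCast_mem _ _)) (dp_mem _ hb))
            (map_mem_pdHull' _)
        · rw [hm, hz, map_mul, map_natCast]; ring
      · obtain ⟨m', rfl⟩ := hm' h0.ne'
        refine ⟨i c ^ ij.1 * m' * dp (p * ij.1) (i b) * i z, ?_, ?_⟩
        · exact Subring.mul_mem _ (Subring.mul_mem _ (Subring.mul_mem _
            (Subring.pow_mem _ (map_mem_pdHull' _) _) (natCast_mem _ _)) (dp_mem _ hb))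
            (map_mem_pdHull' _)
        · rw [hm, hz]; push_cast; ring
    choose! z hz hz' using this
    refine ⟨∑ ij ∈ Finset.HasAntidiagonal.antidiagonal n, z ij, Subring.sum_mem _ hz, ?_⟩
    rw [Finset.mul_sum]
    exact Finset.sum_congr rfl hz'
  have hle : pdHullIdeal i J ≤ (Ideal.span {(p : pdHull i J)}).comap (mapHull g hg) := by
    rw [pdHullIdeal, Ideal.span_le]
    rintro x ⟨n, a, hn, ha, hx⟩
    obtain ⟨z, hz, hz'⟩ := key n a hn ha
    refine Ideal.mem_span_singleton.2 ⟨⟨z, hz⟩, ?_⟩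
    ext1
    change g (x : B') = _
    rw [hx, hz']
    push_cast
    rfl
  exact Ideal.mem_span_singleton.1 (hle hx)

theorem derivation_mem {R : Type u} [CommRing R] [Algebra R B'] (δ : B → B)
    (D : Derivation R B' B') (hD : ∀ x, i (δ x) = D (i x)) {x : B'} (hx : x ∈ pdHull i J) :
    D x ∈ pdHull i J := by
  induction hx using Subring.closure_induction with
  | mem x hx =>
    rcases hx with ⟨s, rfl⟩ | ⟨n, a, ha, rfl⟩
    · rw [← hD]; exact map_mem_pdHull' _
    · cases n with
      | zero => rw [dp_zero, Derivation.map_one_eq_zero]; exact Subring.zero_mem _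
      | succ n =>
        have : D (dp (n + 1) (i a)) = dp n (i a) * i (δ a) := by
          apply natCast_mul_cancel (n + 1).factorial_ne_zero
          have h := congrArg D (factorial_mul_dp (n + 1) (i a))
          rw [← nsmul_eq_mul, map_nsmul, nsmul_eq_mul, Derivation.leibniz_pow] at h
          rw [h, Nat.factorial_succ, hD, Nat.add_sub_cancel, ← factorial_mul_dp n]
          simp only [nsmul_eq_mul, smul_eq_mul]
          push_cast
          ring
        rw [this]
        exact Subring.mul_mem _ (dp_mem _ ha) (map_mem_pdHull' _)
  | zero => rw [map_zero]; exact Subring.zero_mem _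
  | one => rw [Derivation.map_one_eq_zero]; exact Subring.zero_mem _
  | add x y _ _ hx hy => rw [map_add]; exact Subring.add_mem _ hx hy
  | neg x _ hx => rw [map_neg]; exact Subring.neg_mem _ hx
  | mul x y hx' hy' hx hy =>
    rw [Derivation.leibniz]
    exact Subring.add_mem _ (Subring.mul_mem _ hx' hy) (Subring.mul_mem _ hy' hx)

/-- The additive endomorphism of `pdHull i J` induced by a derivation. -/
def derHull {R : Type u} [CommRing R] [Algebra R B'] (D : Derivation R B' B')
    (hD : ∀ x ∈ pdHull i J, D x ∈ pdHull i J) : pdHull i J →+ pdHull i J where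
  toFun x := ⟨D x, hD x x.2⟩
  map_zero' := by ext1; simp
  map_add' x y := by ext1; simp

/-- If `i' : A → A'` is an injective homomorphism to a `ℚ`-algebra and `q : B → A`, `q' : B' → A'`
are compatible homomorphisms with `q (J) ⊆ p A`, then `q'` sends `pdHull i J` into `A`. -/
theorem proj_mem {A A' : Type u} [CommRing A] [CommRing A'] [Algebra ℚ A'] (i' : A →+* A')
    (hA : HasPPowDivFactorial p A) (q : B →+* A) (q' : B' →+* A') (hq : ∀ x, q' (i x) = i' (q x))
    (hJ : ∀ a ∈ J, (p : A) ∣ q a) {x : B'} (hx : x ∈ pdHull i J) : q' x ∈ i'.range := by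
  induction hx using Subring.closure_induction with
  | mem x hx =>
    rcases hx with ⟨s, rfl⟩ | ⟨n, a, ha, rfl⟩
    · exact ⟨q s, (hq s).symm⟩
    · obtain ⟨y, hy⟩ := hJ a ha
      obtain ⟨z, hz, -⟩ := exists_dp_p i' hA n y
      exact ⟨z, by rw [map_dp, hq, hy, hz]⟩
  | zero => rw [map_zero]; exact Subring.zero_mem _
  | one => rw [map_one]; exact Subring.one_mem _
  | add x y _ _ hx hy => rw [map_add]; exact Subring.add_mem _ hx hy
  | neg x _ hx => rw [map_neg]; exact Subring.neg_mem _ hx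
  | mul x y _ _ hx hy => rw [map_mul]; exact Subring.mul_mem _ hx hy

/-- The homomorphism `pdHull i J → A` that extends `q : B → A`; it is the restriction of `q'`. -/
def projHull {A A' : Type u} [CommRing A] [CommRing A'] (i' : A →+* A')
    (hi : Function.Injective i') (q' : B' →+* A') (hq : ∀ x ∈ pdHull i J, q' x ∈ i'.range) :
    pdHull i J →+* A :=
  (((RingEquiv.ofBijective i'.rangeRestrict
    ⟨fun _ _ h => hi (congrArg Subtype.val h), i'.rangeRestrict_surjective⟩).symm : i'.range ≃+* A) :
      i'.range →+* A).comp
    ((q'.comp (pdHull i J).subtype).codRestrict i'.range fun x => hq x x.2)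

theorem projHull_spec {A A' : Type u} [CommRing A] [CommRing A'] (i' : A →+* A')
    (hi : Function.Injective i') (q' : B' →+* A') (hq : ∀ x ∈ pdHull i J, q' x ∈ i'.range)
    (x : pdHull i J) : i' (projHull i' hi q' hq x) = q' x := by
  have := (RingEquiv.ofBijective i'.rangeRestrict
    ⟨fun _ _ h => hi (congrArg Subtype.val h), i'.rangeRestrict_surjective⟩).apply_symm_apply
    (((q'.comp (pdHull i J).subtype).codRestrict i'.range fun x => hq x x.2) x)
  exact congrArg Subtype.val this

end Hull

/-! ### `p`-adic completion -/

section Completion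

variable (p : ℕ) {B C : Type u} [CommRing B] [CommRing C]

/-- The `p`-adic completion of a ring. -/
abbrev PCompl (p : ℕ) (B : Type u) [CommRing B] : Type u :=
  AdicCompletion (Ideal.span {(p : B)}) B

theorem span_pow_le_comap (f : B →+* C) (n : ℕ) :
    Ideal.span {(p : B)} ^ n ≤ (Ideal.span {(p : C)} ^ n).comap f := by
  rw [← Ideal.map_le_iff_le_comap, Ideal.map_pow, Ideal.map_span]
  simp

theorem complMap_compat (f : B →+* C) {m n : ℕ} (hle : m ≤ n) :
    (Ideal.Quotient.factorPow (Ideal.span {(p : C)}) hle).comp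
      ((Ideal.quotientMap (Ideal.span {(p : C)} ^ n) f (span_pow_le_comap p f n)).comp
        (AdicCompletion.evalₐ (Ideal.span {(p : B)}) n).toRingHom) =
      (Ideal.quotientMap (Ideal.span {(p : C)} ^ m) f (span_pow_le_comap p f m)).comp
        (AdicCompletion.evalₐ (Ideal.span {(p : B)}) m).toRingHom := by
  ext x
  obtain ⟨a, rfl⟩ := AdicCompletion.mk_surjective _ _ x
  have h := congrArg (Ideal.quotientMap (Ideal.span {(p : C)} ^ m) f (span_pow_le_comap p f m))
    (AdicCompletion.Ideal.mk_eq_mk _ hle a)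
  simp only [RingHom.comp_apply, AlgHom.toRingHom_eq_coe, RingHom.coe_coe,
    AdicCompletion.evalₐ_mk]
  exact h

/-- The homomorphism of `p`-adic completions induced by a ring homomorphism. -/
def complMap (f : B →+* C) : PCompl p B →+* PCompl p C :=
  AdicCompletion.liftRingHom (Ideal.span {(p : C)})
    (fun n => (Ideal.quotientMap (Ideal.span {(p : C)} ^ n) f (span_pow_le_comap p f n)).comp
      (AdicCompletion.evalₐ (Ideal.span {(p : B)}) n).toRingHom) (complMap_compat p f)

theorem evalₐ_complMap (f : B →+* C) (n : ℕ) (x : PCompl p B) :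
    AdicCompletion.evalₐ _ n (complMap p f x) =
      Ideal.quotientMap (Ideal.span {(p : C)} ^ n) f (span_pow_le_comap p f n)
        (AdicCompletion.evalₐ _ n x) :=
  AdicCompletion.evalₐ_liftRingHom (Ideal.span {(p : C)}) _ (complMap_compat p f) n x

theorem complMap_of (f : B →+* C) (x : B) :
    complMap p f (AdicCompletion.of _ _ x) = AdicCompletion.of _ _ (f x) := by
  apply AdicCompletion.ext_evalₐ
  intro n
  rw [evalₐ_complMap, AdicCompletion.evalₐ_of, AdicCompletion.evalₐ_of]
  rfl

theorem addMap_le (f : B →+ B) (n : ℕ) :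
    (Ideal.span {(p : B)} ^ n • (⊤ : Submodule B B)).toAddSubgroup ≤
      (Ideal.span {(p : B)} ^ n • (⊤ : Submodule B B)).toAddSubgroup.comap f := by
  intro y hy
  simp only [Submodule.mem_toAddSubgroup, AddSubgroup.mem_comap, smul_eq_mul, Ideal.mul_top,
    Ideal.span_singleton_pow, Ideal.mem_span_singleton] at hy ⊢
  obtain ⟨b, rfl⟩ := hy
  refine ⟨f b, ?_⟩
  have : ∀ z : B, (p : B) ^ n * z = (p ^ n) • z := fun z => by simp
  rw [this, this, map_nsmul]

/-- The additive endomorphism of `B / p^n B` induced by an additive endomorphism of `B`. -/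
def levelAddMap (f : B →+ B) (n : ℕ) :
    B ⧸ (Ideal.span {(p : B)} ^ n • (⊤ : Submodule B B)) →+
      B ⧸ (Ideal.span {(p : B)} ^ n • (⊤ : Submodule B B)) :=
  QuotientAddGroup.map _ _ f (addMap_le p f n)

theorem levelAddMap_mk (f : B →+ B) (n : ℕ) (b : B) :
    levelAddMap p f n (Submodule.Quotient.mk b) = Submodule.Quotient.mk (f b) := rfl

theorem levelAddMap_compat (f : B →+ B) {m n : ℕ} (hmn : m ≤ n)
    (y : B ⧸ (Ideal.span {(p : B)} ^ n • (⊤ : Submodule B B))) :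
    AdicCompletion.transitionMap (Ideal.span {(p : B)}) B hmn (levelAddMap p f n y) =
      levelAddMap p f m (AdicCompletion.transitionMap (Ideal.span {(p : B)}) B hmn y) := by
  obtain ⟨b, rfl⟩ := Submodule.Quotient.mk_surjective _ y
  have t : ∀ c : B, AdicCompletion.transitionMap (Ideal.span {(p : B)}) B hmn
      (Submodule.Quotient.mk c) = Submodule.Quotient.mk c := fun c => Submodule.factor_mk _ c
  rw [levelAddMap_mk, t, t, levelAddMap_mk]

/-- The additive endomorphism of the `p`-adic completion induced by an additive endomorphism
of the ring. -/
def complAddMap (f : B →+ B) : PCompl p B →+ PCompl p B where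
  toFun x := ⟨fun n => levelAddMap p f n (x.val n), fun {m n} hmn =>
    (levelAddMap_compat p f hmn (x.val n)).trans (congrArg (levelAddMap p f m) (x.2 hmn))⟩
  map_zero' := AdicCompletion.ext fun n => map_zero (levelAddMap p f n)
  map_add' x y := AdicCompletion.ext fun n => map_add (levelAddMap p f n) (x.val n) (y.val n)

theorem complAddMap_of (f : B →+ B) (x : B) :
    complAddMap p f (AdicCompletion.of _ _ x) = AdicCompletion.of _ _ (f x) :=
  AdicCompletion.ext fun n => levelAddMap_mk p f n x

theorem compl_torsionFree (hB : ∀ x : B, (p : B) * x = 0 → x = 0) (x : PCompl p B)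
    (hx : (p : PCompl p B) * x = 0) : x = 0 := by
  apply AdicCompletion.ext_evalₐ
  intro n
  obtain ⟨a, rfl⟩ := AdicCompletion.mk_surjective _ _ x
  have h := congrArg (AdicCompletion.evalₐ (Ideal.span {(p : B)}) (n + 1)) hx
  have h2 := AdicCompletion.Ideal.mk_eq_mk (Ideal.span {(p : B)}) (Nat.le_succ n) a
  rw [map_mul, map_natCast, map_zero, AdicCompletion.evalₐ_mk, ← map_natCast (Ideal.Quotient.mk _),
    ← map_mul, Ideal.Quotient.eq_zero_iff_mem, Ideal.span_singleton_pow,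
    Ideal.mem_span_singleton] at h
  obtain ⟨b, hb⟩ := h
  have h3 : a (n + 1) = (p : B) ^ n * b := by
    have := hB (a (n + 1) - (p : B) ^ n * b) (by rw [mul_sub, hb]; ring)
    exact sub_eq_zero.1 this
  rw [map_zero, AdicCompletion.evalₐ_mk, ← h2]
  change Ideal.Quotient.mk _ (a (n + 1)) = 0
  rw [Ideal.Quotient.eq_zero_iff_mem, Ideal.span_singleton_pow, Ideal.mem_span_singleton, h3]
  exact dvd_mul_right _ _

/-- If `f` sends the ideal `I` into the multiples of `p`, then its completion sends the kernel of
`B^ → (B/I)^` into the multiples of `p`. -/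
theorem dvd_complMap (f : B →+* B) (I : Ideal B) (hf : ∀ x ∈ I, (p : B) ∣ f x) (x : PCompl p B)
    (hx : x ∈ RingHom.ker (complMap p (Ideal.Quotient.mk I))) :
    (p : PCompl p B) ∣ complMap p f x := by
  obtain ⟨b, hb⟩ := Ideal.Quotient.mk_surjective (AdicCompletion.evalₐ (Ideal.span {(p : B)}) 1 x)
  have h1 := congrArg (AdicCompletion.evalₐ (Ideal.span {(p : B ⧸ I)}) 1) (RingHom.mem_ker.1 hx)
  rw [evalₐ_complMap, ← hb, map_zero, Ideal.quotientMap_mk, Ideal.Quotient.eq_zero_iff_mem, pow_one,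
    Ideal.mem_span_singleton] at h1
  obtain ⟨c, hc⟩ := h1
  obtain ⟨c, rfl⟩ := Ideal.Quotient.mk_surjective c
  rw [← map_natCast (Ideal.Quotient.mk I), ← map_mul, Ideal.Quotient.eq] at hc
  have h2 : x - AdicCompletion.of _ _ b ∈
      RingHom.ker (AdicCompletion.evalOneₐ (Ideal.span {(p : B)})).toRingHom := by
    rw [RingHom.mem_ker]
    change AdicCompletion.evalOneₐ _ _ = 0
    rw [← AdicCompletion.factorₐ_evalₐ_one, map_sub, ← hb, AdicCompletion.evalₐ_of, sub_self,
      map_zero]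
  replace h2 := (AdicCompletion.ker_evalOneₐ_eq_map
    (I := Ideal.span {(p : B)}) (Submodule.fg_span_singleton _)).le h2
  rw [Ideal.map_span, Set.image_singleton, map_natCast, Ideal.mem_span_singleton] at h2
  obtain ⟨y, hy⟩ := h2
  rw [eq_add_of_sub_eq' hy, map_add, map_mul, map_natCast, complMap_of]
  refine dvd_add ?_ (dvd_mul_right _ _)
  have h3 : (p : B) ∣ f b := by
    have h4 := hf _ hc
    rw [map_sub, map_mul, map_natCast] at h4
    exact (dvd_sub_left (dvd_mul_right _ _)).1 h4
  obtain ⟨e, he⟩ := h3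
  refine ⟨AdicCompletion.of _ _ e, ?_⟩
  rw [he]
  have : ∀ z : B, AdicCompletion.of (Ideal.span {(p : B)}) B z =
    algebraMap B (PCompl p B) z := fun z => rfl
  rw [this, this, map_mul, map_natCast]

end Completion

/-! ### The frame `S_r` with its extra structures -/

section Cyclotomic

variable (p : ℕ) [Fact p.Prime] (k : Type u) [Field k] [CharP k p] [PerfectRing k p] (d r : ℕ)

/-- The field `F = W(k)[1/p]`. -/
abbrev FF : Type u := FractionRing (WittVector p k)

/-- The ring `𝔖 = W(k)[[u, t_1, …, t_d]]`. -/
abbrev SS : Type u := PS d (WittVector p k)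

/-- The ring `F[[u, t_1, …, t_d]]`, which contains `𝔖[1/p]`. -/
abbrev SF : Type u := PS d (FF p k)

/-- The inclusion `𝔖 → F[[u, t_1, …, t_d]]`. -/
abbrev incl : SS p k d →+* SF p k d := psMap d (algebraMap (WittVector p k) (FF p k))

/-- The canonical homomorphism `ℤ_p → W(k)`. -/
def zpToW : ℤ_[p] →+* WittVector p k :=
  (WittVector.map (ZMod.castHom (dvd_refl p) k)).comp (WittVector.fromPadicInt p)

/-- The ideal `E_r 𝔖`. -/
def idealE : Ideal (SS p k d) := Ideal.span {cycE d p (WittVector p k) r}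

instance charZero_W : CharZero (WittVector p k) := by
  obtain ⟨q, hq⟩ := CharP.exists (WittVector p k)
  rcases CharP.char_is_prime_or_zero (WittVector p k) q with h | h
  · exfalso
    have h0 : ((q : ℕ) : WittVector p k) = 0 := CharP.cast_eq_zero _ _
    have h1 : ((q : ℕ) : k) = 0 := by
      rw [← map_natCast (WittVector.constantCoeff (p := p) (R := k)), h0, map_zero]
    have h2 : p ∣ q := (CharP.cast_eq_zero_iff k p q).1 h1
    have h3 : p = q := (Nat.prime_dvd_prime_iff_eq Fact.out h).1 h2
    subst h3
    exact WittVector.p_nonzero p k h0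
  · subst h
    exact CharP.charP_to_charZero _

instance charZero_F : CharZero (FF p k) :=
  charZero_of_injective_algebraMap (IsFractionRing.injective (WittVector p k) (FF p k))

/-- The divided power envelope of the ideal `E_r 𝔖` of `𝔖`. As `p, E_r` is a regular sequence in
`𝔖`, the envelope has no `p`-torsion, and it is the `𝔖`-subalgebra of
`𝔖[1/p] ⊆ F[[u, t_1, …, t_d]]` generated by the elements `a ^ n / n!` with `a ∈ E_r 𝔖`. -/
abbrev PD : Type u := pdHull (incl p k d) (idealE p k d r)

/-- The divided power ideal of the envelope, with quotient `𝔖 / E_r 𝔖 = R_r`. -/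
abbrev pdIdeal : Ideal (PD p k d r) := pdHullIdeal (incl p k d) (idealE p k d r)

/-- The Frobenius of `𝔖`. -/
def phiSS : SS p k d →+* SS p k d := frob p d WittVector.frobenius

/-- The Frobenius of `F[[u, t_1, …, t_d]]`. -/
def phiSF : SF p k d →+* SF p k d := frob p d (WittVector.FractionRing.frobeniusRingHom p k)

/-- The endomorphism `1 + u ↦ (1 + u) ^ a` of `𝔖`, for `a ∈ ℤ_p`. -/
def cycSS (a : ℤ_[p]) : SS p k d →+* SS p k d := cyc d (zpToW p k) a

/-- The endomorphism `1 + u ↦ (1 + u) ^ a` of `F[[u, t_1, …, t_d]]`, for `a ∈ ℤ_p`. -/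
def cycSF (a : ℤ_[p]) : SF p k d →+* SF p k d :=
  cyc d ((algebraMap (WittVector p k) (FF p k)).comp (zpToW p k)) a

variable {p k d}

theorem incl_phi (x : SS p k d) : incl p k d (phiSS p k d x) = phiSF p k d (incl p k d x) := by
  apply psMap_frob
  intro x
  exact (IsFractionRing.ringEquivOfRingEquiv_algebraMap (WittVector.frobeniusEquiv p k) x).symm

theorem incl_cyc (a : ℤ_[p]) (x : SS p k d) :
    incl p k d (cycSS p k d a x) = cycSF p k d a (incl p k d x) :=
  psMap_cyc d _ _ a x

theorem X_dvd_phi : (PowerSeries.X : SS p k d) ∣ phiSS p k d PowerSeries.X := by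
  rw [PowerSeries.X_dvd_iff, phiSS, frob_X]
  exact constantCoeff_frobSeries p

theorem X_dvd_cyc (a : ℤ_[p]) : (PowerSeries.X : SS p k d) ∣ cycSS p k d a PowerSeries.X := by
  rw [PowerSeries.X_dvd_iff, cycSS, cyc_X, constantCoeff_onePlusPow]

theorem hasPPow_SS : HasPPowDivFactorial p (SS p k d) :=
  hasPPowDivFactorial p ((PowerSeries.C.comp MvPowerSeries.C).comp (zpToW p k))

theorem hasPPow_A : HasPPowDivFactorial p (MvPowerSeries (Fin d) (WittVector p k)) :=
  hasPPowDivFactorial p (MvPowerSeries.C.comp (zpToW p k))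

/-- An endomorphism of `𝔖` that sends `u` to a multiple of `u` preserves `(p, E_r)`. -/
theorem idealE_stable (f : SS p k d →+* SS p k d)
    (hX : (PowerSeries.X : SS p k d) ∣ f PowerSeries.X) :
    ∀ a ∈ idealE p k d r, ∃ b ∈ idealE p k d r, (p : SS p k d) ∣ f a - b := by
  intro a ha
  obtain ⟨e, rfl⟩ := Ideal.mem_span_singleton.1 ha
  obtain ⟨w, hw⟩ := hX
  obtain ⟨y1, h1⟩ := dvd_geom_sub (p := p) (r - 1) (PowerSeries.X : SS p k d)
  obtain ⟨y2, h2⟩ := dvd_geom_sub (p := p) (r - 1) (f PowerSeries.X)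
  have h3 : f (cycE d p (WittVector p k) r) - (f PowerSeries.X) ^ (p ^ (r - 1) * (p - 1)) =
      (p : SS p k d) * y2 := by rw [← h2, map_cycE]
  have h4 : cycE d p (WittVector p k) r - PowerSeries.X ^ (p ^ (r - 1) * (p - 1)) =
      (p : SS p k d) * y1 := h1
  generalize p ^ (r - 1) * (p - 1) = N at h3 h4
  refine ⟨cycE d p (WittVector p k) r * (w ^ N * f e), Ideal.mem_span_singleton.2 ⟨_, rfl⟩,
    y2 * f e - y1 * w ^ N * f e, ?_⟩
  rw [map_mul, eq_add_of_sub_eq' h3, eq_add_of_sub_eq' h4, hw]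
  ring

/-- The Frobenius sends `E_r` to `E_r ^ p` modulo `p`. -/
theorem idealE_phi : ∀ a ∈ idealE p k d r, ∃ b ∈ idealE p k d r, ∃ c,
    (p : SS p k d) ∣ phiSS p k d a - b ^ p * c := by
  intro a ha
  obtain ⟨e, rfl⟩ := Ideal.mem_span_singleton.1 ha
  refine ⟨_, Ideal.mem_span_singleton_self _, phiSS p k d e, ?_⟩
  obtain ⟨y2, h2⟩ := dvd_geom_sub (p := p) (r - 1) (phiSS p k d PowerSeries.X)
  have h3 : (p : SS p k d) ∣ phiSS p k d (cycE d p (WittVector p k) r) -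
      (phiSS p k d PowerSeries.X) ^ (p ^ (r - 1) * (p - 1)) := ⟨y2, by rw [← h2, map_cycE]⟩
  have h4 : (p : SS p k d) ∣ cycE d p (WittVector p k) r -
      PowerSeries.X ^ (p ^ (r - 1) * (p - 1)) := dvd_geom_sub (p := p) (r - 1) _
  have h5 : (p : SS p k d) ∣ phiSS p k d PowerSeries.X - PowerSeries.X ^ p := by
    obtain ⟨q, hq⟩ := exists_add_pow_prime_eq (Fact.out : p.Prime) (1 : SS p k d) PowerSeries.X
    refine ⟨1 * PowerSeries.X * q, ?_⟩
    rw [phiSS, frob_X, hq]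
    ring
  generalize p ^ (r - 1) * (p - 1) = N at h3 h4
  have h6 := (h5.trans (sub_dvd_pow_sub_pow _ _ N))
  have h7 := (h4.trans (sub_dvd_pow_sub_pow _ _ p))
  have h8 : (p : SS p k d) ∣ phiSS p k d (cycE d p (WittVector p k) r) -
      cycE d p (WittVector p k) r ^ p := by
    have := dvd_sub (dvd_add h3 h6) h7
    convert this using 1
    ring
  rw [map_mul, ← sub_mul]
  exact h8.mul_right _

theorem proj_idealE : ∀ a ∈ idealE p k d r,
    ((p : ℕ) : MvPowerSeries (Fin d) (WittVector p k)) ∣ PowerSeries.constantCoeff a := by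
  intro a ha
  obtain ⟨e, rfl⟩ := Ideal.mem_span_singleton.1 ha
  rw [map_mul]
  refine Dvd.dvd.mul_right ?_ _
  simp [cycE]

theorem map_algebraMap_injective : Function.Injective
    (MvPowerSeries.map (σ := Fin d) (algebraMap (WittVector p k) (FF p k))) := by
  intro x y h
  refine MvPowerSeries.ext fun n => ?_
  have := congrArg (MvPowerSeries.coeff n) h
  rw [MvPowerSeries.coeff_map, MvPowerSeries.coeff_map] at this
  exact IsFractionRing.injective (WittVector p k) (FF p k) this

theorem constantCoeff_incl (x : SS p k d) : PowerSeries.constantCoeff (incl p k d x) =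
    MvPowerSeries.map (algebraMap (WittVector p k) (FF p k)) (PowerSeries.constantCoeff x) := by
  rw [← PowerSeries.coeff_zero_eq_constantCoeff_apply,
    ← PowerSeries.coeff_zero_eq_constantCoeff_apply, PowerSeries.coeff_map]

variable (p k d)

/-- The Frobenius of the divided power envelope. -/
def phiPD : PD p k d r →+* PD p k d r :=
  mapHull (phiSF p k d) fun _ hx =>
    map_mem_pdHull hasPPow_SS (phiSS p k d) _ incl_phi (idealE_stable r _ X_dvd_phi) hx

/-- The endomorphism `1 + u ↦ (1 + u) ^ a` of the divided power envelope, for `a ∈ ℤ_p`. -/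
def cycPD (a : ℤ_[p]) : PD p k d r →+* PD p k d r :=
  mapHull (cycSF p k d a) fun _ hx =>
    map_mem_pdHull hasPPow_SS (cycSS p k d a) _ (incl_cyc a) (idealE_stable r _ (X_dvd_cyc a)) hx

/-- The derivation `d/du` of the divided power envelope; it sends `a ^ n / n!` to
`a ^ (n - 1) / (n - 1)! * da/du`. -/
def derPD : PD p k d r →+ PD p k d r :=
  derHull (PowerSeries.derivative (MvPowerSeries (Fin d) (FF p k))) fun _ hx =>
    derivation_mem _ _ (psMap_derivative d (algebraMap (WittVector p k) (FF p k))) hx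

/-- The homomorphism from the divided power envelope to `𝔖 / u𝔖 = W(k)[[t_1, …, t_d]]` that
extends `u ↦ 0`. -/
def projPD : PD p k d r →+* MvPowerSeries (Fin d) (WittVector p k) :=
  projHull (MvPowerSeries.map (algebraMap (WittVector p k) (FF p k))) map_algebraMap_injective
    PowerSeries.constantCoeff fun _ hx =>
      proj_mem _ hasPPow_A PowerSeries.constantCoeff _ constantCoeff_incl (proj_idealE r) hx

/-- The ring `S_r`, the `p`-adic completion of the divided power envelope of `E_r 𝔖 ⊆ 𝔖`. -/
def SR : Type u := PCompl p (PD p k d r)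

instance : CommRing (SR p k d r) := inferInstanceAs (CommRing (PCompl p (PD p k d r)))

/-- The homomorphism `𝔖 → S_r`. -/
def toSR : SS p k d →+* SR p k d r :=
  (algebraMap (PD p k d r) (PCompl p (PD p k d r))).comp
    ((incl p k d).codRestrict _ fun x => map_mem_pdHull' x)

/-- The Frobenius `φ` of `S_r`. -/
def phiSR : SR p k d r →+* SR p k d r := complMap p (phiPD p k d r)

/-- The endomorphism of `S_r` with `1 + u ↦ (1 + u) ^ a` and `t_i ↦ t_i`, for `a ∈ ℤ_p`. -/
def cycSR (a : ℤ_[p]) : SR p k d r →+* SR p k d r := complMap p (cycPD p k d r a)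

/-- The derivation `d/du` of `S_r`. -/
def derSR : SR p k d r →+ SR p k d r := complAddMap p (derPD p k d r)

/-- `Fil¹ S_r`, the kernel of `S_r → R_r = 𝔖 / E_r 𝔖`. -/
def filSR : Ideal (SR p k d r) :=
  RingHom.ker (complMap p (Ideal.Quotient.mk (pdIdeal p k d r)))

/-- The kernel of the homomorphism `S_r → 𝔖 / u𝔖 = W(k)[[t_1, …, t_d]]`, `u ↦ 0`. -/
def kerU : Ideal (SR p k d r) := RingHom.ker (complMap p (projPD p k d r))

variable {p k d r}

theorem p_mul_cancel {x y : SR p k d r} (h : (p : SR p k d r) * x = p * y) : x = y := by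
  refine sub_eq_zero.1 (compl_torsionFree p (B := PD p k d r) ?_ (x - y) ?_)
  · intro z hz
    ext1
    apply natCast_mul_cancel (Fact.out : p.Prime).ne_zero
    have := congrArg Subtype.val hz
    simpa using this
  · exact (mul_sub (p : SR p k d r) x y).trans (sub_eq_zero.2 h)

theorem p_dvd_phi (x : filSR p k d r) :
    ∃ y : SR p k d r, phiSR p k d r x = p * y :=
  dvd_complMap p (phiPD p k d r) (pdIdeal p k d r)
    (fun _ hx => dvd_mapHull (Fact.out : p.Prime) hasPPow_SS (phiSS p k d) _ incl_phi
      (idealE_phi r) _ hx) x.1 x.2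

variable (p k d r)

/-- The `φ`-linear map `φ_1 = p⁻¹ φ : Fil¹ S_r → S_r`. -/
def phi1SR : filSR p k d r →ₛₗ[phiSR p k d r] SR p k d r where
  toFun x := (p_dvd_phi x).choose
  map_add' x y := p_mul_cancel (by
    rw [mul_add, ← (p_dvd_phi (x + y)).choose_spec, ← (p_dvd_phi x).choose_spec,
      ← (p_dvd_phi y).choose_spec, ← map_add]
    rfl)
  map_smul' c x := p_mul_cancel (by
    rw [← (p_dvd_phi (c • x)).choose_spec, smul_eq_mul, mul_left_comm,
      ← (p_dvd_phi x).choose_spec, ← map_mul]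
    rfl)

end Cyclotomic

/-! ### Frames and windows -/

section Windows

/-- The data `(S, Fil¹ S, φ, φ_1, ϖ)` of a frame that enter the definition of windows. -/
structure FrameData (S : Type u) [CommRing S] where
  /-- the ideal `Fil¹ S` -/
  fil : Ideal S
  /-- the Frobenius lift -/
  φ : S →+* S
  /-- the divided Frobenius -/
  φ₁ : fil →ₛₗ[φ] S
  /-- the element `ϖ` -/
  ϖ : S
  φ_eq : ∀ s : fil, φ s = ϖ * φ₁ s

variable {S : Type u} [CommRing S]

/-- A window over a frame. -/
structure Window (𝓢 : FrameData S) where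
  /-- the underlying finite projective module -/
  M : Type u
  [addCommGroup : AddCommGroup M]
  [module : Module S M]
  [finite : Module.Finite S M]
  [projective : Module.Projective S M]
  /-- the submodule `Fil¹ M` -/
  fil : Submodule S M
  /-- the `φ`-linear map `Φ` -/
  Φ : M →ₛₗ[𝓢.φ] M
  /-- the `φ`-linear map `Φ_1` -/
  Φ₁ : fil →ₛₗ[𝓢.φ] M
  exists_normal_decomposition : ∃ L N : Submodule S M, IsCompl L N ∧ fil = L ⊔ 𝓢.fil • N
  Φ₁_smul : ∀ (s : 𝓢.fil) (m : M) (h : (s : S) • m ∈ fil), Φ₁ ⟨(s : S) • m, h⟩ = 𝓢.φ₁ s • Φ m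
  Φ_eq : ∀ m : fil, Φ m = 𝓢.ϖ • Φ₁ m
  span_eq_top : Submodule.span S (Set.range Φ₁ ∪ Set.range Φ) = ⊤

attribute [instance] Window.addCommGroup Window.module Window.finite Window.projective

/-- A homomorphism of windows: a linear map that preserves the filtrations and commutes with `Φ`
and with `Φ_1`. -/
@[ext]
structure Window.Hom {𝓢 : FrameData S} (P Q : Window 𝓢) where
  /-- the underlying linear map -/
  lin : P.M →ₗ[S] Q.M
  map_fil : ∀ m ∈ P.fil, lin m ∈ Q.fil
  map_Φ : ∀ m, lin (P.Φ m) = Q.Φ (lin m)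
  map_Φ₁ : ∀ m : P.fil, lin (P.Φ₁ m) = Q.Φ₁ ⟨lin m, map_fil m m.2⟩

/-- The identity homomorphism. -/
def Window.Hom.id {𝓢 : FrameData S} (P : Window 𝓢) : Window.Hom P P where
  lin := LinearMap.id
  map_fil _ h := h
  map_Φ _ := rfl
  map_Φ₁ _ := rfl

/-- The composition `g ∘ f`. -/
def Window.Hom.comp {𝓢 : FrameData S} {P Q R : Window 𝓢} (g : Window.Hom Q R) (f : Window.Hom P Q) :
    Window.Hom P R where
  lin := g.lin.comp f.lin
  map_fil m h := g.map_fil _ (f.map_fil m h)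
  map_Φ m := by simp [f.map_Φ, g.map_Φ]
  map_Φ₁ m := by simp [f.map_Φ₁, g.map_Φ₁]

end Windows

/-! ### The cyclotomic Galois groups -/

section Galois

variable (p : ℕ) [Fact p.Prime] (k : Type u) [Field k] [CharP k p] [PerfectRing k p]

/-- The field `F_∞`, generated over `F` by all `p`-power roots of unity. -/
abbrev Finf : IntermediateField (FF p k) (AlgebraicClosure (FF p k)) :=
  IntermediateField.adjoin (FF p k) {ζ | ∃ n : ℕ, ζ ^ p ^ n = 1}

/-- The field `F_r = F(μ_{p^r})` as a subfield of `F_∞`. -/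
def Fr (r : ℕ) : IntermediateField (FF p k) (Finf p k) :=
  IntermediateField.adjoin (FF p k) {ζ | ζ ^ p ^ r = 1}

/-- The group `Γ_r = Gal(F_∞ / F_r)` as a subgroup of `Γ_0 = Gal(F_∞ / F)`. -/
def Gam (r : ℕ) : Subgroup (Finf p k ≃ₐ[FF p k] Finf p k) := (Fr p k r).fixingSubgroup

variable {p k}

/-- The `p`-adic cyclotomic character. -/
def chi (γ : Finf p k ≃ₐ[FF p k] Finf p k) : ℤ_[p] :=
  (cyclotomicCharacter (Finf p k) p (γ : Finf p k ≃+* Finf p k) : ℤ_[p]ˣ)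

end Galois

/-! ### Windows over `S_r` with a strict action and with a connection -/

section Categories

variable (p : ℕ) [Fact p.Prime] (k : Type u) [Field k] [CharP k p] [PerfectRing k p] (d r : ℕ)

/-- The frame `(S_r, Fil¹ S_r, φ, φ_1 = p⁻¹ φ, p)`. -/
def frameSR : FrameData (SR p k d r) where
  fil := filSR p k d r
  φ := phiSR p k d r
  φ₁ := phi1SR p k d r
  ϖ := p
  φ_eq s := (p_dvd_phi s).choose_spec

variable {p k} in
/-- The action of `γ ∈ Γ_0` on `S_r`, with `γ(1 + u) = (1 + u)^{χ(γ)}` and `γ(t_i) = t_i`. -/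
def gamSR (γ : Finf p k ≃ₐ[FF p k] Finf p k) : SR p k d r →+* SR p k d r :=
  cycSR p k d r (chi γ)

/-- An `S_r`-window with an action of `Γ_r` by window automorphisms over the action on `S_r`
which is strict: the induced action on `M ⊗_{S_r} 𝔖/u𝔖 = M / ker(S_r → 𝔖/u𝔖) M` is trivial. -/
structure GammaWindow extends Window (frameSR p k d r) where
  /-- the action -/
  act : Gam p k r →* AddMonoid.End M
  act_smul : ∀ (γ : Gam p k r) (s : SR p k d r) (m : M),
    act γ (s • m) = gamSR d r (γ : Finf p k ≃ₐ[FF p k] Finf p k) s • act γ m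
  act_fil : ∀ (γ : Gam p k r), ∀ m ∈ fil, act γ m ∈ fil
  act_Φ : ∀ (γ : Gam p k r) (m : M), act γ (Φ m) = Φ (act γ m)
  act_Φ₁ : ∀ (γ : Gam p k r) (m : fil), act γ (Φ₁ m) = Φ₁ ⟨act γ m, act_fil γ m m.2⟩
  strict : ∀ (γ : Gam p k r) (m : M), act γ m - m ∈ kerU p k d r • (⊤ : Submodule (SR p k d r) M)

variable {p k d r}

/-- A homomorphism of windows with an action of `Γ_r`: an equivariant homomorphism of windows. -/
@[ext]
structure GammaWindow.Hom (P Q : GammaWindow p k d r) extends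
    toWindowHom : Window.Hom P.toWindow Q.toWindow where
  map_act : ∀ (γ : Gam p k r) (m : P.M), lin (P.act γ m) = Q.act γ (lin m)

instance : Category (GammaWindow p k d r) where
  Hom P Q := GammaWindow.Hom P Q
  id P := { Window.Hom.id P.toWindow with map_act := fun _ _ => rfl }
  comp f g :=
    { Window.Hom.comp g.toWindowHom f.toWindowHom with
      map_act := fun γ m => by simp [Window.Hom.comp, f.map_act, g.map_act] }

/-- The image in `S_r` of the variable `u` of `𝔖`. -/
def uSR : SR p k d r := toSR p k d r PowerSeries.X

variable (p k d r)

/-- An `S_r`-window with a strict action of `Γ_r` and a connection `∇_0 : M → M ⊗_𝔖 Ω_0` over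
`d : S_r → S_r ⊗_𝔖 Ω_0`, with respect to which `Φ` and the action of `Γ_r` are horizontal.
Here `Ω_0 = 𝔖 du`, and the connection is written as `∇_0(m) = N(m) ⊗ du`. The map
`dφ : Ω_0 → Ω_0` sends `du` to `d(φ(u)) = (d/du)(φ(u)) du`, hence the relation
`∇_0 ∘ Φ = (Φ ⊗ dφ) ∘ ∇_0` is `N(Φ(m)) = (d/du)(φ(u)) Φ(N(m))`, and similarly for `γ ∈ Γ_r`. -/
structure ConnGammaWindow extends GammaWindow p k d r where
  /-- the coefficient of `du` in the connection -/
  N : M →+ M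
  leibniz : ∀ (s : SR p k d r) (m : M), N (s • m) = derSR p k d r s • m + s • N m
  horizontal_Φ : ∀ m : M, N (Φ m) = derSR p k d r (phiSR p k d r uSR) • Φ (N m)
  horizontal_act : ∀ (γ : Gam p k r) (m : M), N (act γ m) =
    derSR p k d r (gamSR d r (γ : Finf p k ≃ₐ[FF p k] Finf p k) uSR) • act γ (N m)

variable {p k d r}

/-- A homomorphism of windows with action and connection: an equivariant homomorphism of windows
that is horizontal, i.e. `(f ⊗ id) ∘ ∇_0 = ∇_0 ∘ f`. -/
@[ext]
structure ConnGammaWindow.Hom (P Q : ConnGammaWindow p k d r) extends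
    toGammaHom : GammaWindow.Hom P.toGammaWindow Q.toGammaWindow where
  map_N : ∀ m : P.M, lin (P.N m) = Q.N (lin m)

instance : Category (ConnGammaWindow p k d r) where
  Hom P Q := ConnGammaWindow.Hom P Q
  id P := { toGammaHom := 𝟙 P.toGammaWindow, map_N := fun _ => rfl }
  comp {P Q R} f g :=
    { toGammaHom := (show P.toGammaWindow ⟶ Q.toGammaWindow from f.toGammaHom) ≫
        (show Q.toGammaWindow ⟶ R.toGammaWindow from g.toGammaHom)
      map_N := fun m => by
        change g.lin (f.lin (P.N m)) = R.N (g.lin (f.lin m))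
        rw [f.map_N, g.map_N] }

variable (p k d r)

/-- The forgetful functor that forgets the connection. -/
def forgetConnection : ConnGammaWindow p k d r ⥤ GammaWindow p k d r where
  obj P := P.toGammaWindow
  map f := f.toGammaHom

end Categories

end CycWin

end

noncomputable section

namespace CycWin

set_option linter.unusedSectionVars false

/-! ### Windows over local rings: normal bases -/

section NormalBases

variable {S : Type u} [CommRing S]

/-! Put ∂ = (1+u) d/du. As 1+u is a unit of S_r, a connection amounts to an operator N on M over ∂.
This derivation is chosen because ∂φ = pφ∂ and ∂γ = χ(γ)γ∂, so horizontality becomes NΦ = pΦN and Nγ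
= χ(γ)γN, with factors fixed by φ. Let U be the kernel of u ↦ 0 on S_r. Two principles carry the
proof.

Rigidity (`DiffFrame.eq_zero`): a semilinear A with AΦ = pΦA and values in U vanishes. Cancelling p
gives AΦ_1 = ΦA on Fil¹; since Φ and Φ_1 generate the module, A has values in the ideal generated by
φ^n(U) for every n. But φ^r(U) lies in Fil¹, hence φ^{r+1}(U) lies in pU, and S_r is p-adically
separated.

Twist (`DiffFrame.mem_of_twist`): irreducibility of cyclotomic polynomials over F gives γ in Γ_r
with χ(γ) = 1 + p^r a, a a unit (`exists_mem_Gam`). By strictness γ is the identity modulo U. If R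
preserves U and Rγ ≡ χ(γ)R modulo U, then p^r a R ≡ 0, so R has values in U because S_r/U has no
p-torsion.

Applied to fN - N'f, the two principles show that every equivariant f is horizontal, which is
fullness. Applied to Nσ - χ(σ)σN, they extend the relation for the single γ to all σ in Γ_r, since
Gal(F_∞/F) is commutative.

For existence, N is first prescribed on a basis so that Nγ ≡ χ(γ)γN modulo U. This means dividing
the ∂-derivatives of the coordinates of (γ-1)b by p^r a modulo U. It is possible because (γ-1)M is
much smaller than UM: the relations with Φ and Φ_1 improve U to the ideals of φ(u), φ²(u), …,
φ^{r-1}(u), and finally to the intersection with Fil¹ (`act_sub_mem_inf`). An element of that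
intersection has linear term in u divisible by p^r (`exists_eulerSR_sub_mem`). This is where p > 2
enters, through E_r'(0) = p^{r-1} · p(p-1)/2. By the twist principle NΦ - pΦN then has values in U,
and adding to N a linear map into UM, obtained from a p-adically convergent series, makes it vanish
(`DiffFrame.exists_der`). -/

theorem mem_smul_top_iff_repr {M ι : Type*} [AddCommGroup M] [Module S M] [Fintype ι]
    (b : Module.Basis ι S M) (K : Ideal S) (x : M) :
    x ∈ K • (⊤ : Submodule S M) ↔ ∀ i, b.repr x i ∈ K := by
  constructor
  · intro hx i
    induction hx using Submodule.smul_induction_on' with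
    | smul s hs m _ => simpa using K.mul_mem_right _ hs
    | add x _ y _ hx hy => simpa using K.add_mem hx hy
  · intro h
    rw [← b.sum_repr x]
    exact Submodule.sum_mem _ fun i _ => Submodule.smul_mem_smul (h i) Submodule.mem_top

variable {𝓢 : FrameData S}

/-- A basis `e` of a window adapted to a normal decomposition, together with the basis formed by
the elements `Φ_1(e_i)` and `Φ(e_j)`. -/
structure Window.NormalBasis (P : Window 𝓢) (ι κ : Type) [Fintype ι] [Fintype κ] where
  /-- the basis adapted to the normal decomposition -/
  e : Module.Basis (ι ⊕ κ) S P.M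
  mem_fil : ∀ y, y ∈ P.fil ↔ ∀ j, e.repr y (Sum.inr j) ∈ 𝓢.fil
  /-- the image of `e` under the divided Frobenius maps -/
  f : Module.Basis (ι ⊕ κ) S P.M
  f_inl : ∀ i (h : e (Sum.inl i) ∈ P.fil), f (Sum.inl i) = P.Φ₁ ⟨e (Sum.inl i), h⟩
  f_inr : ∀ j, f (Sum.inr j) = P.Φ (e (Sum.inr j))

theorem basis_inl_mem_fil {P : Window 𝓢} {ι κ : Type} [Fintype ι] [Fintype κ]
    (e : Module.Basis (ι ⊕ κ) S P.M)
    (he : ∀ y, y ∈ P.fil ↔ ∀ j, e.repr y (Sum.inr j) ∈ 𝓢.fil) (i : ι) :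
    e (Sum.inl i) ∈ P.fil := by
  rw [he]
  intro j
  simp

/-- The value of `Φ_1` in terms of the coordinates with respect to an adapted basis. -/
theorem Φ₁_eq_sum {P : Window 𝓢} {ι κ : Type} [Fintype ι] [Fintype κ]
    (e : Module.Basis (ι ⊕ κ) S P.M)
    (he : ∀ y, y ∈ P.fil ↔ ∀ j, e.repr y (Sum.inr j) ∈ 𝓢.fil) (y : P.fil) :
    P.Φ₁ y = ∑ i, 𝓢.φ (e.repr y (Sum.inl i)) • P.Φ₁ ⟨e (Sum.inl i), basis_inl_mem_fil e he i⟩ +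
      ∑ j, 𝓢.φ₁ ⟨e.repr y (Sum.inr j), (he y).1 y.2 j⟩ • P.Φ (e (Sum.inr j)) := by
  have hmem : ∀ (s : S) (j : κ), s ∈ 𝓢.fil → s • e (Sum.inr j) ∈ P.fil := by
    intro s j hs
    rw [he]
    intro j'
    simp only [map_smul, Module.Basis.repr_self, Finsupp.smul_single, smul_eq_mul, mul_one]
    by_cases h : j = j'
    · subst h; simpa using hs
    · simp [h]
  have hy : y = ∑ i, e.repr y (Sum.inl i) • (⟨e (Sum.inl i), basis_inl_mem_fil e he i⟩ : P.fil) +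
      ∑ j, (⟨e.repr y (Sum.inr j) • e (Sum.inr j), hmem _ j ((he y).1 y.2 j)⟩ : P.fil) := by
    ext1
    have := e.sum_repr (y : P.M)
    rw [Fintype.sum_sum_type] at this
    simpa using this.symm
  conv_lhs => rw [hy]
  rw [map_add, map_sum, map_sum]
  congr 1
  · exact Finset.sum_congr rfl fun i _ => P.Φ₁.map_smulₛₗ _ _
  · exact Finset.sum_congr rfl fun j _ =>
      P.Φ₁_smul ⟨e.repr y (Sum.inr j), (he y).1 y.2 j⟩ (e (Sum.inr j)) _

/-- Over a local ring every window has a normal basis. -/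
theorem Window.exists_normalBasis [IsLocalRing S] (P : Window 𝓢) :
    ∃ a b : ℕ, Nonempty (P.NormalBasis (Fin a) (Fin b)) := by
  obtain ⟨L, N, hLN, hfil⟩ := P.exists_normal_decomposition
  -- Direct summands of a finite projective module are finite projective, hence free over a local
  -- ring.
  have key : ∀ L N : Submodule S P.M, IsCompl L N → Module.Finite S L ∧ Module.Free S L := by
    intro L N h
    have hs : (L.projectionOnto N h).comp L.subtype = LinearMap.id := by
      ext x; simp
    have h1 : Module.Projective S L := Module.Projective.of_split _ _ hs
    have h2 : Module.Finite S L := Module.Finite.of_surjective (L.projectionOnto N h)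
      fun x => ⟨x, LinearMap.congr_fun hs x⟩
    exact ⟨h2, Module.free_of_flat_of_isLocalRing⟩
  obtain ⟨_, _⟩ := key L N hLN
  obtain ⟨_, _⟩ := key N L hLN.symm
  let bL := Module.finBasis S L
  let bN := Module.finBasis S N
  let e := (bL.prod bN).map (L.prodEquivOfIsCompl N hLN)
  have e_inl : ∀ i, e (Sum.inl i) = bL i := fun i => by simp [e]
  have e_inr : ∀ i, e (Sum.inr i) = bN i := fun i => by simp [e]
  have he : ∀ y, y ∈ P.fil ↔ ∀ j, e.repr y (Sum.inr j) ∈ 𝓢.fil := by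
    have hL : ∀ y ∈ L, ∀ j, e.repr y (Sum.inr j) = 0 := by
      intro y hy j
      simp [e, (Submodule.projectionOnto_apply_eq_zero_iff hLN.symm).2 hy]
    intro y
    constructor
    · intro hy j
      rw [hfil] at hy
      obtain ⟨l, hl, n, hn, rfl⟩ := Submodule.mem_sup.1 hy
      rw [map_add, Finsupp.add_apply, hL l hl, zero_add]
      clear hy
      induction hn using Submodule.smul_induction_on' with
      | smul s hs m _ => simpa using 𝓢.fil.mul_mem_right _ hs
      | add x hx' y hy' hx hy =>
        rw [map_add, Finsupp.add_apply]
        exact 𝓢.fil.add_mem hx hy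
    · intro h
      rw [← e.sum_repr y, Fintype.sum_sum_type, hfil]
      refine Submodule.add_mem_sup ?_ ?_
      · refine Submodule.sum_mem _ fun i _ => L.smul_mem _ ?_
        rw [e_inl]; exact (bL i).2
      · refine Submodule.sum_mem _ fun i _ => Submodule.smul_mem_smul (h i) ?_
        rw [e_inr]; exact (bN i).2
  let v : Fin (Module.finrank S L) ⊕ Fin (Module.finrank S N) → P.M :=
    Sum.elim (fun i => P.Φ₁ ⟨e (Sum.inl i), basis_inl_mem_fil e he i⟩)
      (fun j => P.Φ (e (Sum.inr j)))
  have hv : ⊤ ≤ Submodule.span S (Set.range v) := by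
    have hl : ∀ i, P.Φ₁ ⟨e (Sum.inl i), basis_inl_mem_fil e he i⟩ ∈
      Submodule.span S (Set.range v) := fun i => Submodule.subset_span ⟨Sum.inl i, rfl⟩
    have hr : ∀ j, P.Φ (e (Sum.inr j)) ∈
      Submodule.span S (Set.range v) := fun j => Submodule.subset_span ⟨Sum.inr j, rfl⟩
    rw [← P.span_eq_top, Submodule.span_le]
    rintro x (⟨y, rfl⟩ | ⟨y, rfl⟩)
    · rw [Φ₁_eq_sum e he]
      exact Submodule.add_mem _ (Submodule.sum_mem _ fun i _ => Submodule.smul_mem _ _ (hl i))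
        (Submodule.sum_mem _ fun j _ => Submodule.smul_mem _ _ (hr j))
    · rw [← e.sum_repr y, Fintype.sum_sum_type, map_add, map_sum, map_sum]
      refine Submodule.add_mem _ (Submodule.sum_mem _ fun i _ => ?_)
        (Submodule.sum_mem _ fun j _ => ?_)
      · rw [LinearMap.map_smulₛₗ, P.Φ_eq ⟨e (Sum.inl i), basis_inl_mem_fil e he i⟩]
        exact Submodule.smul_mem _ _ (Submodule.smul_mem _ _ (hl i))
      · rw [LinearMap.map_smulₛₗ]
        exact Submodule.smul_mem _ _ (hr j)
  -- The family v generates a free module of the same rank, so the endomorphism e ↦ v is surjective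
  -- and therefore bijective: v is again a basis.
  have hg : Function.Surjective (e.constr S v) := by
    rw [← LinearMap.range_eq_top, Module.Basis.constr_range]
    exact top_le_iff.1 hv
  have hg' : Function.Bijective (e.constr S v) :=
    OrzechProperty.bijective_of_surjective_endomorphism _ hg
  refine ⟨_, _, ⟨⟨e, he, e.map (LinearEquiv.ofBijective _ hg'), fun i h => ?_, fun j => ?_⟩⟩⟩
  · rw [Module.Basis.map_apply, LinearEquiv.ofBijective_apply, Module.Basis.constr_basis]
    rfl
  · rw [Module.Basis.map_apply, LinearEquiv.ofBijective_apply, Module.Basis.constr_basis]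
    rfl

end NormalBases

/-! ### Frames with a derivation -/

section Differential

variable {S : Type u} [CommRing S]

/-- A frame with `ϖ = p` over a `p`-adically complete `p`-torsion free ring, with a derivation `∂`
such that `∂ φ = p φ ∂` and a closed `φ`-stable ideal `U` with `p`-torsion free quotient such that
an iterate of `φ` sends `U` into `Fil¹`. -/
structure DiffFrame (𝓢 : FrameData S) (p : ℕ) (U : Ideal S) (δ : S →+ S) : Prop where
  ϖ_eq : 𝓢.ϖ = p
  torsionFree : ∀ x : S, (p : S) * x = 0 → x = 0
  haus : ∀ x : S, (∀ n, (p : S) ^ n ∣ x) → x = 0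
  prec : ∀ f : ℕ → S, (∀ n, (p : S) ^ n ∣ f (n + 1) - f n) → ∃ l, ∀ n, (p : S) ^ n ∣ f n - l
  leibniz : ∀ x y, δ (x * y) = δ x * y + x * δ y
  der_φ : ∀ s, δ (𝓢.φ s) = p * 𝓢.φ (δ s)
  U_torsionFree : ∀ x, (p : S) * x ∈ U → x ∈ U
  U_closed : ∀ x, (∀ n, ∃ y, x - (p : S) ^ n * y ∈ U) → x ∈ U
  φ_U : ∀ x ∈ U, 𝓢.φ x ∈ U
  exists_φ_fil : ∃ m : ℕ, ∀ x ∈ U, 𝓢.φ^[m] x ∈ 𝓢.fil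

/-- The additive map `N` satisfies the Leibniz rule over `δ`. -/
def IsDer {M : Type*} [AddCommGroup M] [Module S M] (δ : S →+ S) (N : M →+ M) : Prop :=
  ∀ (s : S) (m : M), N (s • m) = δ s • m + s • N m

/-- The additive map `A` is semilinear over `τ`. -/
def IsSemilin {M M' : Type*} [AddCommGroup M] [Module S M] [AddCommGroup M'] [Module S M']
    (τ : S →+* S) (A : M →+ M') : Prop :=
  ∀ (s : S) (m : M), A (s • m) = τ s • A m

/-! ### Semilinear maps and derivations on a free module -/

section Basis

variable {M M' ι : Type*} [AddCommGroup M] [Module S M] [AddCommGroup M'] [Module S M'] [Fintype ι]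

theorem IsSemilin.map_mem {τ : S →+* S} {A : M →+ M'} (hA : IsSemilin τ A) {J J' : Ideal S}
    (hJ : ∀ x ∈ J, τ x ∈ J') {m : M} (hm : m ∈ J • (⊤ : Submodule S M)) :
    A m ∈ J' • (⊤ : Submodule S M') := by
  induction hm using Submodule.smul_induction_on' with
  | smul s hs m _ =>
    rw [hA]
    exact Submodule.smul_mem_smul (hJ s hs) Submodule.mem_top
  | add x _ y _ hx hy =>
    rw [map_add]
    exact Submodule.add_mem _ hx hy

theorem IsSemilin.mem_of_basis {τ : S →+* S} {A : M →+ M'} (hA : IsSemilin τ A)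
    (b : Module.Basis ι S M) (Q : Submodule S M') (h : ∀ i, A (b i) ∈ Q) (m : M) : A m ∈ Q := by
  rw [← b.sum_repr m, map_sum]
  refine Submodule.sum_mem _ fun i _ => ?_
  rw [hA]
  exact Q.smul_mem _ (h i)

/-- For a derivation `N` and a semilinear map `h`, the commutator `N h - c h N` is semilinear. -/
theorem IsDer.commutator {δ : S →+ S} {N : M →+ M} (hN : IsDer δ N) {τ : S →+* S} {h : M →+ M}
    (hh : IsSemilin τ h) {c : S} (hc : ∀ s, δ (τ s) = c * τ (δ s)) (s : S) (m : M) :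
    N (h (s • m)) - c • h (N (s • m)) = τ s • (N (h m) - c • h (N m)) := by
  rw [hh, hN, hN, map_add, hh, hh, hc]
  module

/-- The derivation over `δ` with given values on a basis. -/
def derOfBasis (b : Module.Basis ι S M) (δ : S →+ S) (z : ι → M) : M →+ M where
  toFun m := ∑ i, (δ (b.repr m i) • b i + b.repr m i • z i)
  map_zero' := by simp
  map_add' x y := by
    rw [← Finset.sum_add_distrib]
    refine Finset.sum_congr rfl fun i _ => ?_
    rw [map_add, Finsupp.add_apply, map_add]
    module

theorem isDer_derOfBasis (b : Module.Basis ι S M) (δ : S →+ S)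
    (hδ : ∀ x y, δ (x * y) = δ x * y + x * δ y) (z : ι → M) : IsDer δ (derOfBasis b δ z) := by
  intro s m
  have h1 : δ s • m = ∑ i, (δ s * b.repr m i) • b i := by
    conv_lhs => rw [← b.sum_repr m, Finset.smul_sum]
    exact Finset.sum_congr rfl fun i _ => by rw [smul_smul]
  change ∑ i, _ = _ + s • ∑ i, _
  rw [h1, Finset.smul_sum, ← Finset.sum_add_distrib]
  refine Finset.sum_congr rfl fun i _ => ?_
  rw [map_smul, Finsupp.smul_apply, smul_eq_mul, hδ]
  module

theorem derOfBasis_apply (b : Module.Basis ι S M) (δ : S →+ S) (hδ : δ 1 = 0) (z : ι → M) (i : ι) :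
    derOfBasis b δ z (b i) = z i := by
  change ∑ j, _ = _
  classical
  rw [Finset.sum_eq_single i]
  · simp [hδ]
  · intro j _ hj
    simp [hj.symm]
  · simp

end Basis

variable {𝓢 : FrameData S} {p : ℕ} {U : Ideal S} {δ : S →+ S}

theorem DiffFrame.der_one (D : DiffFrame 𝓢 p U δ) : δ 1 = 0 := by
  have := D.leibniz 1 1
  simpa using this

theorem DiffFrame.smul_cancel (D : DiffFrame 𝓢 p U δ) {M ι : Type*} [AddCommGroup M] [Module S M]
    [Fintype ι] (b : Module.Basis ι S M) {x y : M} (h : (p : S) • x = (p : S) • y) : x = y := by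
  refine b.ext_elem fun i => ?_
  have := congrArg (fun z => b.repr z i) h
  simp only [map_smul, Finsupp.smul_apply, smul_eq_mul] at this
  exact sub_eq_zero.1 (D.torsionFree _ (by rw [mul_sub, this, sub_self]))

theorem DiffFrame.mem_of_smul_mem (D : DiffFrame 𝓢 p U δ) {M ι : Type*} [AddCommGroup M]
    [Module S M] [Fintype ι] (b : Module.Basis ι S M) {x : M}
    (h : (p : S) • x ∈ U • (⊤ : Submodule S M)) : x ∈ U • (⊤ : Submodule S M) := by
  rw [mem_smul_top_iff_repr b] at h ⊢
  intro i
  have := h i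
  rw [map_smul, Finsupp.smul_apply, smul_eq_mul] at this
  exact D.U_torsionFree _ this

theorem DiffFrame.mem_of_pow_smul_mem (D : DiffFrame 𝓢 p U δ) {M ι : Type*} [AddCommGroup M]
    [Module S M] [Fintype ι] (b : Module.Basis ι S M) {x : M} (n : ℕ) {a : S} (ha : IsUnit a)
    (h : ((p : S) ^ n * a) • x ∈ U • (⊤ : Submodule S M)) : x ∈ U • (⊤ : Submodule S M) := by
  obtain ⟨a, rfl⟩ := ha
  induction n generalizing x with
  | zero =>
    have := Submodule.smul_mem _ ((a⁻¹ : Sˣ) : S) h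
    rwa [pow_zero, one_mul, smul_smul, Units.inv_mul, one_smul] at this
  | succ n ih =>
    apply ih
    apply D.mem_of_smul_mem b
    rw [smul_smul]
    convert h using 2
    ring

/-- Some iterate of `φ` sends `U` into `p U`. -/
theorem DiffFrame.exists_φ_U (D : DiffFrame 𝓢 p U δ) :
    ∃ m : ℕ, ∀ x ∈ U, ∃ y ∈ U, 𝓢.φ^[m] x = p * y := by
  obtain ⟨m, hm⟩ := D.exists_φ_fil
  -- One Frobenius beyond the exponent that reaches Fil¹ produces the factor p, since φ = pφ_1
  -- there; the cofactor φ_1 stays in U because S/U has no p-torsion.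
  refine ⟨m + 1, fun x hx => ?_⟩
  have h1 : ∀ n, 𝓢.φ^[n] x ∈ U := by
    intro n
    induction n with
    | zero => exact hx
    | succ n ih => rw [Function.iterate_succ_apply']; exact D.φ_U _ ih
  have h2 := 𝓢.φ_eq ⟨_, hm x hx⟩
  rw [D.ϖ_eq] at h2
  refine ⟨𝓢.φ₁ ⟨_, hm x hx⟩, D.U_torsionFree _ ?_, ?_⟩
  · rw [← h2]
    exact D.φ_U _ (h1 m)
  · rw [Function.iterate_succ_apply']
    exact h2

/-- There is `m` such that the `m k`-th iterate of `φ` sends `U` into `p ^ k U`. -/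
theorem DiffFrame.exists_map_φ_le (D : DiffFrame 𝓢 p U δ) :
    ∃ m : ℕ, ∀ k, U.map (𝓢.φ ^ (m * k)) ≤ Ideal.span {(p : S) ^ k} * U := by
  obtain ⟨m, hm⟩ := D.exists_φ_U
  refine ⟨m, fun k => ?_⟩
  rw [Ideal.map_le_iff_le_comap]
  intro x hx
  rw [Ideal.mem_comap, RingHom.coe_pow, Function.iterate_mul]
  have h : ∀ k, ∃ y ∈ U, (𝓢.φ^[m])^[k] x = p ^ k * y := by
    intro k
    induction k with
    | zero => exact ⟨x, hx, by simp⟩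
    | succ k ih =>
      obtain ⟨y, hy, h⟩ := ih
      obtain ⟨z, hz, h'⟩ := hm y hy
      refine ⟨z, hz, ?_⟩
      rw [Function.iterate_succ_apply', h, ← RingHom.coe_pow, map_mul, map_pow, map_natCast,
        RingHom.coe_pow, h']
      ring
  obtain ⟨y, hy, h⟩ := h k
  rw [h]
  exact Ideal.mul_mem_mul (Ideal.mem_span_singleton_self _) hy

theorem DiffFrame.eq_zero_of_mem (D : DiffFrame 𝓢 p U δ) {M ι : Type*} [AddCommGroup M]
    [Module S M] [Fintype ι] (b : Module.Basis ι S M) {x : M}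
    (h : ∀ k, x ∈ Ideal.span {(p : S) ^ k} • (⊤ : Submodule S M)) : x = 0 := by
  refine b.ext_elem fun i => ?_
  rw [map_zero, Finsupp.zero_apply]
  refine D.haus _ fun k => ?_
  exact Ideal.mem_span_singleton.1 ((mem_smul_top_iff_repr b _ x).1 (h k) i)

/-- If `P` is spanned by `Φ_1` and `Φ` and `A Φ = p Φ A`, then `A` improves ideals by `φ`. -/
theorem map_mem_map_φ {P Q : Window 𝓢} {τ : S →+* S} {A : P.M →+ Q.M} (hA : IsSemilin τ A)
    (h : ∀ m, A (P.Φ m) = (p : S) • Q.Φ (A m)) (h₁ : ∀ m : P.fil, A (P.Φ₁ m) = Q.Φ (A m))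
    {J : Ideal S} (hJ : ∀ m, A m ∈ J • (⊤ : Submodule S Q.M)) (m : P.M) :
    A m ∈ J.map 𝓢.φ • (⊤ : Submodule S Q.M) := by
  have hΦ : ∀ m, Q.Φ (A m) ∈ J.map 𝓢.φ • (⊤ : Submodule S Q.M) := fun m =>
    IsSemilin.map_mem (A := (Q.Φ : Q.M →+ Q.M)) (fun s m => Q.Φ.map_smulₛₗ s m)
      (fun x hx => Ideal.mem_map_of_mem _ hx) (hJ m)
  have hm : m ∈ Submodule.span S (Set.range P.Φ₁ ∪ Set.range P.Φ) := by
    rw [P.span_eq_top]; trivial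
  induction hm using Submodule.span_induction with
  | mem x hx =>
    rcases hx with ⟨y, rfl⟩ | ⟨y, rfl⟩
    · rw [h₁]; exact hΦ _
    · rw [h]; exact Submodule.smul_mem _ _ (hΦ _)
  | zero => rw [map_zero]; exact Submodule.zero_mem _
  | add x y _ _ hx hy => rw [map_add]; exact Submodule.add_mem _ hx hy
  | smul s x _ hx => rw [hA]; exact Submodule.smul_mem _ _ hx

/-- A semilinear map with values in `U` and `A Φ = p Φ A` vanishes. -/
theorem DiffFrame.eq_zero [IsLocalRing S] (D : DiffFrame 𝓢 p U δ) {P Q : Window 𝓢} {τ : S →+* S}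
    {A : P.M →+ Q.M} (hA : IsSemilin τ A) (h : ∀ m, A (P.Φ m) = (p : S) • Q.Φ (A m))
    (hU : ∀ m, A m ∈ U • (⊤ : Submodule S Q.M)) (m : P.M) : A m = 0 := by
  obtain ⟨a, b, ⟨B⟩⟩ := Q.exists_normalBasis
  -- Both sides agree after multiplication by p, because Φ = pΦ_1 on Fil¹ and A is semilinear.
  have h₁ : ∀ m : P.fil, A (P.Φ₁ m) = Q.Φ (A m) := by
    intro m
    apply D.smul_cancel B.e
    rw [← h, P.Φ_eq, D.ϖ_eq, hA, map_natCast]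
  have key : ∀ n m, A m ∈ U.map (𝓢.φ ^ n) • (⊤ : Submodule S Q.M) := by
    intro n
    induction n with
    | zero =>
      rw [pow_zero, RingHom.one_def, Ideal.map_id]
      exact hU
    | succ n ih =>
      intro m
      have := map_mem_map_φ hA h h₁ ih m
      rwa [Ideal.map_map, ← RingHom.mul_def, ← pow_succ'] at this
  obtain ⟨c, hc⟩ := D.exists_map_φ_le
  refine D.eq_zero_of_mem B.e fun k => ?_
  have hle : U.map (𝓢.φ ^ (c * k)) ≤ Ideal.span {(p : S) ^ k} := (hc k).trans Ideal.mul_le_left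
  exact Submodule.smul_mono_left hle (key (c * k) m)

/-- If `R` is congruent to a multiple of itself under `g` with multiplier `1 + p ^ n a`, then it
has values in `U`. -/
theorem DiffFrame.mem_of_twist (D : DiffFrame 𝓢 p U δ) {M M' ι : Type*} [AddCommGroup M]
    [Module S M] [AddCommGroup M'] [Module S M'] [Fintype ι] (b : Module.Basis ι S M')
    {R : M →+ M'} {g : M →+ M}
    (hR : ∀ m ∈ U • (⊤ : Submodule S M), R m ∈ U • (⊤ : Submodule S M'))
    (hg : ∀ m, g m - m ∈ U • (⊤ : Submodule S M)) {n : ℕ} {a : S} (ha : IsUnit a)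
    (h : ∀ m, R (g m) - (1 + (p : S) ^ n * a) • R m ∈ U • (⊤ : Submodule S M')) (m : M) :
    R m ∈ U • (⊤ : Submodule S M') := by
  -- The element p^n a R(m) is R(gm - m) minus the defect of the twisted relation, and both lie in
  -- U.
  apply D.mem_of_pow_smul_mem b n ha
  have := Submodule.sub_mem _ (hR _ (hg m)) (h m)
  convert this using 1
  rw [map_sub]
  module

/-- One step in the analysis of a strict action: if `g - 1` has values in `K`, then it has values
in any ideal that contains `φ (K)`, `φ_1 (K ∩ Fil¹)` and the image of `τ - 1`. -/
theorem act_sub_mem [IsLocalRing S] {P : Window 𝓢} {τ : S →+* S} {g : P.M →+ P.M}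
    (hg : IsSemilin τ g) (g_fil : ∀ m ∈ P.fil, g m ∈ P.fil) (g_Φ : ∀ m, g (P.Φ m) = P.Φ (g m))
    (g_Φ₁ : ∀ m : P.fil, g (P.Φ₁ m) = P.Φ₁ ⟨g m, g_fil m m.2⟩) {K K' : Ideal S}
    (h : ∀ x ∈ K, 𝓢.φ x ∈ K') (h₁ : ∀ x : 𝓢.fil, (x : S) ∈ K → 𝓢.φ₁ x ∈ K')
    (hτ : ∀ s, τ s - s ∈ K') (hK : ∀ m, g m - m ∈ K • (⊤ : Submodule S P.M)) (m : P.M) :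
    g m - m ∈ K' • (⊤ : Submodule S P.M) := by
  obtain ⟨a, b, ⟨B⟩⟩ := P.exists_normalBasis
  have hm : m ∈ Submodule.span S (Set.range P.Φ₁ ∪ Set.range P.Φ) := by
    rw [P.span_eq_top]; trivial
  induction hm using Submodule.span_induction with
  | mem x hx =>
    rcases hx with ⟨y, rfl⟩ | ⟨y, rfl⟩
    -- As g commutes with Φ_1, the difference is Φ_1((g-1)y). Its expansion in a normal basis has
    -- coefficients φ(x) or φ_1(x), with x a coordinate of (g-1)y and hence in K.
    · have e : g (P.Φ₁ y) - P.Φ₁ y = P.Φ₁ (⟨g y, g_fil y y.2⟩ - y) := by rw [map_sub, g_Φ₁]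
      have hy := (mem_smul_top_iff_repr B.e K _).1 (hK y)
      rw [e, Φ₁_eq_sum B.e B.mem_fil]
      refine Submodule.add_mem _ (Submodule.sum_mem _ fun i _ => ?_)
        (Submodule.sum_mem _ fun j _ => ?_)
      · exact Submodule.smul_mem_smul (h _ (hy _)) Submodule.mem_top
      · exact Submodule.smul_mem_smul (h₁ _ (hy _)) Submodule.mem_top
    · rw [g_Φ, ← map_sub]
      exact IsSemilin.map_mem (A := (P.Φ : P.M →+ P.M)) (fun s m => P.Φ.map_smulₛₗ s m)
        h (hK y)
  | zero => rw [map_zero, sub_zero]; exact Submodule.zero_mem _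
  | add x y _ _ hx hy =>
    rw [map_add, add_sub_add_comm]; exact Submodule.add_mem _ hx hy
  | smul s x _ hx =>
    have : g (s • x) - s • x = τ s • (g x - x) + (τ s - s) • x := by rw [hg]; module
    rw [this]
    exact Submodule.add_mem _ (Submodule.smul_mem _ _ hx)
      (Submodule.smul_mem_smul (hτ s) Submodule.mem_top)

end Differential

/-! ### Existence of connections -/

section Existence

variable {S : Type u} [CommRing S] {𝓢 : FrameData S} {p : ℕ} {U : Ideal S} {δ : S →+ S}

/-- The map `N h - c h N` as an additive map. -/
def commutator {M : Type*} [AddCommGroup M] [Module S M] (N h : M →+ M) (c : S) : M →+ M :=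
  N.comp h - (DistribSMul.toAddMonoidHom M c).comp (h.comp N)

theorem commutator_apply {M : Type*} [AddCommGroup M] [Module S M] (N h : M →+ M) (c : S) (m : M) :
    commutator N h c m = N (h m) - c • h (N m) := rfl

theorem isSemilin_commutator {M : Type*} [AddCommGroup M] [Module S M] {N h : M →+ M} {c : S}
    {τ : S →+* S} (hN : IsDer δ N) (hh : IsSemilin τ h) (hc : ∀ s, δ (τ s) = c * τ (δ s)) :
    IsSemilin τ (commutator N h c) := fun s m => hN.commutator hh hc s m

theorem isSemilin_Φ (P : Window 𝓢) : IsSemilin 𝓢.φ (P.Φ : P.M →+ P.M) :=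
  fun s m => P.Φ.map_smulₛₗ s m

/-- A derivation that commutes with `g` up to the multiplier `c` modulo `U`. -/
theorem DiffFrame.exists_der_mod [IsLocalRing S] (D : DiffFrame 𝓢 p U δ) {P : Window 𝓢}
    {ι : Type*} [Fintype ι] (b : Module.Basis ι S P.M)
    {τ : S →+* S} {g : P.M →+ P.M} (hg : IsSemilin τ g)
    (hgU : ∀ m, g m - m ∈ U • (⊤ : Submodule S P.M)) {n : ℕ} {a : S} (ha : IsUnit a)
    (hτ : ∀ s, δ (τ s) = (1 + (p : S) ^ n * a) * τ (δ s)) {K : Ideal S}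
    (hK : ∀ x ∈ K, ∃ y, δ x - (p : S) ^ n * y ∈ U)
    (hgK : ∀ m, g m - m ∈ K • (⊤ : Submodule S P.M)) :
    ∃ N : P.M →+ P.M, IsDer δ N ∧
      ∀ m, commutator N g (1 + (p : S) ^ n * a) m ∈ U • (⊤ : Submodule S P.M) := by
  obtain ⟨a', ha'⟩ := ha.exists_right_inv
  -- The vector z is to become N(b_i). Since g ≡ 1 modulo U, the required relation on b_i reads:
  -- derivatives of the coordinates of (g-1)b_i ≡ p^n a z. So the derivatives must be divided by p^n
  -- a, which the hypothesis on K allows.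
  have h1 : ∀ i, ∃ z : P.M, ∑ j, δ (b.repr (g (b i) - b i) j) • b j - ((p : S) ^ n * a) • z ∈
      U • (⊤ : Submodule S P.M) := by
    intro i
    have hx : ∀ j, ∃ y, δ (b.repr (g (b i) - b i) j) - (p : S) ^ n * y ∈ U := fun j =>
      hK _ ((mem_smul_top_iff_repr b K _).1 (hgK (b i)) j)
    choose y hy using hx
    refine ⟨∑ j, (a' * y j) • b j, ?_⟩
    rw [Finset.smul_sum, ← Finset.sum_sub_distrib]
    refine Submodule.sum_mem _ fun j _ => ?_
    rw [smul_smul, ← sub_smul]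
    refine Submodule.smul_mem_smul ?_ Submodule.mem_top
    convert hy j using 1
    linear_combination (-(p : S) ^ n * y j) * ha'
  choose z hz using h1
  refine ⟨derOfBasis b δ z, isDer_derOfBasis b δ D.leibniz z, fun m => ?_⟩
  -- The commutator is semilinear, so it suffices to test it on the basis.
  refine (isSemilin_commutator (isDer_derOfBasis b δ D.leibniz z) hg hτ).mem_of_basis b _
    (fun i => ?_) m
  rw [commutator_apply, derOfBasis_apply b δ D.der_one]
  have e1 : derOfBasis b δ z (g (b i)) = derOfBasis b δ z (g (b i) - b i) + z i := by
    rw [map_sub, derOfBasis_apply b δ D.der_one, sub_add_cancel]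
  have e2 : derOfBasis b δ z (g (b i) - b i) = ∑ j, δ (b.repr (g (b i) - b i) j) • b j +
      ∑ j, b.repr (g (b i) - b i) j • z j := by
    rw [← Finset.sum_add_distrib]; rfl
  have h2 : ∑ j, b.repr (g (b i) - b i) j • z j ∈ U • (⊤ : Submodule S P.M) :=
    Submodule.sum_mem _ fun j _ => Submodule.smul_mem_smul
      ((mem_smul_top_iff_repr b U _).1 (hgU (b i)) j) Submodule.mem_top
  have h3 := Submodule.smul_mem _ (1 + (p : S) ^ n * a) (hgU (z i))
  have := Submodule.sub_mem _ (Submodule.add_mem _ (hz i) h2) h3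
  convert this using 1
  rw [e1, e2]
  module

/-- The fixed point equation `w = b + G w` in a finite free module, for an operator `G` that
is contracting on the orbit of `b`. -/
theorem DiffFrame.exists_fixedPoint (D : DiffFrame 𝓢 p U δ) {M ι : Type*}
    [AddCommGroup M] [Module S M] [Fintype ι] (b : Module.Basis ι S M)
    (G : (ι → M) →+ (ι → M)) (v : ι → M) (c : ℕ)
    (hG : ∀ k w, (∀ i, w i ∈ Ideal.span {(p : S) ^ k} • (⊤ : Submodule S M)) →
      ∀ i, G w i ∈ Ideal.span {(p : S) ^ k} • (⊤ : Submodule S M))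
    (hU : ∀ n i, (G^[n] v) i ∈ U • (⊤ : Submodule S M))
    (hv : ∀ k n, c * k ≤ n → ∀ i, (G^[n] v) i ∈ Ideal.span {(p : S) ^ k} • (⊤ : Submodule S M)) :
    ∃ w : ι → M, w = v + G w ∧ ∀ i, w i ∈ U • (⊤ : Submodule S M) := by
  -- Partial sums of the series Σ G^l(v), whose limit formally inverts 1 - G on v.
  let x : ℕ → ι → M := fun n => ∑ l ∈ Finset.range n, G^[l] v
  have hx : ∀ n, x (n + 1) = v + G (x n) := by
    intro n
    simp only [x]
    rw [Finset.sum_range_succ', map_sum, add_comm]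
    congr 1
    exact Finset.sum_congr rfl fun l _ => Function.iterate_succ_apply' _ _ _
  have hxU : ∀ n i, x n i ∈ U • (⊤ : Submodule S M) := by
    intro n i
    simp only [x, Finset.sum_apply]
    exact Submodule.sum_mem _ fun l _ => hU l i
  have hlim : ∀ i j, ∃ l, ∀ k, (p : S) ^ k ∣ b.repr (x (c * k) i) j - l := by
    intro i j
    apply D.prec
    intro k
    -- Only the subsequence with indices ck is used: its k-th increment collects terms G^l(v) with l
    -- ≥ ck, all divisible by p^k.
    have h1 : x (c * (k + 1)) i - x (c * k) i ∈ Ideal.span {(p : S) ^ k} • (⊤ : Submodule S M) := by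
      have h2 : x (c * (k + 1)) - x (c * k) = ∑ l ∈ Finset.Ico (c * k) (c * (k + 1)), G^[l] v := by
        rw [Finset.sum_Ico_eq_sub _ (Nat.mul_le_mul_left c (Nat.le_succ k))]
      rw [← Pi.sub_apply, h2, Finset.sum_apply]
      exact Submodule.sum_mem _ fun l hl => hv k l (Finset.mem_Ico.1 hl).1 i
    have := (mem_smul_top_iff_repr b _ _).1 h1 j
    rwa [map_sub, Finsupp.sub_apply, Ideal.mem_span_singleton] at this
  choose l hl using hlim
  let w : ι → M := fun i => ∑ j, l i j • b j
  have hw : ∀ i j, b.repr (w i) j = l i j := by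
    intro i j
    simp only [w]
    rw [b.repr_sum_self]
  have hxw : ∀ k i, (x (c * k) - w) i ∈ Ideal.span {(p : S) ^ k} • (⊤ : Submodule S M) := by
    intro k i
    rw [mem_smul_top_iff_repr b]
    intro j
    rw [Pi.sub_apply, map_sub, Finsupp.sub_apply, hw, Ideal.mem_span_singleton]
    exact hl i j k
  refine ⟨w, ?_, fun i => ?_⟩
  · funext i
    rw [← sub_eq_zero]
    refine D.eq_zero_of_mem b fun k => ?_
    have h1 := hxw k i
    have h2 := hG k _ (hxw k) i
    have h3 : (x (c * k + 1) - x (c * k)) i ∈ Ideal.span {(p : S) ^ k} • (⊤ : Submodule S M) := by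
      have : x (c * k + 1) - x (c * k) = G^[c * k] v := by
        simp only [x]; rw [Finset.sum_range_succ, add_sub_cancel_left]
      rw [this]
      exact hv k _ le_rfl i
    rw [hx] at h3
    have := Submodule.sub_mem _ (Submodule.sub_mem _ h2 h1) h3
    convert this using 1
    rw [map_sub]
    simp only [Pi.sub_apply, Pi.add_apply]
    abel
  · rw [mem_smul_top_iff_repr b]
    intro j
    refine D.U_closed _ fun k => ?_
    obtain ⟨y, hy⟩ := hl i j k
    refine ⟨-y, ?_⟩
    have := (mem_smul_top_iff_repr b _ _).1 (hxU (c * k) i) j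
    convert this using 1
    rw [hw]
    linear_combination -hy

/-- Existence of a derivation that commutes with `Φ` up to the factor `p` and with `g` up to the
factor `1 + p ^ n a` modulo `U`. -/
theorem DiffFrame.exists_der [IsLocalRing S] (D : DiffFrame 𝓢 p U δ) {P : Window 𝓢}
    {τ : S →+* S} {g : P.M →+ P.M} (hg : IsSemilin τ g)
    (hgU : ∀ m, g m - m ∈ U • (⊤ : Submodule S P.M)) (hτU : ∀ s, τ s - s ∈ U)
    (g_Φ : ∀ m, g (P.Φ m) = P.Φ (g m)) {n : ℕ} {a : S} (ha : IsUnit a) (hφa : 𝓢.φ a = a)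
    (hτ : ∀ s, δ (τ s) = (1 + (p : S) ^ n * a) * τ (δ s)) {K : Ideal S}
    (hK : ∀ x ∈ K, ∃ y, δ x - (p : S) ^ n * y ∈ U)
    (hgK : ∀ m, g m - m ∈ K • (⊤ : Submodule S P.M)) :
    ∃ N : P.M →+ P.M, IsDer δ N ∧ (∀ m, N (P.Φ m) = (p : S) • P.Φ (N m)) ∧
      ∀ m, commutator N g (1 + (p : S) ^ n * a) m ∈ U • (⊤ : Submodule S P.M) := by
  obtain ⟨α, β, ⟨B⟩⟩ := P.exists_normalBasis
  obtain ⟨N, hN, hNg⟩ := D.exists_der_mod B.f hg hgU ha hτ hK hgK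
  have τU : ∀ x ∈ U, τ x ∈ U := fun x hx => by simpa using U.add_mem (hτU x) hx
  -- modulo `U`, the derivation commutes with `Φ`
  have hR : ∀ m, commutator N (P.Φ : P.M →+ P.M) (p : S) m ∈ U • (⊤ : Submodule S P.M) := by
    have hs := isSemilin_commutator hN (isSemilin_Φ P) D.der_φ
    -- The twist principle for R = NΦ - pΦN: since g commutes with Φ and φ fixes a, both NΦ and pΦN
    -- acquire the factor 1 + p^n a modulo U under composition with g.
    refine D.mem_of_twist B.e (fun m hm => hs.map_mem D.φ_U hm) hgU (n := n) ha fun m => ?_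
    have h1 : N (g m) - (1 + (p : S) ^ n * a) • N m ∈ U • (⊤ : Submodule S P.M) := by
      have := Submodule.add_mem _ (hNg m) (Submodule.smul_mem _ (1 + (p : S) ^ n * a) (hgU (N m)))
      convert this using 1
      rw [commutator_apply]; module
    have h2 : N (g (P.Φ m)) - (1 + (p : S) ^ n * a) • N (P.Φ m) ∈ U • (⊤ : Submodule S P.M) := by
      have := Submodule.add_mem _ (hNg (P.Φ m))
        (Submodule.smul_mem _ (1 + (p : S) ^ n * a) (hgU (N (P.Φ m))))
      convert this using 1
      rw [commutator_apply]; module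
    have h3 := Submodule.smul_mem _ (p : S) ((isSemilin_Φ P).map_mem D.φ_U h1)
    have := Submodule.sub_mem _ h2 h3
    convert this using 1
    rw [commutator_apply, commutator_apply]
    simp only [AddMonoidHom.coe_coe, map_sub,
      LinearMap.map_smulₛₗ, map_add, map_mul, map_pow, map_natCast, map_one, hφa, g_Φ]
    module
  -- The basis f consists of Φ_1(e_i) and Φ(e_j). The desired relation is NΦ_1 = ΦN on the former
  -- and NΦ = pΦN on the latter, whence the factors 1 and p.
  let c : Fin α ⊕ Fin β → S := Sum.elim (fun _ => 1) (fun _ => p)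
  -- the correction term
  let G : (Fin α ⊕ Fin β → P.M) →+ (Fin α ⊕ Fin β → P.M) :=
    { toFun := fun w i => c i • P.Φ (B.f.constr S w (B.e i))
      map_zero' := by funext i; simp
      map_add' := fun w w' => by funext i; simp [map_add, smul_add] }
  have hG : ∀ (J J' : Ideal S), (∀ x ∈ J, 𝓢.φ x ∈ J') → ∀ w : Fin α ⊕ Fin β → P.M,
      (∀ i, w i ∈ J • (⊤ : Submodule S P.M)) → ∀ i, G w i ∈ J' • (⊤ : Submodule S P.M) := by
    intro J J' hJ w hw i
    refine Submodule.smul_mem _ _ ((isSemilin_Φ P).map_mem hJ ?_)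
    rw [B.f.constr_apply_fintype S]
    exact Submodule.sum_mem _ fun j _ => Submodule.smul_mem _ _ (hw j)
  let v : Fin α ⊕ Fin β → P.M := fun i => c i • P.Φ (N (B.e i)) - N (B.f i)
  have hv : ∀ i, v i ∈ U • (⊤ : Submodule S P.M) := by
    rintro (i | j)
    · have h1 := B.f_inl i (basis_inl_mem_fil B.e B.mem_fil i)
      have h2 := P.Φ_eq ⟨B.e (Sum.inl i), basis_inl_mem_fil B.e B.mem_fil i⟩
      rw [← h1, D.ϖ_eq] at h2
      -- Here Φ(e_i) = p f_i, so the commutator only controls p times the defect; p is cancelled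
      -- modulo U.
      apply D.mem_of_smul_mem B.e
      have := Submodule.neg_mem _ (hR (B.e (Sum.inl i)))
      convert this using 1
      rw [commutator_apply, AddMonoidHom.coe_coe]
      simp only at h2
      rw [h2, Nat.cast_smul_eq_nsmul S p (B.f _), map_nsmul, ← Nat.cast_smul_eq_nsmul S p (N _)]
      simp only [v, c, Sum.elim_inl]
      module
    · have := Submodule.neg_mem _ (hR (B.e (Sum.inr j)))
      convert this using 1
      rw [commutator_apply, AddMonoidHom.coe_coe, ← B.f_inr]
      simp only [v, c, Sum.elim_inr]
      module
  have hiter : ∀ n i, (G^[n] v) i ∈ U.map (𝓢.φ ^ n) • (⊤ : Submodule S P.M) := by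
    intro n
    induction n with
    | zero => rw [pow_zero, RingHom.one_def, Ideal.map_id]; exact hv
    | succ n ih =>
      rw [Function.iterate_succ_apply', pow_succ', RingHom.mul_def, ← Ideal.map_map]
      exact hG _ _ (fun x hx => Ideal.mem_map_of_mem _ hx) _ ih
  have hmapU : ∀ n, U.map (𝓢.φ ^ n) ≤ U := by
    intro n
    induction n with
    | zero => rw [pow_zero, RingHom.one_def, Ideal.map_id]
    | succ n ih =>
      rw [pow_succ', RingHom.mul_def, ← Ideal.map_map, Ideal.map_le_iff_le_comap]
      exact fun x hx => D.φ_U x (ih hx)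
  have hpφ : ∀ k, ∀ x ∈ Ideal.span {(p : S) ^ k}, 𝓢.φ x ∈ Ideal.span {(p : S) ^ k} := by
    intro k x hx
    obtain ⟨y, rfl⟩ := Ideal.mem_span_singleton.1 hx
    rw [map_mul, map_pow, map_natCast]
    exact Ideal.mul_mem_right _ _ (Ideal.mem_span_singleton_self _)
  obtain ⟨e, he⟩ := D.exists_map_φ_le
  -- G moves coefficients by φ. The iterates of φ carry U into p^k U, and divisibility by p^k
  -- persists afterwards.
  have hconv : ∀ k n, e * k ≤ n → ∀ i,
      (G^[n] v) i ∈ Ideal.span {(p : S) ^ k} • (⊤ : Submodule S P.M) := by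
    intro k n hn
    induction n, hn using Nat.le_induction with
    | base =>
      intro i
      have hle : U.map (𝓢.φ ^ (e * k)) ≤ Ideal.span {(p : S) ^ k} := (he k).trans Ideal.mul_le_left
      exact Submodule.smul_mono_left hle (hiter _ i)
    | succ n _ ih =>
      rw [Function.iterate_succ_apply']
      exact hG _ _ (hpφ k) _ ih
  obtain ⟨w, hw, hwU⟩ := D.exists_fixedPoint B.f G v e (fun k => hG _ _ (hpφ k))
    (fun n i => Submodule.smul_mono_left (hmapU n) (hiter n i)) hconv
  let A : P.M →ₗ[S] P.M := B.f.constr S w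
  have hAf : ∀ i, A (B.f i) = w i := fun i => B.f.constr_basis S w i
  have hAU : ∀ m, A m ∈ U • (⊤ : Submodule S P.M) := by
    intro m
    simp only [A]
    rw [B.f.constr_apply_fintype S]
    exact Submodule.sum_mem _ fun j _ => Submodule.smul_mem _ _ (hwU j)
  let N' : P.M →+ P.M := N + (A : P.M →+ P.M)
  have hN'_apply : ∀ m, N' m = N m + A m := fun m => rfl
  have hN' : IsDer δ N' := by
    intro s m
    rw [hN'_apply, hN'_apply, hN, map_smul]
    module
  have hfix : ∀ i, N' (B.f i) = c i • P.Φ (N' (B.e i)) := by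
    intro i
    have := congrFun hw i
    change w i = (c i • P.Φ (N (B.e i)) - N (B.f i)) + c i • P.Φ (A (B.e i)) at this
    rw [hN'_apply, hN'_apply, hAf, this, map_add]
    module
  refine ⟨N', hN', fun m => ?_, fun m => ?_⟩
  · have hs := isSemilin_commutator hN' (isSemilin_Φ P) D.der_φ
    have h0 : commutator N' (P.Φ : P.M →+ P.M) (p : S) m ∈ (⊥ : Submodule S P.M) := by
      refine hs.mem_of_basis B.e _ ?_ m
      rintro (i | j)
      · have h1 := B.f_inl i (basis_inl_mem_fil B.e B.mem_fil i)
        have h2 := P.Φ_eq ⟨B.e (Sum.inl i), basis_inl_mem_fil B.e B.mem_fil i⟩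
        rw [← h1, D.ϖ_eq] at h2
        simp only at h2
        rw [Submodule.mem_bot, commutator_apply, AddMonoidHom.coe_coe, h2,
          Nat.cast_smul_eq_nsmul S p (B.f _), map_nsmul, ← Nat.cast_smul_eq_nsmul S p (N' _), hfix]
        simp [c]
      · rw [Submodule.mem_bot, commutator_apply, AddMonoidHom.coe_coe, ← B.f_inr, hfix]
        simp [c]
    rwa [Submodule.mem_bot, commutator_apply, sub_eq_zero] at h0
  -- The correction has values in U, so it does not disturb the relation with g, which is only
  -- claimed modulo U.
  · have h1 : A (g m) ∈ U • (⊤ : Submodule S P.M) := hAU _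
    have h2 := Submodule.smul_mem _ (1 + (p : S) ^ n * a) (hg.map_mem τU (hAU m))
    have := Submodule.add_mem _ (hNg m) (Submodule.sub_mem _ h1 h2)
    convert this using 1
    rw [commutator_apply, commutator_apply, hN'_apply, hN'_apply, map_add]
    module

/-- A derivation that commutes with `Φ` up to the factor `p` and with `g` up to the factor
`1 + p ^ n a` modulo `U` commutes with every semilinear automorphism that commutes with `g`, up to
the corresponding factor. -/
theorem DiffFrame.commutator_eq_zero [IsLocalRing S] (D : DiffFrame 𝓢 p U δ) {P : Window 𝓢}
    {g : P.M →+ P.M} (hgU : ∀ m, g m - m ∈ U • (⊤ : Submodule S P.M)) {n : ℕ} {a : S}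
    (ha : IsUnit a) {N : P.M →+ P.M} (hN : IsDer δ N)
    (hNΦ : ∀ m, N (P.Φ m) = (p : S) • P.Φ (N m))
    (hNg : ∀ m, commutator N g (1 + (p : S) ^ n * a) m ∈ U • (⊤ : Submodule S P.M))
    {τ : S →+* S} {h : P.M →+ P.M} (hh : IsSemilin τ h)
    (hτU : ∀ s, τ s - s ∈ U)
    (h_Φ : ∀ m, h (P.Φ m) = P.Φ (h m)) {c : S} (hφc : 𝓢.φ c = c)
    (hτ : ∀ s, δ (τ s) = c * τ (δ s)) (hgh : ∀ m, g (h m) = h (g m)) (m : P.M) :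
    N (h m) = c • h (N m) := by
  obtain ⟨α, β, ⟨B⟩⟩ := P.exists_normalBasis
  have τU : ∀ x ∈ U, τ x ∈ U := fun x hx => by simpa using U.add_mem (hτU x) hx
  have hs := isSemilin_commutator hN hh hτ
  have hNg' : ∀ m, N (g m) - (1 + (p : S) ^ n * a) • N m ∈ U • (⊤ : Submodule S P.M) := by
    intro m
    have := Submodule.add_mem _ (hNg m) (Submodule.smul_mem _ (1 + (p : S) ^ n * a) (hgU (N m)))
    convert this using 1
    rw [commutator_apply]; module
  have hU : ∀ m, commutator N h c m ∈ U • (⊤ : Submodule S P.M) := by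
    refine D.mem_of_twist B.e (fun m hm => hs.map_mem τU hm) hgU (n := n) ha fun m => ?_
    have h1 := hNg' (h m)
    have h2 := Submodule.smul_mem _ c (hh.map_mem τU (hNg' m))
    -- Pulling the factor 1 + p^n a through h replaces it by its image under τ, which differs from
    -- it by an element of U.
    have h3 : (τ (1 + (p : S) ^ n * a) - (1 + (p : S) ^ n * a)) • c • h (N m) ∈
      U • (⊤ : Submodule S P.M) := Submodule.smul_mem_smul (hτU _) Submodule.mem_top
    have := Submodule.sub_mem _ (Submodule.sub_mem _ h1 h2) h3
    convert this using 1
    rw [commutator_apply, commutator_apply, map_sub, hh, hgh]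
    module
  -- Rigidity applies to the commutator: it intertwines Φ up to p because N does, h commutes with Φ,
  -- and φ(c) = c.
  have h0 := D.eq_zero hs (fun m => ?_) hU m
  · rwa [commutator_apply, sub_eq_zero] at h0
  · rw [commutator_apply, commutator_apply, h_Φ, hNΦ, hNΦ, map_sub, LinearMap.map_smulₛₗ, hφc,
      Nat.cast_smul_eq_nsmul S p (P.Φ (N m)), map_nsmul, h_Φ, ← Nat.cast_smul_eq_nsmul S p]
    module

/-- A homomorphism of windows that commutes with `g` commutes with the connections. -/
theorem DiffFrame.hom_horizontal [IsLocalRing S] (D : DiffFrame 𝓢 p U δ) {P Q : Window 𝓢}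
    (f : Window.Hom P Q) {g : P.M →+ P.M} {g' : Q.M →+ Q.M}
    (hgf : ∀ m, f.lin (g m) = g' (f.lin m))
    (hgU : ∀ m, g m - m ∈ U • (⊤ : Submodule S P.M))
    (hgU' : ∀ m, g' m - m ∈ U • (⊤ : Submodule S Q.M)) {n : ℕ} {a : S} (ha : IsUnit a)
    {N : P.M →+ P.M} {N' : Q.M →+ Q.M} (hN : IsDer δ N) (hN' : IsDer δ N')
    (hNΦ : ∀ m, N (P.Φ m) = (p : S) • P.Φ (N m)) (hNΦ' : ∀ m, N' (Q.Φ m) = (p : S) • Q.Φ (N' m))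
    (hNg : ∀ m, N (g m) = (1 + (p : S) ^ n * a) • g (N m))
    (hNg' : ∀ m, N' (g' m) = (1 + (p : S) ^ n * a) • g' (N' m)) (m : P.M) :
    f.lin (N m) = N' (f.lin m) := by
  obtain ⟨α, β, ⟨B⟩⟩ := Q.exists_normalBasis
  let A : P.M →+ Q.M := (f.lin : P.M →+ Q.M).comp N - N'.comp (f.lin : P.M →+ Q.M)
  have hA : ∀ m, A m = f.lin (N m) - N' (f.lin m) := fun m => rfl
  -- The derivation terms cancel, so the difference of the two composites is linear.
  have hs : IsSemilin (RingHom.id S) A := by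
    intro s m
    rw [hA, hA, hN, map_smul, hN', map_add, map_smul, map_smul, RingHom.id_apply]
    module
  have hU : ∀ m, A m ∈ U • (⊤ : Submodule S Q.M) := by
    refine D.mem_of_twist B.e (fun m hm => hs.map_mem (fun x hx => hx) hm) hgU (n := n) ha
      fun m => ?_
    have := Submodule.smul_mem _ (1 + (p : S) ^ n * a) (hgU' (A m))
    convert this using 1
    rw [hA, hA, hNg, map_smul, hgf, hgf, hNg', map_sub]
    module
  have h0 := D.eq_zero hs (fun m => ?_) hU m
  · rwa [hA, sub_eq_zero] at h0
  · rw [hA, hA, hNΦ, map_smul, f.map_Φ, f.map_Φ, hNΦ', map_sub]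
    module

end Existence

/-! ### Derivatives and congruences for substitutions of power series -/

section PowerSeriesFacts

/-- The difference of `f (v)` and `f (u)` is divisible by `v - u`. -/
theorem sub_X_dvd_subst_sub {A : Type u} [CommRing A] {v : PowerSeries A}
    (hv : PowerSeries.constantCoeff v = 0) (f : PowerSeries A) :
    v - PowerSeries.X ∣ f.subst v - f := by
  have hs : PowerSeries.HasSubst v := PowerSeries.HasSubst.of_constantCoeff_zero' hv
  have hXv : (PowerSeries.X : PowerSeries A) ∣ v := PowerSeries.X_dvd_iff.2 hv
  -- This is (v^n - u^n)/(v - u). It is divisible by u^{n-1}, so Σ f_n h_n converges u-adically to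
  -- the desired quotient q; Q N is its truncation, exact up to degree N because the first omitted
  -- term is h (N+2).
  let h : ℕ → PowerSeries A := fun n => ∑ i ∈ Finset.range n, v ^ i * PowerSeries.X ^ (n - 1 - i)
  have hh : ∀ n, (PowerSeries.X : PowerSeries A) ^ (n - 1) ∣ h n := by
    intro n
    refine Finset.dvd_sum fun i hi => ?_
    rw [Finset.mem_range] at hi
    have : n - 1 = i + (n - 1 - i) := by omega
    conv_lhs => rw [this, pow_add]
    exact mul_dvd_mul (pow_dvd_pow_of_dvd hXv i) dvd_rfl
  have hmul : ∀ n, (v - PowerSeries.X) * h n = v ^ n - PowerSeries.X ^ n := fun n =>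
    (Commute.all _ _).mul_geom_sum₂ n
  let Q : ℕ → PowerSeries A := fun N =>
    ∑ n ∈ Finset.range (N + 2), PowerSeries.C (PowerSeries.coeff n f) * h n
  let q : PowerSeries A := PowerSeries.mk fun m => PowerSeries.coeff m (Q m)
  have hQ : ∀ N m, m ≤ N → PowerSeries.coeff m (Q N) = PowerSeries.coeff m (Q m) := by
    intro N m hm
    induction N, hm using Nat.le_induction with
    | base => rfl
    | succ N hN ih =>
      have e : Q (N + 1) = Q N + PowerSeries.C (PowerSeries.coeff (N + 2) f) * h (N + 2) :=
        Finset.sum_range_succ _ _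
      rw [e, map_add, ih, add_eq_left]
      exact PowerSeries.X_pow_dvd_iff.1 ((hh (N + 2)).mul_left _) m (by omega)
  have hq : ∀ N, (PowerSeries.X : PowerSeries A) ^ (N + 1) ∣ q - Q N := by
    intro N
    rw [PowerSeries.X_pow_dvd_iff]
    intro m hm
    rw [map_sub, PowerSeries.coeff_mk, hQ N m (by omega), sub_self]
  have hQf : ∀ N, (PowerSeries.X : PowerSeries A) ^ (N + 1) ∣
      (v - PowerSeries.X) * Q N - (f.subst v - f) := by
    intro N
    have e1 : (v - PowerSeries.X) * Q N =
        (PowerSeries.trunc (N + 2) f : PowerSeries A).subst v -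
          (PowerSeries.trunc (N + 2) f : PowerSeries A) := by
      rw [PowerSeries.subst_coe hs, Finset.mul_sum, Polynomial.aeval_eq_sum_range'
        (PowerSeries.natDegree_trunc_lt f (N + 1))]
      have e2 : ((PowerSeries.trunc (N + 2) f : Polynomial A) : PowerSeries A) =
          Polynomial.aeval PowerSeries.X (PowerSeries.trunc (N + 2) f) := by
        rw [← PowerSeries.subst_coe PowerSeries.HasSubst.X', PowerSeries.X_subst]
      rw [e2, Polynomial.aeval_eq_sum_range' (PowerSeries.natDegree_trunc_lt f (N + 1)),
        ← Finset.sum_sub_distrib]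
      refine Finset.sum_congr rfl fun n hn => ?_
      rw [Finset.mem_range] at hn
      rw [mul_left_comm, hmul, PowerSeries.coeff_trunc, if_pos hn, PowerSeries.smul_eq_C_mul,
        PowerSeries.smul_eq_C_mul]
      ring
    have e3 := PowerSeries.eq_X_pow_mul_shift_add_trunc (N + 2) f
    set g : PowerSeries A := PowerSeries.mk fun i => PowerSeries.coeff (i + (N + 2)) f
    have e4 : f.subst v = v ^ (N + 2) * g.subst v +
        (PowerSeries.trunc (N + 2) f : PowerSeries A).subst v := by
      conv_lhs => rw [e3]
      rw [PowerSeries.subst_add hs, PowerSeries.subst_mul hs, PowerSeries.subst_pow hs,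
        PowerSeries.subst_X hs]
    have e5 : (v - PowerSeries.X) * Q N - (f.subst v - f) =
        PowerSeries.X ^ (N + 2) * g - v ^ (N + 2) * g.subst v := by
      rw [e1, e4]
      linear_combination e3
    rw [e5]
    refine dvd_sub (Dvd.dvd.mul_right (pow_dvd_pow _ (by omega)) _) (Dvd.dvd.mul_right ?_ _)
    exact (pow_dvd_pow _ (by omega)).trans (pow_dvd_pow_of_dvd hXv _)
  refine ⟨q, ?_⟩
  rw [eq_comm, ← sub_eq_zero]
  ext m
  have h1 : (PowerSeries.X : PowerSeries A) ^ (m + 1) ∣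
      (v - PowerSeries.X) * q - (f.subst v - f) := by
    have := dvd_add ((hq m).mul_left (v - PowerSeries.X)) (hQf m)
    convert this using 1
    ring
  rw [map_zero]
  exact PowerSeries.X_pow_dvd_iff.1 h1 m (Nat.lt_succ_self m)

/-! ### The invariant derivation (1+u) d/du -/

theorem derivative_map {A B : Type*} [CommRing A] [CommRing B] (f : A →+* B) (x : PowerSeries A) :
    PowerSeries.derivative B (PowerSeries.map f x) =
      PowerSeries.map f (PowerSeries.derivative A x) := by
  ext n
  simp [PowerSeries.coeff_derivative]

/-- The operator `(1 + u) d/du` on power series. -/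
def eulerOp (A : Type*) [CommRing A] : PowerSeries A →+ PowerSeries A :=
  (AddMonoidHom.mulLeft (1 + PowerSeries.X)).comp
    (PowerSeries.derivative A : PowerSeries A →ₗ[A] PowerSeries A).toAddMonoidHom

theorem eulerOp_apply {A : Type*} [CommRing A] (x : PowerSeries A) :
    eulerOp A x = (1 + PowerSeries.X) * PowerSeries.derivative A x := rfl

/-- The chain rule gives f'(v) ∂v = c (1+v) f'(v), and (1+v) f'(v) is the substitution of v into
(1+u) f'. Every commutation rule for ∂ comes from a case where 1+v is an eigenvector of ∂. -/
theorem eulerOp_subst {A : Type*} [CommRing A] {v : PowerSeries A} (hv : PowerSeries.HasSubst v)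
    {c : PowerSeries A} (hc : eulerOp A v = c * (1 + v)) (f : PowerSeries A) :
    eulerOp A (f.subst v) = c * (eulerOp A f).subst v := by
  have h1 : (1 + PowerSeries.X : PowerSeries A).subst v = 1 + v := by
    rw [← PowerSeries.coe_substAlgHom hv, map_add, map_one, PowerSeries.substAlgHom_X]
  rw [eulerOp_apply, eulerOp_apply, PowerSeries.derivative_subst hv, PowerSeries.subst_mul hv, h1]
  rw [eulerOp_apply] at hc
  linear_combination (PowerSeries.derivative A f).subst v * hc

theorem coeff_eulerOp {A : Type*} [CommRing A] (f : PowerSeries A) (n : ℕ) :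
    PowerSeries.coeff n (eulerOp A f) =
      PowerSeries.coeff (n + 1) f * (n + 1) + PowerSeries.coeff n f * n := by
  rw [eulerOp_apply, add_mul, one_mul, map_add, PowerSeries.coeff_derivative]
  congr 1
  cases n with
  | zero => simp
  | succ n => rw [PowerSeries.coeff_succ_X_mul, PowerSeries.coeff_derivative]; push_cast; ring

/-- Uniqueness of solutions of `(1 + u) df/du = a f`. -/
theorem eq_of_eulerOp_eq {A : Type*} [CommRing A] [IsDomain A] [CharZero A] {a : A}
    {f g : PowerSeries A} (hf : eulerOp A f = PowerSeries.C a * f)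
    (hg : eulerOp A g = PowerSeries.C a * g)
    (h0 : PowerSeries.constantCoeff f = PowerSeries.constantCoeff g) : f = g := by
  ext n
  induction n with
  | zero => simpa using h0
  | succ n ih =>
    have h1 := congrArg (PowerSeries.coeff n) hf
    have h2 := congrArg (PowerSeries.coeff n) hg
    -- The equation is the recursion (n+1) f_{n+1} = (a - n) f_n, and n+1 is not a zero divisor.
    rw [coeff_eulerOp, PowerSeries.coeff_C_mul] at h1 h2
    apply mul_right_cancel₀ (Nat.cast_add_one_ne_zero n : ((n : A) + 1) ≠ 0)
    rw [ih] at h1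
    linear_combination h1 - h2

/-! ### Binomial series with p-adic exponents -/

variable {p : ℕ} [Fact p.Prime]

/-- On coefficients this is (n+1) C(a,n+1) = (a-n) C(a,n). -/
theorem eulerOp_binomialSeries (a : ℤ_[p]) :
    eulerOp ℤ_[p] (PowerSeries.binomialSeries ℤ_[p] a) =
      PowerSeries.C a * PowerSeries.binomialSeries ℤ_[p] a := by
  ext n
  rw [coeff_eulerOp, PowerSeries.coeff_C_mul]
  have h := Ring.choose_smul_choose a (Nat.le_succ n)
  simp only [PowerSeries.binomialSeries_coeff, smul_eq_mul, mul_one] at *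
  rw [Nat.succ_sub (le_refl n), Nat.sub_self, Ring.choose_one_right, Nat.succ_eq_add_one,
    Nat.choose_succ_self_right, nsmul_eq_mul] at h
  push_cast at h
  linear_combination h

theorem eulerOp_one_add_X_pow_sub_one (A : Type*) [CommRing A] (m : ℕ) :
    eulerOp A ((1 + PowerSeries.X) ^ m - 1) =
      PowerSeries.C (m : A) * (1 + ((1 + PowerSeries.X) ^ m - 1)) := by
  rw [eulerOp_apply, map_sub, Derivation.leibniz_pow, map_add, Derivation.map_one_eq_zero,
    PowerSeries.derivative_X]
  cases m with
  | zero => simp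
  | succ m => simp [pow_succ]; ring

theorem hasSubst_one_add_X_pow_sub_one (A : Type*) [CommRing A] (m : ℕ) :
    PowerSeries.HasSubst ((1 + PowerSeries.X) ^ m - 1 : PowerSeries A) :=
  PowerSeries.HasSubst.of_constantCoeff_zero' (by simp)

/-- Both sides are solutions of ∂f = mb f with constant term 1, so uniqueness for this equation
identifies them. -/
theorem binomialSeries_mul (m : ℕ) (b : ℤ_[p]) :
    (PowerSeries.binomialSeries ℤ_[p] b).subst ((1 + PowerSeries.X) ^ m - 1 : PowerSeries ℤ_[p]) =
      PowerSeries.binomialSeries ℤ_[p] (m * b) := by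
  have hs := hasSubst_one_add_X_pow_sub_one ℤ_[p] m
  refine eq_of_eulerOp_eq ?_ (eulerOp_binomialSeries _) ?_
  · rw [eulerOp_subst hs (eulerOp_one_add_X_pow_sub_one _ m), eulerOp_binomialSeries,
      PowerSeries.subst_mul hs, PowerSeries.subst_C, ← mul_assoc, map_mul]
    rfl
  · rw [PowerSeries.binomialSeries_constantCoeff]
    have h1 : (PowerSeries.X : PowerSeries ℤ_[p]) ∣ PowerSeries.binomialSeries ℤ_[p] b - 1 := by
      rw [PowerSeries.X_dvd_iff, map_sub, PowerSeries.binomialSeries_constantCoeff]; simp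
    obtain ⟨w, hw⟩ := h1
    rw [eq_add_of_sub_eq' hw, ← PowerSeries.coe_substAlgHom hs, map_add, map_one, map_mul,
      PowerSeries.substAlgHom_X]
    simp

/-- Substitute (1+u)^m - 1 for u in the divisibility of (1+u)^b - 1 by u. -/
theorem pow_sub_one_dvd_binomialSeries (m : ℕ) (b : ℤ_[p]) :
    ((1 + PowerSeries.X) ^ m - 1 : PowerSeries ℤ_[p]) ∣
      PowerSeries.binomialSeries ℤ_[p] (m * b) - 1 := by
  have hs := hasSubst_one_add_X_pow_sub_one ℤ_[p] m
  have h1 : (PowerSeries.X : PowerSeries ℤ_[p]) ∣ PowerSeries.binomialSeries ℤ_[p] b - 1 := by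
    rw [PowerSeries.X_dvd_iff, map_sub, PowerSeries.binomialSeries_constantCoeff]; simp
  have := map_dvd (PowerSeries.substAlgHom hs) h1
  rwa [PowerSeries.substAlgHom_X, map_sub, map_one, PowerSeries.coe_substAlgHom,
    binomialSeries_mul] at this

/-! ### Frobenius and cyclotomic substitutions -/

variable (d : ℕ) {C : Type u} [CommRing C]

theorem frob_eq_subst (σ : C →+* C) (x : PS d C) :
    frob p d σ x = PowerSeries.subst ((1 + PowerSeries.X) ^ p - 1 : PS d C)
      (PowerSeries.map ((MvPowerSeries.expand p (Fact.out : p.Prime).ne_zero).toRingHom.comp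
      (MvPowerSeries.map σ)) x) := by
  rw [← PowerSeries.coe_substAlgHom (hasSubst_one_add_X_pow_sub_one _ p)]; rfl

theorem cyc_eq_subst (ι : ℤ_[p] →+* C) (a : ℤ_[p]) (x : PS d C) :
    cyc d ι a x = PowerSeries.subst (onePlusPow d ι a - 1) x := by
  rw [← PowerSeries.coe_substAlgHom
    (PowerSeries.HasSubst.of_constantCoeff_zero' (constantCoeff_onePlusPow d ι a))]; rfl

theorem eulerOp_frob (σ : C →+* C) (x : PS d C) :
    eulerOp _ (frob p d σ x) = (p : PS d C) * frob p d σ (eulerOp _ x) := by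
  rw [frob_eq_subst, frob_eq_subst, eulerOp_subst (hasSubst_one_add_X_pow_sub_one _ p)
    (eulerOp_one_add_X_pow_sub_one _ p), map_natCast, eulerOp_apply, eulerOp_apply, derivative_map,
    map_mul, map_add, map_one, PowerSeries.map_X]

theorem eulerOp_onePlusPow (ι : ℤ_[p] →+* C) (a : ℤ_[p]) :
    eulerOp _ (onePlusPow d ι a) =
      PowerSeries.C (MvPowerSeries.C (ι a)) * onePlusPow d ι a := by
  have h := congrArg (PowerSeries.map ((MvPowerSeries.C (σ := Fin d)).comp ι))
    (eulerOp_binomialSeries a)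
  rw [eulerOp_apply, map_mul, ← derivative_map, map_add, map_one, PowerSeries.map_X, map_mul,
    PowerSeries.map_C] at h
  exact h

theorem eulerOp_cyc (ι : ℤ_[p] →+* C) (a : ℤ_[p]) (x : PS d C) :
    eulerOp _ (cyc d ι a x) =
      PowerSeries.C (MvPowerSeries.C (ι a)) * cyc d ι a (eulerOp _ x) := by
  rw [cyc_eq_subst, cyc_eq_subst]
  refine eulerOp_subst (PowerSeries.HasSubst.of_constantCoeff_zero'
    (constantCoeff_onePlusPow d ι a)) ?_ x
  rw [map_sub, eulerOp_onePlusPow, add_sub_cancel]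
  simp [eulerOp_apply]

/-- If `a ≡ 1` modulo `p ^ r`, then `1 + u ↦ (1 + u) ^ a` is the identity modulo `φ^r(u)`. -/
theorem pow_sub_one_dvd_cyc_sub (ι : ℤ_[p] →+* C) (m : ℕ) (b : ℤ_[p]) (x : PS d C) :
    ((1 + PowerSeries.X) ^ m - 1 : PS d C) ∣ cyc d ι (1 + m * b) x - x := by
  rw [cyc_eq_subst]
  -- It suffices to treat x = u, where the difference is (1+u)((1+u)^{mb} - 1).
  refine dvd_trans ?_ (sub_X_dvd_subst_sub (constantCoeff_onePlusPow d ι _) x)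
  have h1 := map_dvd (PowerSeries.map ((MvPowerSeries.C (σ := Fin d)).comp ι))
    (pow_sub_one_dvd_binomialSeries (p := p) m b)
  rw [map_sub, map_pow, map_add, map_one, PowerSeries.map_X, map_sub, map_one] at h1
  have h2 : onePlusPow d ι (1 + m * b) = (1 + PowerSeries.X) * onePlusPow d ι (m * b) := by
    rw [onePlusPow, onePlusPow, PowerSeries.binomialSeries_add, map_mul]
    congr 1
    have := PowerSeries.binomialSeries_nat (R := ℤ_[p]) (A := ℤ_[p]) 1
    rw [Nat.cast_one] at this
    rw [this]
    simp
  have h3 : onePlusPow d ι (1 + m * b) - 1 - PowerSeries.X =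
      (1 + PowerSeries.X) * (onePlusPow d ι (m * b) - 1) := by
    rw [h2]; ring
  rw [h3]
  exact h1.mul_left _

end PowerSeriesFacts

/-! ### Further properties of `p`-adic completions -/

section CompletionFacts

variable {p : ℕ} {B C D : Type u} [CommRing B] [CommRing C] [CommRing D]

theorem algebraMap_eq_of (b : B) :
    algebraMap B (PCompl p B) b = AdicCompletion.of (Ideal.span {(p : B)}) B b := rfl

theorem complMap_algebraMap (f : B →+* C) (b : B) :
    complMap p f (algebraMap B _ b) = algebraMap C _ (f b) := complMap_of p f b

theorem complAddMap_algebraMap (f : B →+ B) (b : B) :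
    complAddMap p f (algebraMap B _ b) = algebraMap B _ (f b) := complAddMap_of p f b

theorem complMap_comp (g : C →+* D) (f : B →+* C) (x : PCompl p B) :
    complMap p (g.comp f) x = complMap p g (complMap p f x) := by
  apply AdicCompletion.ext_evalₐ
  intro n
  rw [evalₐ_complMap, evalₐ_complMap, evalₐ_complMap]
  obtain ⟨b, hb⟩ := Ideal.Quotient.mk_surjective (AdicCompletion.evalₐ (Ideal.span {(p : B)}) n x)
  rw [← hb]
  rfl

theorem compl_isAdicComplete (p : ℕ) (B : Type u) [CommRing B] :
    IsAdicComplete (Ideal.span {(p : PCompl p B)}) (PCompl p B) := by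
  have := AdicCompletion.isAdicComplete_self (Ideal.span {(p : B)}) (Submodule.fg_span_singleton _)
  rwa [Ideal.map_span, Set.image_singleton, map_natCast] at this

theorem compl_haus {x : PCompl p B} (h : ∀ n, (p : PCompl p B) ^ n ∣ x) : x = 0 := by
  have := compl_isAdicComplete p B
  refine IsHausdorff.haus' (I := Ideal.span {(p : PCompl p B)}) x fun n => ?_
  rw [SModEq.zero, smul_eq_mul, Ideal.mul_top, Ideal.span_singleton_pow,
    Ideal.mem_span_singleton]
  exact h n

theorem compl_prec (f : ℕ → PCompl p B) (hf : ∀ n, (p : PCompl p B) ^ n ∣ f (n + 1) - f n) :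
    ∃ l, ∀ n, (p : PCompl p B) ^ n ∣ f n - l := by
  have := compl_isAdicComplete p B
  have key : ∀ {m n}, m ≤ n → (p : PCompl p B) ^ m ∣ f m - f n := by
    intro m n hmn
    induction n, hmn using Nat.le_induction with
    | base => simp
    | succ n hn ih =>
      have := dvd_sub ih ((pow_dvd_pow _ hn).trans (hf n))
      convert this using 1
      ring
  obtain ⟨l, hl⟩ := IsPrecomplete.prec' (I := Ideal.span {(p : PCompl p B)}) f fun {m n} hmn => by
    rw [SModEq.sub_mem, smul_eq_mul, Ideal.mul_top, Ideal.span_singleton_pow,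
      Ideal.mem_span_singleton]
    exact key hmn
  refine ⟨l, fun n => ?_⟩
  have := hl n
  rwa [SModEq.sub_mem, smul_eq_mul, Ideal.mul_top, Ideal.span_singleton_pow,
    Ideal.mem_span_singleton] at this

theorem compl_exists_one (x : PCompl p B) :
    ∃ (b : B) (y : PCompl p B), x = algebraMap B _ b + (p : PCompl p B) * y := by
  obtain ⟨b, hb⟩ := Ideal.Quotient.mk_surjective (AdicCompletion.evalₐ (Ideal.span {(p : B)}) 1 x)
  have h2 : x - AdicCompletion.of _ _ b ∈
      RingHom.ker (AdicCompletion.evalOneₐ (Ideal.span {(p : B)})).toRingHom := by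
    rw [RingHom.mem_ker]
    change AdicCompletion.evalOneₐ _ _ = 0
    rw [← AdicCompletion.factorₐ_evalₐ_one, map_sub, ← hb, AdicCompletion.evalₐ_of, sub_self,
      map_zero]
  replace h2 := (AdicCompletion.ker_evalOneₐ_eq_map
    (I := Ideal.span {(p : B)}) (Submodule.fg_span_singleton _)).le h2
  rw [Ideal.map_span, Set.image_singleton, map_natCast, Ideal.mem_span_singleton] at h2
  obtain ⟨y, hy⟩ := h2
  exact ⟨b, y, eq_add_of_sub_eq' hy⟩

theorem compl_exists (x : PCompl p B) (n : ℕ) :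
    ∃ (b : B) (y : PCompl p B), x = algebraMap B _ b + (p : PCompl p B) ^ n * y := by
  induction n with
  | zero => exact ⟨0, x, by simp⟩
  | succ n ih =>
    obtain ⟨b, y, h⟩ := ih
    obtain ⟨b', y', h'⟩ := compl_exists_one y
    refine ⟨b + (p : B) ^ n * b', y', ?_⟩
    rw [h, h', map_add, map_mul, map_pow, map_natCast]
    ring

/-- Two additive maps to a `p`-adically separated ring that agree on a ring agree on its
completion. -/
theorem compl_addHom_ext {T : Type*} [CommRing T] (hT : ∀ x : T, (∀ n, (p : T) ^ n ∣ x) → x = 0)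
    {f g : PCompl p B →+ T} (h : ∀ b : B, f (algebraMap B _ b) = g (algebraMap B _ b))
    (x : PCompl p B) : f x = g x := by
  rw [← sub_eq_zero]
  refine hT _ fun n => ?_
  obtain ⟨b, y, rfl⟩ := compl_exists x n
  have e : ∀ (q : PCompl p B →+ T), q ((p : PCompl p B) ^ n * y) = (p : T) ^ n * q y := by
    intro q
    have h1 : (p : PCompl p B) ^ n * y = (p ^ n) • y := by simp
    rw [h1, map_nsmul]
    simp
  rw [map_add, map_add, h, e, e]
  exact ⟨f y - g y, by ring⟩

/-- Look at the level C/p^n of the completion, where the second summand disappears. This replaces an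
element of a kernel by a ring element that vanishes modulo p^n. -/
theorem dvd_of_complMap_eq_zero (f : B →+* C) {b : B} {y : PCompl p B} {n : ℕ}
    (h : complMap p f (algebraMap B _ b + (p : PCompl p B) ^ n * y) = 0) : (p : C) ^ n ∣ f b := by
  rw [map_add, map_mul, map_pow, map_natCast, complMap_algebraMap] at h
  have h1 := congrArg (AdicCompletion.evalₐ (Ideal.span {(p : C)}) n) h
  have h2 : ((p : ℕ) : C ⧸ Ideal.span {(p : C)} ^ n) ^ n = 0 := by
    rw [← map_natCast (Ideal.Quotient.mk _), ← map_pow, Ideal.Quotient.eq_zero_iff_mem]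
    exact Ideal.pow_mem_pow (Ideal.mem_span_singleton_self _) n
  rw [map_add, map_mul, map_pow, map_natCast, h2, zero_mul, add_zero, map_zero, algebraMap_eq_of,
    AdicCompletion.evalₐ_of] at h1
  rwa [← Ideal.mem_span_singleton, ← Ideal.span_singleton_pow, ← Ideal.Quotient.eq_zero_iff_mem]

theorem mem_ker_complMap_of_closed (f : B →+* C) {x : PCompl p B}
    (h : ∀ n, ∃ y, x - (p : PCompl p B) ^ n * y ∈ RingHom.ker (complMap p f)) :
    x ∈ RingHom.ker (complMap p f) := by
  rw [RingHom.mem_ker]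
  refine compl_haus fun n => ?_
  obtain ⟨y, hy⟩ := h n
  rw [RingHom.mem_ker, map_sub, sub_eq_zero] at hy
  rw [hy, map_mul, map_pow, map_natCast]
  exact dvd_mul_right _ _

theorem mem_ker_complMap_of_mul (f : B →+* C) (hC : ∀ x : C, (p : C) * x = 0 → x = 0)
    {x : PCompl p B} (h : (p : PCompl p B) * x ∈ RingHom.ker (complMap p f)) :
    x ∈ RingHom.ker (complMap p f) := by
  rw [RingHom.mem_ker, map_mul, map_natCast] at h
  exact compl_torsionFree p hC _ h

/-- Transport of kernels along a commutative square of rings. -/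
theorem complMap_mem_ker {B' C' : Type u} [CommRing B'] [CommRing C'] {f : B →+* C}
    {f' : B' →+* C'} {g : B →+* B'} {h : C →+* C'} (e : f'.comp g = h.comp f) {x : PCompl p B}
    (hx : x ∈ RingHom.ker (complMap p f)) : complMap p g x ∈ RingHom.ker (complMap p f') := by
  rw [RingHom.mem_ker] at hx ⊢
  rw [← complMap_comp, e, complMap_comp, hx, map_zero]

theorem complMap_sub_mem_ker {f : B →+* C} {g : B →+* B} (e : f.comp g = f) (x : PCompl p B) :
    complMap p g x - x ∈ RingHom.ker (complMap p f) := by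
  rw [RingHom.mem_ker, map_sub, ← complMap_comp, e, sub_self]

theorem ker_complMap_le {f : B →+* C} {f' : B →+* D} {h : C →+* D} (e : f' = h.comp f) :
    RingHom.ker (complMap p f) ≤ RingHom.ker (complMap p f') := by
  intro x hx
  rw [RingHom.mem_ker] at hx ⊢
  rw [e, complMap_comp, hx, map_zero]

end CompletionFacts

section TorsionFree

variable {p : ℕ} [Fact p.Prime] {A : Type u} [CommRing A]

/-- In a `p`-torsion free ring over `ℤ_p`, nonzero integers are nonzero divisors. -/
theorem natCast_mul_eq_zero (f : ℤ_[p] →+* A) (hA : ∀ x : A, (p : A) * x = 0 → x = 0) {n : ℕ}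
    (hn : n ≠ 0) {x : A} (h : (n : A) * x = 0) : x = 0 := by
  obtain ⟨e, m, hm, rfl⟩ := Nat.exists_eq_pow_mul_and_not_dvd hn p (Fact.out : p.Prime).ne_one
  -- The prime-to-p part of n is already invertible in ℤ_p, so only powers of p have to be
  -- cancelled.
  have hu : IsUnit ((m : ℕ) : A) := by
    have : IsUnit ((m : ℕ) : ℤ_[p]) := by
      rw [PadicInt.isUnit_iff]
      refine le_antisymm (PadicInt.norm_le_one _) (not_lt.1 fun h => hm ?_)
      have := (PadicInt.norm_int_lt_one_iff_dvd (p := p) m).1 (by simpa using h)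
      exact_mod_cast this
    simpa using this.map f
  push_cast at h
  have h1 : ∀ e (x : A), (p : A) ^ e * x = 0 → x = 0 := by
    intro e
    induction e with
    | zero => intro x hx; simpa using hx
    | succ e ih => intro x hx; exact ih _ (hA _ (by rw [← hx]; ring))
  have h2 := h1 e (m * x) (by rw [← h]; ring)
  exact hu.mul_right_eq_zero.1 h2

end TorsionFree

/-! ### Further properties of divided power envelopes -/

section HullFacts

variable {B B' : Type u} [CommRing B] [CommRing B'] [Algebra ℚ B'] (i : B →+* B') (J : Ideal B)

/-- The homomorphism from a ring to its divided power envelope. -/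
def inclHull : B →+* pdHull i J := i.codRestrict _ fun x => map_mem_pdHull' x

variable {i J}

theorem coe_inclHull (x : B) : (inclHull i J x : B') = i x := rfl

theorem exists_natCast_mul (x : pdHull i J) :
    ∃ (n : ℕ) (s : B), n ≠ 0 ∧ (n : pdHull i J) * x = inclHull i J s := by
  obtain ⟨x, hx⟩ := x
  suffices h : ∃ (n : ℕ) (s : B), n ≠ 0 ∧ (n : B') * x = i s by
    obtain ⟨n, s, hn, h⟩ := h
    exact ⟨n, s, hn, Subtype.ext (by push_cast; exact h)⟩
  induction hx using Subring.closure_induction with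
  | mem x hx =>
    rcases hx with ⟨s, rfl⟩ | ⟨n, a, ha, rfl⟩
    · exact ⟨1, s, one_ne_zero, by simp⟩
    · exact ⟨n.factorial, a ^ n, n.factorial_ne_zero, by rw [factorial_mul_dp, map_pow]⟩
  | zero => exact ⟨1, 0, one_ne_zero, by simp⟩
  | one => exact ⟨1, 1, one_ne_zero, by simp⟩
  | add x y _ _ hx hy =>
    obtain ⟨n, s, hn, h⟩ := hx
    obtain ⟨m, t, hm, h'⟩ := hy
    refine ⟨n * m, m * s + n * t, mul_ne_zero hn hm, ?_⟩
    simp only [map_add, map_mul, map_natCast, Nat.cast_mul]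
    linear_combination (m : B') * h + (n : B') * h'
  | neg x _ hx =>
    obtain ⟨n, s, hn, h⟩ := hx
    exact ⟨n, -s, hn, by rw [map_neg, mul_neg, h]⟩
  | mul x y _ _ hx hy =>
    obtain ⟨n, s, hn, h⟩ := hx
    obtain ⟨m, t, hm, h'⟩ := hy
    refine ⟨n * m, s * t, mul_ne_zero hn hm, ?_⟩
    simp only [map_mul, Nat.cast_mul]
    linear_combination (m : B') * y * h + i s * h'

variable {A : Type u} [CommRing A]

/-- Each element of the envelope has a nonzero integral multiple coming from B, so a homomorphism to
a torsion free ring is determined on B. Identities between maps on the envelope thereby reduce to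
identities on 𝔖. -/
theorem hull_ringHom_ext (hA : ∀ n : ℕ, n ≠ 0 → ∀ x : A, (n : A) * x = 0 → x = 0)
    {f g : pdHull i J →+* A} (h : ∀ s, f (inclHull i J s) = g (inclHull i J s)) : f = g := by
  ext x
  obtain ⟨n, s, hn, hx⟩ := exists_natCast_mul x
  have := h s
  rw [← hx, map_mul, map_mul, map_natCast, map_natCast] at this
  exact sub_eq_zero.1 (hA n hn _ (by rw [mul_sub, this, sub_self]))

/-- The value b of the extension at x is characterised by clearing denominators: nx = s and nb =
q(s). For a divided power of a in J, where q(a) = py, it is (p^n/n!) y^n. -/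
theorem exists_ext {p : ℕ} (hA : HasPPowDivFactorial p A) (q : B →+* A)
    (hJ : ∀ a ∈ J, (p : A) ∣ q a) (x : pdHull i J) :
    ∃ (b : A) (n : ℕ) (s : B), n ≠ 0 ∧ (n : B') * x = i s ∧ (n : A) * b = q s := by
  obtain ⟨x, hx⟩ := x
  simp only
  induction hx using Subring.closure_induction with
  | mem x hx =>
    rcases hx with ⟨s, rfl⟩ | ⟨n, a, ha, rfl⟩
    · exact ⟨q s, 1, s, one_ne_zero, by simp, by simp⟩
    · obtain ⟨y, hy⟩ := hJ a ha
      obtain ⟨z, hz, -⟩ := hA n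
      refine ⟨z * y ^ n, n.factorial, a ^ n, n.factorial_ne_zero,
        by rw [factorial_mul_dp, map_pow], ?_⟩
      rw [map_pow, hy, mul_pow, ← hz, mul_assoc]
  | zero => exact ⟨0, 1, 0, one_ne_zero, by simp, by simp⟩
  | one => exact ⟨1, 1, 1, one_ne_zero, by simp, by simp⟩
  | add x y _ _ hx hy =>
    obtain ⟨b, n, s, hn, h, hb⟩ := hx
    obtain ⟨c, m, t, hm, h', hc⟩ := hy
    refine ⟨b + c, n * m, m * s + n * t, mul_ne_zero hn hm, ?_, ?_⟩
    · simp only [map_add, map_mul, map_natCast, Nat.cast_mul]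
      linear_combination (m : B') * h + (n : B') * h'
    · simp only [map_add, map_mul, map_natCast, Nat.cast_mul]
      linear_combination (m : A) * hb + (n : A) * hc
  | neg x _ hx =>
    obtain ⟨b, n, s, hn, h, hb⟩ := hx
    exact ⟨-b, n, -s, hn, by rw [map_neg, mul_neg, h], by rw [map_neg, mul_neg, hb]⟩
  | mul x y _ _ hx hy =>
    obtain ⟨b, n, s, hn, h, hb⟩ := hx
    obtain ⟨c, m, t, hm, h', hc⟩ := hy
    refine ⟨b * c, n * m, s * t, mul_ne_zero hn hm, ?_, ?_⟩
    · simp only [map_mul, Nat.cast_mul]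
      linear_combination (m : B') * y * h + i s * h'
    · simp only [map_mul, Nat.cast_mul]
      linear_combination (m : A) * c * hb + q s * hc

/-- A homomorphism `q` to a torsion free ring that sends `J` to multiples of `p` extends to the
divided power envelope. -/
theorem exists_hull_ringHom (hi : Function.Injective i) {p : ℕ} (hA : HasPPowDivFactorial p A)
    (hA' : ∀ n : ℕ, n ≠ 0 → ∀ x : A, (n : A) * x = 0 → x = 0) (q : B →+* A)
    (hJ : ∀ a ∈ J, (p : A) ∣ q a) :
    ∃ f : pdHull i J →+* A, ∀ s, f (inclHull i J s) = q s := by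
  -- The value does not depend on how denominators are cleared; additivity and multiplicativity are
  -- further instances of this.
  have uniq : ∀ {x : B'} {b c : A} {n m : ℕ} {s t : B}, n ≠ 0 → m ≠ 0 → (n : B') * x = i s →
      (m : B') * x = i t → (n : A) * b = q s → (m : A) * c = q t → b = c := by
    intro x b c n m s t hn hm h1 h2 h3 h4
    have h5 : (m : B) * s = n * t := by
      apply hi
      rw [map_mul, map_mul, map_natCast, map_natCast, ← h1, ← h2]
      ring
    have h6 := congrArg q h5
    rw [map_mul, map_mul, map_natCast, map_natCast, ← h3, ← h4] at h6
    refine sub_eq_zero.1 (hA' (m * n) (mul_ne_zero hm hn) _ ?_)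
    push_cast
    linear_combination h6
  choose F n s hn h1 h2 using exists_ext (i := i) hA q hJ
  refine ⟨{ toFun := F, map_one' := ?_, map_mul' := ?_, map_zero' := ?_, map_add' := ?_ }, ?_⟩
  · exact uniq (x := 1) (hn _) one_ne_zero (h1 1) (t := 1) (by simp) (h2 _) (by simp)
  · intro x y
    refine uniq (hn _) (mul_ne_zero (hn x) (hn y)) (h1 (x * y)) (t := s x * s y) ?_ (h2 _) ?_
    · rw [map_mul, ← h1, ← h1]; push_cast; ring
    · rw [map_mul, ← h2, ← h2]; push_cast; ring
  · exact uniq (x := 0) (hn _) one_ne_zero (h1 0) (t := 0) (by simp) (h2 _) (by simp)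
  · intro x y
    refine uniq (hn _) (mul_ne_zero (hn x) (hn y)) (h1 (x + y)) (t := n y * s x + n x * s y)
      ?_ (h2 _) ?_
    · rw [map_add, map_mul, map_mul, map_natCast, map_natCast, ← h1, ← h1]; push_cast; ring
    · rw [map_add, map_mul, map_mul, map_natCast, map_natCast, ← h2, ← h2]; push_cast; ring
  · intro t
    exact uniq (hn _) one_ne_zero (h1 (inclHull i J t)) (t := t) (by simp [coe_inclHull]) (h2 _)
      (by simp)

/-! ### The divided power ideal -/

theorem dp_mem_pdHullIdeal {n : ℕ} (hn : n ≠ 0) {a : B} (ha : a ∈ J) :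
    (⟨dp n (i a), dp_mem n ha⟩ : pdHull i J) ∈ pdHullIdeal i J :=
  Ideal.subset_span ⟨n, a, hn, ha, rfl⟩

theorem inclHull_mem_pdHullIdeal {a : B} (ha : a ∈ J) : inclHull i J a ∈ pdHullIdeal i J := by
  refine Ideal.subset_span ⟨1, a, one_ne_zero, ha, ?_⟩
  rw [coe_inclHull]
  simp [dp]

theorem exists_sub_mem_pdHullIdeal (x : pdHull i J) :
    ∃ s, x - inclHull i J s ∈ pdHullIdeal i J := by
  obtain ⟨x, hx⟩ := x
  induction hx using Subring.closure_induction with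
  | mem x hx =>
    rcases hx with ⟨s, rfl⟩ | ⟨n, a, ha, rfl⟩
    · refine ⟨s, ?_⟩
      have : (⟨i s, map_mem_pdHull' s⟩ : pdHull i J) - inclHull i J s = 0 := sub_self _
      rw [this]
      exact Ideal.zero_mem _
    · rcases eq_or_ne n 0 with rfl | hn
      · refine ⟨1, ?_⟩
        have : (⟨dp 0 (i a), dp_mem 0 ha⟩ : pdHull i J) - inclHull i J 1 = 0 := by
          rw [map_one, sub_eq_zero]
          exact Subtype.ext (dp_zero _)
        rw [this]
        exact Ideal.zero_mem _
      · refine ⟨0, ?_⟩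
        rw [map_zero, sub_zero]
        exact dp_mem_pdHullIdeal hn ha
  | zero => exact ⟨0, by simp only [map_zero, sub_zero]; exact Ideal.zero_mem _⟩
  | one =>
    refine ⟨1, ?_⟩
    rw [map_one]
    exact (sub_self (1 : pdHull i J)).symm ▸ Ideal.zero_mem _
  | add x y hx' hy' hx hy =>
    obtain ⟨s, hs⟩ := hx
    obtain ⟨t, ht⟩ := hy
    refine ⟨s + t, ?_⟩
    have := Ideal.add_mem _ hs ht
    rwa [sub_add_sub_comm, ← map_add] at this
  | neg x hx' hx =>
    obtain ⟨s, hs⟩ := hx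
    refine ⟨-s, ?_⟩
    have := Ideal.neg_mem_iff _ |>.2 hs
    rw [neg_sub', ← map_neg] at this
    exact this
  | mul x y hx' hy' hx hy =>
    obtain ⟨s, hs⟩ := hx
    obtain ⟨t, ht⟩ := hy
    refine ⟨s * t, ?_⟩
    have := Ideal.add_mem _ (Ideal.mul_mem_right (⟨y, hy'⟩ : pdHull i J) _ hs)
      (Ideal.mul_mem_left _ (inclHull i J s) ht)
    convert this using 1
    have e : (⟨x * y, Subring.mul_mem _ hx' hy'⟩ : pdHull i J) = ⟨x, hx'⟩ * ⟨y, hy'⟩ := rfl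
    rw [map_mul, e]
    ring

theorem exists_natCast_mul_of_mem {x : pdHull i J} (hx : x ∈ pdHullIdeal i J) :
    ∃ (n : ℕ) (s : B), n ≠ 0 ∧ s ∈ J ∧ (n : pdHull i J) * x = inclHull i J s := by
  induction hx using Submodule.span_induction with
  | mem x hx =>
    obtain ⟨n, a, hn, ha, hx⟩ := hx
    refine ⟨n.factorial, a ^ n, n.factorial_ne_zero, Ideal.pow_mem_of_mem _ ha _ hn.bot_lt,
      Subtype.ext ?_⟩
    push_cast
    rw [hx, factorial_mul_dp, coe_inclHull, map_pow]
  | zero => exact ⟨1, 0, one_ne_zero, J.zero_mem, by simp⟩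
  | add x y _ _ hx hy =>
    obtain ⟨n, s, hn, hs, h⟩ := hx
    obtain ⟨m, t, hm, ht, h'⟩ := hy
    refine ⟨n * m, m * s + n * t, mul_ne_zero hn hm,
      J.add_mem (J.mul_mem_left _ hs) (J.mul_mem_left _ ht), ?_⟩
    simp only [map_add, map_mul, map_natCast, Nat.cast_mul]
    linear_combination (m : pdHull i J) * h + (n : pdHull i J) * h'
  | smul y x _ hx =>
    obtain ⟨n, s, hn, hs, h⟩ := hx
    obtain ⟨m, t, hm, h'⟩ := exists_natCast_mul y
    refine ⟨n * m, s * t, mul_ne_zero hn hm, J.mul_mem_right _ hs, ?_⟩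
    simp only [map_mul, Nat.cast_mul, smul_eq_mul]
    linear_combination (m : pdHull i J) * y * h + inclHull i J s * h'

theorem dp_mul_dp (m n : ℕ) (x : B') :
    dp m x * dp n x = ((m + n).choose n : B') * dp (m + n) x := by
  apply natCast_mul_cancel m.factorial_ne_zero
  apply natCast_mul_cancel n.factorial_ne_zero
  have h2 : (m.factorial : B') * n.factorial * (m + n).choose n = ((m + n).factorial : B') := by
    rw [← Nat.add_choose_mul_factorial_mul_factorial m n]
    push_cast
    ring
  have h7 := factorial_mul_dp (m + n) x
  rw [pow_add] at h7
  linear_combination (n.factorial : B') * dp n x * factorial_mul_dp m x +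
    x ^ m * factorial_mul_dp n x - h7 - dp (m + n) x * h2

theorem exists_dp_pow (n m : ℕ) (x : B') : ∃ c : ℕ, (dp n x) ^ m = c * dp (m * n) x := by
  induction m with
  | zero => exact ⟨1, by simp [dp_zero]⟩
  | succ m ih =>
    obtain ⟨c, hc⟩ := ih
    refine ⟨c * (m * n + n).choose n, ?_⟩
    rw [pow_succ, hc, mul_assoc, dp_mul_dp, add_mul, one_mul]
    push_cast
    ring

/-- The divided power ideal is nilpotent modulo `p`, elementwise. -/
theorem exists_dvd_pow {p : ℕ} (hp : p.Prime) {x : pdHull i J} (hx : x ∈ pdHullIdeal i J) :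
    ∃ n : ℕ, (p : pdHull i J) ∣ x ^ n := by
  have hle : pdHullIdeal i J ≤ (Ideal.span {(p : pdHull i J)}).radical := by
    rw [pdHullIdeal, Ideal.span_le]
    rintro x ⟨n, a, hn, ha, hx⟩
    -- The p-th power of a^n/n! is an integral multiple of C(pn,n) · a^{pn}/(pn)!, and C(pn,n) = p ·
    -- C(pn-1,n-1).
    refine ⟨p, Ideal.mem_span_singleton.2 ?_⟩
    obtain ⟨m, hm⟩ : ∃ m, p = m + 1 := ⟨p - 1, (Nat.sub_add_cancel hp.one_le).symm⟩
    obtain ⟨l, hl⟩ : ∃ l, n = l + 1 := ⟨n - 1, (Nat.succ_pred hn).symm⟩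
    obtain ⟨c, hc⟩ := exists_dp_pow n m (i a)
    have hchoose : (m * n + n).choose n = p * (m * n + l).choose l := by
      have h1 := Nat.add_one_mul_choose_eq (m * n + l) l
      have h2 : m * n + l + 1 = m * n + n := by omega
      rw [h2, ← hl] at h1
      apply Nat.eq_of_mul_eq_mul_right hn.bot_lt
      rw [← h1, hm]
      ring
    refine ⟨⟨c * (m * n + l).choose l * dp (m * n + n) (i a), ?_⟩, Subtype.ext ?_⟩
    · exact Subring.mul_mem _ (Subring.mul_mem _ (natCast_mem _ _) (natCast_mem _ _)) (dp_mem _ ha)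
    · push_cast
      rw [hx]
      conv_lhs => rw [hm]
      rw [pow_succ, hc, mul_assoc, dp_mul_dp, hchoose]
      push_cast
      ring
  obtain ⟨n, hn⟩ := hle hx
  exact ⟨n, Ideal.mem_span_singleton.1 hn⟩

end HullFacts

/-! ### Reduction modulo `p` and the quotients `𝔖 / φ^j(u)` -/

section Reduction

variable {p : ℕ} [Fact p.Prime] {k : Type u} [Field k] [CharP k p] [PerfectRing k p] {d r : ℕ}

/-- The reduction `𝔖 → k[[u, t_1, …, t_d]]`. -/
abbrev redSS (p : ℕ) [Fact p.Prime] (k : Type u) [Field k] [CharP k p] [PerfectRing k p] (d : ℕ) :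
    SS p k d →+* PS d k := psMap d WittVector.constantCoeff

theorem p_dvd_of_redSS_eq_zero {x : SS p k d} (h : redSS p k d x = 0) : (p : SS p k d) ∣ x := by
  have h1 : ∀ n m, ∃ w : WittVector p k,
      MvPowerSeries.coeff m (PowerSeries.coeff n x) = p * w := by
    intro n m
    have h2 : WittVector.constantCoeff (MvPowerSeries.coeff m (PowerSeries.coeff n x)) = 0 := by
      have := congrArg (fun y => MvPowerSeries.coeff m (PowerSeries.coeff n y)) h
      simpa [PowerSeries.coeff_map, MvPowerSeries.coeff_map] using this
    have h3 := (RingHom.mem_ker (f := WittVector.constantCoeff (p := p) (R := k))).2 h2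
    rwa [WittVector.ker_constantCoeff, Ideal.mem_span_singleton] at h3
  choose w hw using h1
  let z : ℕ → MvPowerSeries (Fin d) (WittVector p k) := fun n m => w n m
  refine ⟨PowerSeries.mk z, ?_⟩
  ext n : 1
  refine MvPowerSeries.ext fun m => ?_
  have e1 : (p : SS p k d) = PowerSeries.C (MvPowerSeries.C (p : WittVector p k)) := by simp
  rw [e1, PowerSeries.coeff_C_mul, MvPowerSeries.coeff_C_mul, PowerSeries.coeff_mk]
  exact hw n m

theorem incl_injective : Function.Injective (incl p k d) := by
  intro x y h
  ext n : 1
  apply map_algebraMap_injective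
  have := congrArg (PowerSeries.coeff n) h
  rwa [PowerSeries.coeff_map, PowerSeries.coeff_map] at this

theorem p_mul_cancel_SS {x y : SS p k d} (h : (p : SS p k d) * x = p * y) : x = y := by
  apply incl_injective
  apply natCast_mul_cancel (Fact.out : p.Prime).ne_zero
  have := congrArg (incl p k d) h
  rwa [map_mul, map_mul, map_natCast] at this

theorem redSS_p : redSS p k d (p : SS p k d) = 0 := by
  have e1 : (p : SS p k d) = PowerSeries.C (MvPowerSeries.C (p : WittVector p k)) := by simp
  rw [e1, PowerSeries.map_C, MvPowerSeries.map_C]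
  simp

theorem p_dvd_of_p_dvd_mul {x y : SS p k d} (hy : redSS p k d y ≠ 0)
    (h : (p : SS p k d) ∣ y * x) : (p : SS p k d) ∣ x := by
  apply p_dvd_of_redSS_eq_zero
  obtain ⟨z, hz⟩ := h
  have := congrArg (redSS p k d) hz
  rw [map_mul, map_mul, redSS_p, zero_mul] at this
  exact (mul_eq_zero.1 this).resolve_left hy

/-- If y is nonzero modulo p, then p, y is a regular sequence, because 𝔖/p = k[[u, t_1, …, t_d]] is
a domain. Hence 𝔖/y has no p-torsion. -/
theorem dvd_of_dvd_p_mul {x y : SS p k d} (hy : redSS p k d y ≠ 0) (h : y ∣ p * x) : y ∣ x := by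
  obtain ⟨z, hz⟩ := h
  obtain ⟨w, rfl⟩ := p_dvd_of_p_dvd_mul hy ⟨x, hz.symm⟩
  exact ⟨w, p_mul_cancel_SS (by rw [hz]; ring)⟩

theorem quotient_torsionFree {y : SS p k d} (hy : redSS p k d y ≠ 0)
    (x : SS p k d ⧸ Ideal.span {y}) (h : (p : SS p k d ⧸ Ideal.span {y}) * x = 0) : x = 0 := by
  obtain ⟨x, rfl⟩ := Ideal.Quotient.mk_surjective x
  rw [← map_natCast (Ideal.Quotient.mk _), ← map_mul, Ideal.Quotient.eq_zero_iff_mem,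
    Ideal.mem_span_singleton] at h
  rw [Ideal.Quotient.eq_zero_iff_mem, Ideal.mem_span_singleton]
  exact dvd_of_dvd_p_mul hy h

variable (p k d) in
/-- The homomorphism `ℤ_p → 𝔖`. -/
def zpToSS : ℤ_[p] →+* SS p k d := (PowerSeries.C.comp MvPowerSeries.C).comp (zpToW p k)

theorem quotient_natTorsionFree {y : SS p k d} (hy : redSS p k d y ≠ 0) (n : ℕ) (hn : n ≠ 0)
    (x : SS p k d ⧸ Ideal.span {y}) (h : (n : SS p k d ⧸ Ideal.span {y}) * x = 0) : x = 0 :=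
  natCast_mul_eq_zero ((Ideal.Quotient.mk _).comp (zpToSS p k d)) (quotient_torsionFree hy) hn h

variable (p k d) in
/-- The element `φ^j(u) = (1 + u)^{p^j} - 1`. -/
def phiU (j : ℕ) : SS p k d := (1 + PowerSeries.X) ^ p ^ j - 1

/-- Modulo p the element φ^j(u) is u^{p^j}. -/
theorem redSS_phiU (j : ℕ) : redSS p k d (phiU p k d j) ≠ 0 := by
  have hc : CharP (PS d k) p :=
    charP_of_injective_ringHom (f := (PowerSeries.C (R := MvPowerSeries (Fin d) k)).comp
      (MvPowerSeries.C)) (RingHom.injective _) p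
  rw [phiU, map_sub, map_pow, map_add, map_one, PowerSeries.map_X, add_pow_char_pow, one_pow,
    add_sub_cancel_left]
  exact pow_ne_zero _ PowerSeries.X_ne_zero

theorem redSS_cycE : redSS p k d (cycE d p (WittVector p k) r) ≠ 0 := by
  obtain ⟨y, hy⟩ : (p : SS p k d) ∣ cycE d p (WittVector p k) r -
    PowerSeries.X ^ (p ^ (r - 1) * (p - 1)) := dvd_geom_sub (p := p) (r - 1) _
  rw [eq_add_of_sub_eq hy, map_add, map_mul, redSS_p, zero_mul, zero_add, map_pow,
    PowerSeries.map_X]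
  exact pow_ne_zero _ PowerSeries.X_ne_zero

theorem phiSS_phiU (j : ℕ) : phiSS p k d (phiU p k d j) = phiU p k d (j + 1) := by
  rw [phiU, phiU, map_sub, map_pow, map_add, map_one, phiSS, frob_X]
  ring

theorem phiU_dvd {i j : ℕ} (h : i ≤ j) : phiU p k d i ∣ phiU p k d j := by
  obtain ⟨l, rfl⟩ := Nat.exists_eq_add_of_le h
  have := sub_dvd_pow_sub_pow ((1 + PowerSeries.X : SS p k d) ^ p ^ i) 1 (p ^ l)
  rwa [one_pow, ← pow_mul, ← pow_add] at this

theorem cycE_dvd_phiU (hr : 1 ≤ r) : cycE d p (WittVector p k) r ∣ phiU p k d r := by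
  have := cycE_mul (p := p) d (WittVector.frobenius (p := p) (R := k)) r hr
  rw [frob_iterate_X, frob_iterate_X] at this
  exact ⟨_, this.symm⟩

/-- Modulo φ^{r-1}(u) each of the p summands (1+u)^{i p^{r-1}} of E_r equals 1. -/
theorem phiU_dvd_cycE_sub : phiU p k d (r - 1) ∣ cycE d p (WittVector p k) r - p := by
  have : cycE d p (WittVector p k) r - p =
      ∑ i ∈ Finset.range p, (((1 + PowerSeries.X : SS p k d) ^ p ^ (r - 1)) ^ i - 1) := by
    rw [Finset.sum_sub_distrib, cycE]
    simp
  rw [this]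
  refine Finset.dvd_sum fun i _ => ?_
  have := sub_dvd_pow_sub_pow ((1 + PowerSeries.X : SS p k d) ^ p ^ (r - 1)) 1 i
  rwa [one_pow] at this

end Reduction

/-! ### Homomorphisms from the divided power envelope -/

section Envelope

variable {p : ℕ} [Fact p.Prime] {k : Type u} [Field k] [CharP k p] [PerfectRing k p] {d r : ℕ}

variable (p k d r) in
/-- The homomorphism from `𝔖` to the divided power envelope of `E_r 𝔖`. -/
abbrev inclPD : SS p k d →+* PD p k d r := inclHull (incl p k d) (idealE p k d r)

theorem phiPD_incl (s : SS p k d) : phiPD p k d r (inclPD p k d r s) =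
    inclPD p k d r (phiSS p k d s) := Subtype.ext (incl_phi s).symm

theorem cycPD_incl (a : ℤ_[p]) (s : SS p k d) : cycPD p k d r a (inclPD p k d r s) =
    inclPD p k d r (cycSS p k d a s) := Subtype.ext (incl_cyc a s).symm

theorem projPD_incl (s : SS p k d) :
    projPD p k d r (inclPD p k d r s) = PowerSeries.constantCoeff s := by
  apply map_algebraMap_injective
  rw [← constantCoeff_incl]
  exact projHull_spec _ _ _ _ _

theorem coe_derPD (x : PD p k d r) : (derPD p k d r x : SF p k d) =
    PowerSeries.derivative (MvPowerSeries (Fin d) (FF p k)) (x : SF p k d) := rfl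

theorem derPD_incl (s : SS p k d) : derPD p k d r (inclPD p k d r s) =
    inclPD p k d r (PowerSeries.derivative _ s) :=
  Subtype.ext (psMap_derivative d (algebraMap (WittVector p k) (FF p k)) s).symm

theorem A_torsionFree (x : MvPowerSeries (Fin d) (WittVector p k))
    (h : (p : MvPowerSeries (Fin d) (WittVector p k)) * x = 0) : x = 0 := by
  have h1 : (PowerSeries.C x : SS p k d) = 0 := by
    apply p_mul_cancel_SS
    rw [← map_natCast PowerSeries.C, ← map_mul, h, map_zero, mul_zero]
  simpa using congrArg PowerSeries.constantCoeff h1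

theorem A_natTorsionFree (n : ℕ) (hn : n ≠ 0) (x : MvPowerSeries (Fin d) (WittVector p k))
    (h : (n : MvPowerSeries (Fin d) (WittVector p k)) * x = 0) : x = 0 :=
  natCast_mul_eq_zero (MvPowerSeries.C.comp (zpToW p k)) A_torsionFree hn h

/-- The ring `PD / pdIdeal` is `𝔖 / E_r 𝔖`. -/
theorem mem_idealE_of_incl_mem {s : SS p k d} (h : inclPD p k d r s ∈ pdIdeal p k d r) :
    s ∈ idealE p k d r := by
  obtain ⟨n, t, hn, ht, hx⟩ := exists_natCast_mul_of_mem h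
  have h1 : (n : SS p k d) * s = t := by
    apply incl_injective
    have := congrArg Subtype.val hx
    rw [map_mul, map_natCast]
    exact this
  change s ∈ Ideal.span {_}
  rw [← Ideal.Quotient.eq_zero_iff_mem]
  refine quotient_natTorsionFree redSS_cycE n hn _ ?_
  rw [← map_natCast (Ideal.Quotient.mk _), ← map_mul, h1, Ideal.Quotient.eq_zero_iff_mem]
  exact ht

/-- The quotient is 𝔖/E_r, and E_r is nonzero modulo p. -/
theorem R_torsionFree (x : PD p k d r ⧸ pdIdeal p k d r)
    (h : (p : PD p k d r ⧸ pdIdeal p k d r) * x = 0) : x = 0 := by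
  obtain ⟨x, rfl⟩ := Ideal.Quotient.mk_surjective x
  obtain ⟨s, hs⟩ := exists_sub_mem_pdHullIdeal x
  have e : Ideal.Quotient.mk (pdIdeal p k d r) x = Ideal.Quotient.mk _ (inclPD p k d r s) :=
    Ideal.Quotient.eq.2 hs
  rw [e, ← map_natCast (Ideal.Quotient.mk _), ← map_mul, Ideal.Quotient.eq_zero_iff_mem,
    ← map_natCast (inclPD p k d r), ← map_mul] at h
  rw [e, Ideal.Quotient.eq_zero_iff_mem]
  apply inclHull_mem_pdHullIdeal
  have h1 := Ideal.mem_span_singleton.1 (mem_idealE_of_incl_mem h)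
  exact Ideal.mem_span_singleton.2 (dvd_of_dvd_p_mul redSS_cycE h1)

theorem R_natTorsionFree (n : ℕ) (hn : n ≠ 0) (x : PD p k d r ⧸ pdIdeal p k d r)
    (h : (n : PD p k d r ⧸ pdIdeal p k d r) * x = 0) : x = 0 :=
  natCast_mul_eq_zero ((Ideal.Quotient.mk _).comp ((inclPD p k d r).comp (zpToSS p k d)))
    R_torsionFree hn h

variable (p k d) in
/-- The ring `𝔖 / φ^j(u) 𝔖`. -/
abbrev BU (j : ℕ) : Type u := SS p k d ⧸ Ideal.span {phiU p k d j}

theorem BU_natTorsionFree (j n : ℕ) (hn : n ≠ 0) (x : BU p k d j)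
    (h : (n : BU p k d j) * x = 0) : x = 0 :=
  quotient_natTorsionFree (redSS_phiU j) n hn x h

/-- For j < r the element E_r becomes p in 𝔖/φ^j(u), and p has divided powers in this torsion free
ring. -/
theorem exists_extPD {j : ℕ} (hj : j < r) :
    ∃ f : PD p k d r →+* BU p k d j, ∀ s, f (inclPD p k d r s) = Ideal.Quotient.mk _ s := by
  refine exists_hull_ringHom incl_injective (p := p)
    (hasPPowDivFactorial p ((Ideal.Quotient.mk _).comp (zpToSS p k d))) (BU_natTorsionFree j) _ ?_
  intro a ha
  obtain ⟨e, rfl⟩ := Ideal.mem_span_singleton.1 ha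
  rw [map_mul]
  refine Dvd.dvd.mul_right ?_ _
  have h : phiU p k d j ∣ cycE d p (WittVector p k) r - p :=
    (phiU_dvd (by omega)).trans phiU_dvd_cycE_sub
  rw [← Ideal.mem_span_singleton, ← Ideal.Quotient.eq_zero_iff_mem, map_sub, sub_eq_zero,
    map_natCast] at h
  rw [h]

variable (p k d) in
/-- The homomorphism from the divided power envelope of `E_r 𝔖` to `𝔖 / φ^j(u) 𝔖` for `j < r`,
which sends `E_r` to `p`. -/
def extPD {j : ℕ} (hj : j < r) : PD p k d r →+* BU p k d j := (exists_extPD hj).choose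

theorem extPD_incl {j : ℕ} (hj : j < r) (s : SS p k d) :
    extPD p k d hj (inclPD p k d r s) = Ideal.Quotient.mk _ s := (exists_extPD hj).choose_spec s

theorem phiSS_mem_span {i j : ℕ} (h : j ≤ i + 1) :
    Ideal.span {phiU p k d i} ≤ (Ideal.span {phiU p k d j}).comap (phiSS p k d) := by
  rw [Ideal.span_singleton_le_iff_mem, Ideal.mem_comap, phiSS_phiU, Ideal.mem_span_singleton]
  exact phiU_dvd h

/-- Frobenius moves the locus φ^i(u) = 0 to φ^{i+1}(u) = 0. This is what makes the chain of kernels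
climb by one step at each application of Φ. -/
theorem extPD_comp_phiPD {i j : ℕ} (hi : i < r) (hj : j < r) (h : j ≤ i + 1) :
    (extPD p k d hj).comp (phiPD p k d r) =
      (Ideal.quotientMap _ (phiSS p k d) (phiSS_mem_span h)).comp (extPD p k d hi) := by
  refine hull_ringHom_ext (BU_natTorsionFree j) fun s => ?_
  rw [RingHom.comp_apply, RingHom.comp_apply, phiPD_incl, extPD_incl, extPD_incl,
    Ideal.quotientMap_mk]

/-- The homomorphism `𝔖 / φ^{r-1}(u) → R_r` induced by `φ`. -/
def phiBU (hr : 1 ≤ r) : BU p k d (r - 1) →+* PD p k d r ⧸ pdIdeal p k d r :=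
  Ideal.Quotient.lift _ (((Ideal.Quotient.mk _).comp (inclPD p k d r)).comp (phiSS p k d))
    fun a ha => by
      obtain ⟨e, rfl⟩ := Ideal.mem_span_singleton.1 ha
      rw [map_mul]
      refine mul_eq_zero_of_left ?_ _
      rw [RingHom.comp_apply, RingHom.comp_apply, Ideal.Quotient.eq_zero_iff_mem, phiSS_phiU,
        Nat.sub_add_cancel hr]
      exact inclHull_mem_pdHullIdeal (Ideal.mem_span_singleton.2 (cycE_dvd_phiU hr))

theorem mk_comp_phiPD (hr : 1 ≤ r) (h : r - 1 < r) :
    (Ideal.Quotient.mk (pdIdeal p k d r)).comp (phiPD p k d r) =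
      (phiBU hr).comp (extPD p k d h) := by
  refine hull_ringHom_ext R_natTorsionFree fun s => ?_
  rw [RingHom.comp_apply, RingHom.comp_apply, phiPD_incl, extPD_incl]
  rfl

theorem cycSS_sub_dvd (n : ℕ) (b : ℤ_[p]) (s : SS p k d) :
    phiU p k d n ∣ cycSS p k d (1 + p ^ n * b) s - s := by
  have := pow_sub_one_dvd_cyc_sub d (zpToW p k) (p ^ n) b s
  push_cast at this
  exact this

theorem extPD_comp_cycPD {j : ℕ} (hj : j < r) (b : ℤ_[p]) :
    (extPD p k d hj).comp (cycPD p k d r (1 + p ^ r * b)) = extPD p k d hj := by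
  refine hull_ringHom_ext (BU_natTorsionFree j) fun s => ?_
  rw [RingHom.comp_apply, cycPD_incl, extPD_incl, extPD_incl, Ideal.Quotient.eq,
    Ideal.mem_span_singleton]
  exact (phiU_dvd hj.le).trans (cycSS_sub_dvd r b s)

theorem mk_comp_cycPD (hr : 1 ≤ r) (b : ℤ_[p]) :
    (Ideal.Quotient.mk (pdIdeal p k d r)).comp (cycPD p k d r (1 + p ^ r * b)) =
      Ideal.Quotient.mk (pdIdeal p k d r) := by
  refine hull_ringHom_ext R_natTorsionFree fun s => ?_
  rw [RingHom.comp_apply, cycPD_incl, Ideal.Quotient.eq, ← map_sub]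
  exact inclHull_mem_pdHullIdeal (Ideal.mem_span_singleton.2
    ((cycE_dvd_phiU hr).trans (cycSS_sub_dvd r b s)))

theorem constantCoeff_cyc {C : Type u} [CommRing C] (ι : ℤ_[p] →+* C) (a : ℤ_[p]) (x : PS d C) :
    PowerSeries.constantCoeff (cyc d ι a x) = PowerSeries.constantCoeff x := by
  have h1 : (PowerSeries.X : PS d C) ∣ onePlusPow d ι a - 1 - PowerSeries.X :=
    dvd_sub (PowerSeries.X_dvd_iff.2 (constantCoeff_onePlusPow d ι a)) dvd_rfl
  have h2 := h1.trans (sub_X_dvd_subst_sub (constantCoeff_onePlusPow d ι a) x)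
  rw [← cyc_eq_subst, PowerSeries.X_dvd_iff, map_sub] at h2
  exact sub_eq_zero.1 h2

theorem projPD_comp_cycPD (a : ℤ_[p]) :
    (projPD p k d r).comp (cycPD p k d r a) = projPD p k d r := by
  refine hull_ringHom_ext A_natTorsionFree fun s => ?_
  rw [RingHom.comp_apply, cycPD_incl, projPD_incl, projPD_incl]
  exact constantCoeff_cyc (zpToW p k) a s

/-- Since u divides φ(u), Frobenius descends to 𝔖/u, viewed here through the constants. -/
theorem projPD_comp_phiPD : (projPD p k d r).comp (phiPD p k d r) =
    ((PowerSeries.constantCoeff.comp (phiSS p k d)).comp PowerSeries.C).comp (projPD p k d r) := by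
  refine hull_ringHom_ext A_natTorsionFree fun s => ?_
  have h : (PowerSeries.X : SS p k d) ∣ s - PowerSeries.C (PowerSeries.constantCoeff s) := by
    rw [PowerSeries.X_dvd_iff]; simp
  have h1 := X_dvd_phi.trans (map_dvd (phiSS p k d) h)
  rw [PowerSeries.X_dvd_iff, map_sub, map_sub, sub_eq_zero] at h1
  rw [RingHom.comp_apply, phiPD_incl, projPD_incl, h1, RingHom.comp_apply, projPD_incl]
  rfl

theorem extPD_zero_eq (h : 0 < r) : extPD p k d h =
    ((Ideal.Quotient.mk _).comp PowerSeries.C).comp (projPD p k d r) := by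
  refine hull_ringHom_ext (BU_natTorsionFree 0) fun s => ?_
  rw [RingHom.comp_apply, extPD_incl, projPD_incl, RingHom.comp_apply, Ideal.Quotient.eq,
    Ideal.mem_span_singleton]
  have e : phiU p k d 0 = PowerSeries.X := by simp [phiU]
  rw [e, PowerSeries.X_dvd_iff]
  simp

end Envelope

/-! ### The linear term of elements of the divided power ideal -/

section LinearTerm

variable {p : ℕ} [Fact p.Prime] {k : Type u} [Field k] [CharP k p] [PerfectRing k p] {d r : ℕ}

/-- The derivative of a power series at zero. -/
theorem constantCoeff_derivative_mul {A : Type*} [CommRing A] (f g : PowerSeries A) :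
    PowerSeries.constantCoeff (PowerSeries.derivative A (f * g)) =
      PowerSeries.constantCoeff (PowerSeries.derivative A f) * PowerSeries.constantCoeff g +
      PowerSeries.constantCoeff f * PowerSeries.constantCoeff (PowerSeries.derivative A g) := by
  rw [Derivation.leibniz]
  simp only [smul_eq_mul, map_add, map_mul]
  ring

theorem constantCoeff_derivative_one_add_X_pow {A : Type*} [CommRing A] (n : ℕ) :
    PowerSeries.constantCoeff (PowerSeries.derivative A ((1 + PowerSeries.X) ^ n)) = n := by
  rw [Derivation.leibniz_pow, map_add, Derivation.map_one_eq_zero, PowerSeries.derivative_X]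
  simp

theorem derPD_mul (x y : PD p k d r) :
    derPD p k d r (x * y) = derPD p k d r x * y + x * derPD p k d r y := by
  ext1
  push_cast
  rw [coe_derPD, coe_derPD, coe_derPD, Subring.coe_mul, Derivation.leibniz]
  simp only [smul_eq_mul]
  ring

theorem derPD_dp (n : ℕ) {a : SS p k d} (ha : a ∈ idealE p k d r) :
    derPD p k d r ⟨dp (n + 1) (incl p k d a), dp_mem (n + 1) ha⟩ =
      ⟨dp n (incl p k d a), dp_mem n ha⟩ * inclPD p k d r (PowerSeries.derivative _ a) := by
  ext1
  rw [coe_derPD, Subring.coe_mul, coe_inclHull, psMap_derivative]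
  simp only
  apply natCast_mul_cancel (n + 1).factorial_ne_zero
  have h := congrArg (PowerSeries.derivative (MvPowerSeries (Fin d) (FF p k)))
    (factorial_mul_dp (n + 1) (incl p k d a))
  rw [← nsmul_eq_mul, map_nsmul, nsmul_eq_mul, Derivation.leibniz_pow] at h
  rw [h, Nat.factorial_succ, Nat.add_sub_cancel, ← factorial_mul_dp n]
  simp only [nsmul_eq_mul, smul_eq_mul]
  push_cast
  ring

theorem constantCoeff_cycE :
    PowerSeries.constantCoeff (cycE d p (WittVector p k) r) = p := by
  simp [cycE]

/-- For odd `p`, the derivative of `E_r` at zero is divisible by `p ^ r`. -/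
theorem pow_dvd_derivative_cycE (hp : 2 < p) (hr : 1 ≤ r) :
    (p : MvPowerSeries (Fin d) (WittVector p k)) ^ r ∣
      PowerSeries.constantCoeff (PowerSeries.derivative _ (cycE d p (WittVector p k) r)) := by
  have h1 : PowerSeries.constantCoeff (PowerSeries.derivative _ (cycE d p (WittVector p k) r)) =
      ((p ^ (r - 1) * ∑ i ∈ Finset.range p, i : ℕ) :
        MvPowerSeries (Fin d) (WittVector p k)) := by
    rw [cycE, map_sum, map_sum, Finset.mul_sum, Nat.cast_sum]
    refine Finset.sum_congr rfl fun i _ => ?_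
    rw [← pow_mul, constantCoeff_derivative_one_add_X_pow]
  -- The sum is p(p-1)/2; for p = 2 it would be 1, so oddness is essential.
  have h2 : p ∣ ∑ i ∈ Finset.range p, i := by
    have h3 := Finset.sum_range_id_mul_two p
    have h4 : p ∣ (∑ i ∈ Finset.range p, i) * 2 := ⟨p - 1, h3⟩
    refine (Nat.Coprime.dvd_mul_right ?_).1 h4
    exact ((Nat.coprime_primes Fact.out Nat.prime_two).2 (by omega))
  obtain ⟨c, hc⟩ := h2
  rw [h1, hc]
  refine ⟨c, ?_⟩
  have : p ^ r = p ^ (r - 1) * p := by rw [← pow_succ, Nat.sub_add_cancel hr]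
  rw [← Nat.cast_pow, this]
  push_cast
  ring

/-- The `p`-adic integer `p ^ n / n!`. -/
def pPowDiv (p : ℕ) [Fact p.Prime] (n : ℕ) : ℤ_[p] := (PadicInt.dividedPowers p).dpow n p

theorem factorial_mul_pPowDiv (n : ℕ) : (n.factorial : ℤ_[p]) * pPowDiv p n = (p : ℤ_[p]) ^ n :=
  (PadicInt.dividedPowers p).factorial_mul_dpow_eq_pow (Ideal.mem_span_singleton_self _)

theorem dvd_pPowDiv {n : ℕ} (hn : n ≠ 0) : (p : ℤ_[p]) ∣ pPowDiv p n :=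
  Ideal.mem_span_singleton.1
    ((PadicInt.dividedPowers p).dpow_mem hn (Ideal.mem_span_singleton_self _))

/-- The arithmetic counterpart of differentiating divided powers, used to compare the derivative of
(E_r e)^{n+1}/(n+1)! with that of (p^{n+1}/(n+1)!) e^{n+1}. -/
theorem succ_mul_pPowDiv (n : ℕ) : ((n : ℤ_[p]) + 1) * pPowDiv p (n + 1) = p * pPowDiv p n := by
  have h1 := factorial_mul_pPowDiv (p := p) (n + 1)
  rw [pow_succ, ← factorial_mul_pPowDiv (p := p) n, Nat.factorial_succ] at h1
  apply mul_left_cancel₀ (Nat.cast_ne_zero.2 n.factorial_ne_zero : (n.factorial : ℤ_[p]) ≠ 0)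
  push_cast at h1
  linear_combination h1

theorem constantCoeff_zpToSS (a : ℤ_[p]) : PowerSeries.constantCoeff (zpToSS p k d a) =
    MvPowerSeries.C (zpToW p k a) := by
  simp [zpToSS]

theorem derivative_zpToSS (a : ℤ_[p]) : PowerSeries.derivative _ (zpToSS p k d a) = 0 := by
  simp [zpToSS]

/-- The power series `g` represents the element `y` of the divided power envelope modulo
`φ^{r-1}(u)`, and its derivative at zero modulo `p ^ r`. -/
structure Represents (h : r - 1 < r) (y : PD p k d r) (g : SS p k d) : Prop where
  ext_eq : extPD p k d h y = Ideal.Quotient.mk _ g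
  proj_eq : projPD p k d r y = PowerSeries.constantCoeff g
  dvd : (p : MvPowerSeries (Fin d) (WittVector p k)) ^ r ∣
    projPD p k d r (derPD p k d r y) - PowerSeries.constantCoeff (PowerSeries.derivative _ g)

theorem represents_incl (h : r - 1 < r) (s : SS p k d) : Represents h (inclPD p k d r s) s where
  ext_eq := extPD_incl h s
  proj_eq := projPD_incl s
  dvd := by rw [derPD_incl, projPD_incl, sub_self]; exact dvd_zero _

theorem Represents.add {h : r - 1 < r} {x y : PD p k d r} {f g : SS p k d} (hx : Represents h x f)
    (hy : Represents h y g) : Represents h (x + y) (f + g) where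
  ext_eq := by rw [map_add, map_add, hx.ext_eq, hy.ext_eq]
  proj_eq := by rw [map_add, map_add, hx.proj_eq, hy.proj_eq]
  dvd := by
    have := dvd_add hx.dvd hy.dvd
    rwa [sub_add_sub_comm, ← map_add, ← map_add, ← map_add, ← map_add] at this

theorem Represents.neg {h : r - 1 < r} {x : PD p k d r} {f : SS p k d} (hx : Represents h x f) :
    Represents h (-x) (-f) where
  ext_eq := by rw [map_neg, map_neg, hx.ext_eq]
  proj_eq := by rw [map_neg, map_neg, hx.proj_eq]
  dvd := by
    have := (dvd_neg).2 hx.dvd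
    rwa [neg_sub', ← map_neg, ← map_neg, ← map_neg, ← map_neg] at this

theorem Represents.mul {h : r - 1 < r} {x y : PD p k d r} {f g : SS p k d} (hx : Represents h x f)
    (hy : Represents h y g) : Represents h (x * y) (f * g) where
  ext_eq := by rw [map_mul, map_mul, hx.ext_eq, hy.ext_eq]
  proj_eq := by rw [map_mul, map_mul, hx.proj_eq, hy.proj_eq]
  dvd := by
    rw [derPD_mul, constantCoeff_derivative_mul, map_add, map_mul, map_mul, hx.proj_eq, hy.proj_eq]
    have := dvd_add (hx.dvd.mul_right (PowerSeries.constantCoeff g))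
      (hy.dvd.mul_left (PowerSeries.constantCoeff f))
    convert this using 1
    ring

/-- For the three data recorded by `Represents`, E_r may be replaced by the constant p: E_r ≡ p
modulo φ^{r-1}(u), E_r(0) = p, and E_r'(0) ≡ 0 modulo p^r. -/
theorem represents_dp (hp : 2 < p) (hr : 1 ≤ r) (h : r - 1 < r) (n : ℕ) (e : SS p k d)
    (he : cycE d p (WittVector p k) r * e ∈ idealE p k d r) :
    Represents h ⟨dp n (incl p k d (cycE d p (WittVector p k) r * e)), dp_mem n he⟩
      (zpToSS p k d (pPowDiv p n) * e ^ n) := by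
  have hdp : ∀ n, (n.factorial : PD p k d r) *
      ⟨dp n (incl p k d (cycE d p (WittVector p k) r * e)), dp_mem n he⟩ =
        inclPD p k d r (cycE d p (WittVector p k) r * e) ^ n := fun n =>
    Subtype.ext (by push_cast; exact factorial_mul_dp _ _)
  have hζ : ∀ n, (n.factorial : SS p k d) * zpToSS p k d (pPowDiv p n) = (p : SS p k d) ^ n := by
    intro n
    have := congrArg (zpToSS p k d) (factorial_mul_pPowDiv (p := p) n)
    simpa using this
  have hproj : ∀ n, projPD p k d r
      ⟨dp n (incl p k d (cycE d p (WittVector p k) r * e)), dp_mem n he⟩ =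
        PowerSeries.constantCoeff (zpToSS p k d (pPowDiv p n) * e ^ n) := by
    intro n
    rw [← sub_eq_zero]
    refine A_natTorsionFree _ n.factorial_ne_zero _ ?_
    have h1 := congrArg (projPD p k d r) (hdp n)
    have h2 := congrArg (PowerSeries.constantCoeff) (hζ n)
    rw [map_mul, map_natCast, map_pow, projPD_incl, map_mul PowerSeries.constantCoeff,
      constantCoeff_cycE] at h1
    rw [map_mul, map_natCast, map_pow, map_natCast] at h2
    rw [mul_sub, h1, map_mul, map_pow]
    linear_combination -(PowerSeries.constantCoeff e) ^ n * h2
  refine ⟨?_, hproj n, ?_⟩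
  · rw [← sub_eq_zero]
    refine BU_natTorsionFree _ _ n.factorial_ne_zero _ ?_
    have h1 := congrArg (extPD p k d h) (hdp n)
    have h2 := congrArg (Ideal.Quotient.mk (Ideal.span {phiU p k d (r - 1)})) (hζ n)
    have h3 : Ideal.Quotient.mk (Ideal.span {phiU p k d (r - 1)}) (cycE d p (WittVector p k) r) =
        p := by
      rw [← map_natCast (Ideal.Quotient.mk _), Ideal.Quotient.eq, Ideal.mem_span_singleton]
      exact phiU_dvd_cycE_sub
    rw [map_mul, map_natCast, map_pow, extPD_incl, map_mul (Ideal.Quotient.mk _), h3] at h1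
    rw [map_mul, map_natCast, map_pow, map_natCast] at h2
    rw [mul_sub, h1, map_mul, map_pow]
    linear_combination -(Ideal.Quotient.mk (Ideal.span {phiU p k d (r - 1)}) e) ^ n * h2
  · cases n with
    | zero =>
      have h1 : (⟨dp 0 (incl p k d (cycE d p (WittVector p k) r * e)), dp_mem 0 he⟩ :
          PD p k d r) = inclPD p k d r 1 := by
        rw [map_one]; exact Subtype.ext (dp_zero _)
      rw [h1, derPD_incl, pow_zero, mul_one, derivative_zpToSS, Derivation.map_one_eq_zero,
        map_zero, map_zero, map_zero, sub_zero]
      exact dvd_zero _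
    | succ n =>
      rw [derPD_dp n he, map_mul, hproj n, projPD_incl, constantCoeff_derivative_mul,
        constantCoeff_derivative_mul, derivative_zpToSS, map_zero, zero_mul, zero_add,
        Derivation.leibniz_pow, constantCoeff_cycE]
      have h1 := congrArg (fun x => (MvPowerSeries.C (zpToW p k x) :
        MvPowerSeries (Fin d) (WittVector p k))) (succ_mul_pPowDiv (p := p) n)
      simp only [map_mul, map_add, map_natCast, map_one] at h1
      -- In the derivative of E_r e at zero, the term with E_r'(0) = p^r c is the whole discrepancy;
      -- the other term cancels against the derivative of the representing series.
      obtain ⟨c, hc⟩ := pow_dvd_derivative_cycE (d := d) (k := k) hp hr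
      rw [hc]
      simp only [map_mul, map_pow, constantCoeff_zpToSS, nsmul_eq_mul, smul_eq_mul, map_natCast,
        Nat.add_sub_cancel]
      push_cast
      refine ⟨MvPowerSeries.C (zpToW p k (pPowDiv p n)) * c *
        PowerSeries.constantCoeff e ^ (n + 1), ?_⟩
      linear_combination -(PowerSeries.constantCoeff e ^ n *
        PowerSeries.constantCoeff (PowerSeries.derivative _ e)) * h1

theorem exists_represents (hp : 2 < p) (hr : 1 ≤ r) (h : r - 1 < r) (y : PD p k d r) :
    ∃ g, Represents h y g := by
  obtain ⟨y, hy⟩ := y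
  induction hy using Subring.closure_induction with
  | mem x hx =>
    rcases hx with ⟨s, rfl⟩ | ⟨n, a, ha, rfl⟩
    · exact ⟨s, represents_incl h s⟩
    · obtain ⟨e, rfl⟩ := Ideal.mem_span_singleton.1 ha
      exact ⟨_, represents_dp hp hr h n e ha⟩
  | zero => exact ⟨0, by have := represents_incl (r := r) h (0 : SS p k d); rwa [map_zero] at this⟩
  | one => exact ⟨1, by have := represents_incl (r := r) h (1 : SS p k d); rwa [map_one] at this⟩
  | add x y hx' hy' hx hy =>
    obtain ⟨f, hf⟩ := hx
    obtain ⟨g, hg⟩ := hy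
    exact ⟨_, hf.add hg⟩
  | neg x hx' hx =>
    obtain ⟨f, hf⟩ := hx
    exact ⟨_, hf.neg⟩
  | mul x y hx' hy' hx hy =>
    obtain ⟨f, hf⟩ := hx
    obtain ⟨g, hg⟩ := hy
    have e : (⟨x * y, Subring.mul_mem _ hx' hy'⟩ : PD p k d r) = ⟨x, hx'⟩ * ⟨y, hy'⟩ := rfl
    rw [e]
    exact ⟨f * g, hf.mul hg⟩

/-- For n ≥ 1 the integer p^n/n! is divisible by p, so the representatives of the generators of the
ideal are too. -/
theorem exists_represents_of_mem (hp : 2 < p) (hr : 1 ≤ r) (h : r - 1 < r) {y : PD p k d r}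
    (hy : y ∈ pdIdeal p k d r) : ∃ g, (p : SS p k d) ∣ g ∧ Represents h y g := by
  induction hy using Submodule.span_induction with
  | mem x hx =>
    obtain ⟨n, a, hn, ha, hx⟩ := hx
    obtain ⟨e, rfl⟩ := Ideal.mem_span_singleton.1 ha
    have hx' : x = ⟨dp n (incl p k d (cycE d p (WittVector p k) r * e)), dp_mem n ha⟩ :=
      Subtype.ext hx
    rw [hx']
    refine ⟨_, ?_, represents_dp hp hr h n e ha⟩
    have := map_dvd (zpToSS p k d) (dvd_pPowDiv (p := p) hn)
    rw [map_natCast] at this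
    exact this.mul_right _
  | zero =>
    exact ⟨0, dvd_zero _, by
      have := represents_incl (r := r) h (0 : SS p k d); rwa [map_zero] at this⟩
  | add x y _ _ hx hy =>
    obtain ⟨f, hf', hf⟩ := hx
    obtain ⟨g, hg', hg⟩ := hy
    exact ⟨_, dvd_add hf' hg', hf.add hg⟩
  | smul y x _ hx =>
    obtain ⟨f, hf', hf⟩ := hx
    obtain ⟨g, hg⟩ := exists_represents hp hr h y
    exact ⟨_, hf'.mul_left _, hg.mul hf⟩

/-- An element of the divided power ideal that vanishes modulo `φ^{r-1}(u)` and `p ^ r` has linear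
term divisible by `p ^ r`. -/
theorem pow_dvd_proj_der (hp : 2 < p) (hr : 1 ≤ r) (h : r - 1 < r) {y : PD p k d r}
    (hy : y ∈ pdIdeal p k d r) (hy' : (p : BU p k d (r - 1)) ^ r ∣ extPD p k d h y) :
    (p : MvPowerSeries (Fin d) (WittVector p k)) ^ r ∣ projPD p k d r (derPD p k d r y) := by
  obtain ⟨g, hg, hR⟩ := exists_represents_of_mem hp hr h hy
  rw [← dvd_sub_left (c := PowerSeries.constantCoeff (PowerSeries.derivative _ g)) ?_]
  · exact hR.dvd
  rw [hR.ext_eq] at hy'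
  obtain ⟨w, hw⟩ := hy'
  obtain ⟨w, rfl⟩ := Ideal.Quotient.mk_surjective w
  rw [← map_natCast (Ideal.Quotient.mk _), ← map_pow, ← map_mul, Ideal.Quotient.eq,
    Ideal.mem_span_singleton] at hw
  obtain ⟨q, hq⟩ := hw
  have hpr : (p : SS p k d) ∣ (p : SS p k d) ^ r := dvd_pow_self _ (by omega)
  -- In g = φ^{r-1}(u) q + p^r w both g and p^r w are divisible by p, and φ^{r-1}(u) is nonzero
  -- modulo p. The extra factor p in q complements the linear coefficient p^{r-1} of φ^{r-1}(u) to
  -- p^r.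
  obtain ⟨q', rfl⟩ : (p : SS p k d) ∣ q := by
    refine p_dvd_of_p_dvd_mul (redSS_phiU (r - 1)) ?_
    rw [← hq]
    exact dvd_sub hg (hpr.mul_right _)
  have e : g = ((p : ℕ) : SS p k d) * (phiU p k d (r - 1) * q') +
      ((p ^ r : ℕ) : SS p k d) * w := by
    push_cast
    linear_combination hq
  have h0 : PowerSeries.constantCoeff (phiU p k d (r - 1)) = 0 := by simp [phiU]
  have h1 : PowerSeries.constantCoeff (PowerSeries.derivative _ (phiU p k d (r - 1))) =
      ((p ^ (r - 1) : ℕ) : MvPowerSeries (Fin d) (WittVector p k)) := by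
    rw [phiU, map_sub, Derivation.map_one_eq_zero, sub_zero, constantCoeff_derivative_one_add_X_pow]
  have hN : ∀ (n : ℕ) (f : SS p k d),
      PowerSeries.constantCoeff (PowerSeries.derivative _ ((n : SS p k d) * f)) =
        n * PowerSeries.constantCoeff (PowerSeries.derivative _ f) := by
    intro n f
    rw [← nsmul_eq_mul, map_nsmul, nsmul_eq_mul, map_mul, map_natCast]
  rw [e, map_add, map_add, hN, hN, constantCoeff_derivative_mul, h0, h1]
  refine ⟨PowerSeries.constantCoeff q' + PowerSeries.constantCoeff (PowerSeries.derivative _ w), ?_⟩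
  have : p ^ r = p ^ (r - 1) * p := by rw [← pow_succ, Nat.sub_add_cancel hr]
  rw [← Nat.cast_pow, this]
  push_cast
  ring

end LinearTerm

/-! ### The ring `S_r` as a frame with a derivation -/

section SRFacts

variable {p : ℕ} [Fact p.Prime] {k : Type u} [Field k] [CharP k p] [PerfectRing k p] {d r : ℕ}

variable (p k d r) in
/-- The homomorphism from the divided power envelope to its completion `S_r`. -/
def ofPD : PD p k d r →+* SR p k d r := algebraMap (PD p k d r) (PCompl p (PD p k d r))

theorem toSR_eq (s : SS p k d) : toSR p k d r s = ofPD p k d r (inclPD p k d r s) := rfl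

theorem SR_exists (x : SR p k d r) (n : ℕ) :
    ∃ (b : PD p k d r) (y : SR p k d r), x = ofPD p k d r b + (p : SR p k d r) ^ n * y :=
  compl_exists (p := p) (B := PD p k d r) x n

theorem SR_haus {x : SR p k d r} (h : ∀ n, (p : SR p k d r) ^ n ∣ x) : x = 0 :=
  compl_haus (p := p) (B := PD p k d r) h

theorem SR_addHom_ext {f g : SR p k d r →+ SR p k d r}
    (h : ∀ b, f (ofPD p k d r b) = g (ofPD p k d r b)) (x : SR p k d r) : f x = g x :=
  compl_addHom_ext (p := p) (B := PD p k d r) (T := SR p k d r) (fun _ => SR_haus) (f := f) (g := g)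
    h x

theorem phiSR_ofPD (b : PD p k d r) :
    phiSR p k d r (ofPD p k d r b) = ofPD p k d r (phiPD p k d r b) :=
  complMap_algebraMap _ b

theorem cycSR_ofPD (a : ℤ_[p]) (b : PD p k d r) :
    cycSR p k d r a (ofPD p k d r b) = ofPD p k d r (cycPD p k d r a b) :=
  complMap_algebraMap _ b

theorem derSR_ofPD (b : PD p k d r) :
    derSR p k d r (ofPD p k d r b) = ofPD p k d r (derPD p k d r b) :=
  complAddMap_algebraMap _ b

/-- The Leibniz rule passes from the envelope to its completion by extending one variable at a time.
-/
theorem derSR_mul (x y : SR p k d r) :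
    derSR p k d r (x * y) = derSR p k d r x * y + x * derSR p k d r y := by
  refine SR_addHom_ext (f := (derSR p k d r).comp (AddMonoidHom.mulRight y))
    (g := (AddMonoidHom.mulRight y).comp (derSR p k d r) + AddMonoidHom.mulRight (derSR p k d r y))
    (fun b => ?_) x
  refine SR_addHom_ext (f := (derSR p k d r).comp (AddMonoidHom.mulLeft (ofPD p k d r b)))
    (g := AddMonoidHom.mulLeft (derSR p k d r (ofPD p k d r b)) +
      (AddMonoidHom.mulLeft (ofPD p k d r b)).comp (derSR p k d r)) (fun c => ?_) y
  simp only [AddMonoidHom.comp_apply, AddMonoidHom.add_apply, AddMonoidHom.coe_mulLeft]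
  rw [← map_mul, derSR_ofPD, derPD_mul, map_add, map_mul, map_mul, derSR_ofPD, derSR_ofPD]

variable (p k d r) in
/-- The derivation `(1 + u) d/du` of `S_r`. -/
def eulerSR : SR p k d r →+ SR p k d r := (AddMonoidHom.mulLeft (1 + uSR)).comp (derSR p k d r)

theorem eulerSR_apply (x : SR p k d r) : eulerSR p k d r x = (1 + uSR) * derSR p k d r x := rfl

theorem eulerSR_mul (x y : SR p k d r) :
    eulerSR p k d r (x * y) = eulerSR p k d r x * y + x * eulerSR p k d r y := by
  rw [eulerSR_apply, eulerSR_apply, eulerSR_apply, derSR_mul]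
  ring

variable (p k d r) in
/-- The derivation `(1 + u) d/du` of the divided power envelope. -/
def eulerPD : PD p k d r →+ PD p k d r :=
  (AddMonoidHom.mulLeft (inclPD p k d r (1 + PowerSeries.X))).comp (derPD p k d r)

theorem coe_eulerPD (b : PD p k d r) :
    (eulerPD p k d r b : SF p k d) = eulerOp _ (b : SF p k d) := by
  change incl p k d (1 + PowerSeries.X) * PowerSeries.derivative _ (b : SF p k d) = _
  rw [eulerOp_apply, map_add, map_one, PowerSeries.map_X]

theorem eulerSR_ofPD (b : PD p k d r) :
    eulerSR p k d r (ofPD p k d r b) = ofPD p k d r (eulerPD p k d r b) := by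
  rw [eulerSR_apply, derSR_ofPD]
  change _ = ofPD p k d r (inclPD p k d r (1 + PowerSeries.X) * derPD p k d r b)
  rw [map_mul, ← toSR_eq, map_add, map_one]
  rfl

theorem eulerPD_phi (b : PD p k d r) :
    eulerPD p k d r (phiPD p k d r b) = p * phiPD p k d r (eulerPD p k d r b) := by
  ext1
  rw [coe_eulerPD, Subring.coe_mul]
  change eulerOp _ (phiSF p k d b) = ((p : PD p k d r) : SF p k d) *
    phiSF p k d (eulerPD p k d r b : SF p k d)
  rw [coe_eulerPD, phiSF, eulerOp_frob]
  rfl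

theorem eulerSR_phi (x : SR p k d r) :
    eulerSR p k d r (phiSR p k d r x) = p * phiSR p k d r (eulerSR p k d r x) := by
  refine SR_addHom_ext (f := (eulerSR p k d r).comp (phiSR p k d r).toAddMonoidHom)
    (g := (AddMonoidHom.mulLeft (p : SR p k d r)).comp
      ((phiSR p k d r).toAddMonoidHom.comp (eulerSR p k d r))) (fun b => ?_) x
  change eulerSR p k d r (phiSR p k d r (ofPD p k d r b)) =
    p * phiSR p k d r (eulerSR p k d r (ofPD p k d r b))
  rw [phiSR_ofPD, eulerSR_ofPD, eulerSR_ofPD, phiSR_ofPD, eulerPD_phi, map_mul, map_natCast]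

variable (p k d r) in
/-- The homomorphism `ℤ_p → S_r`. -/
def zpToSR : ℤ_[p] →+* SR p k d r := (toSR p k d r).comp (zpToSS p k d)

theorem eulerPD_cyc (a : ℤ_[p]) (b : PD p k d r) :
    eulerPD p k d r (cycPD p k d r a b) =
      inclPD p k d r (zpToSS p k d a) * cycPD p k d r a (eulerPD p k d r b) := by
  ext1
  rw [coe_eulerPD, Subring.coe_mul]
  change eulerOp _ (cycSF p k d a b) = incl p k d (zpToSS p k d a) *
    cycSF p k d a (eulerPD p k d r b : SF p k d)
  rw [coe_eulerPD, cycSF, eulerOp_cyc]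
  congr 1
  symm
  change PowerSeries.map _ (PowerSeries.C (MvPowerSeries.C (zpToW p k a))) = _
  rw [PowerSeries.map_C, MvPowerSeries.map_C]
  rfl

theorem eulerSR_cyc (a : ℤ_[p]) (x : SR p k d r) :
    eulerSR p k d r (cycSR p k d r a x) =
      zpToSR p k d r a * cycSR p k d r a (eulerSR p k d r x) := by
  refine SR_addHom_ext (f := (eulerSR p k d r).comp (cycSR p k d r a).toAddMonoidHom)
    (g := (AddMonoidHom.mulLeft (zpToSR p k d r a)).comp
      ((cycSR p k d r a).toAddMonoidHom.comp (eulerSR p k d r))) (fun b => ?_) x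
  change eulerSR p k d r (cycSR p k d r a (ofPD p k d r b)) =
    zpToSR p k d r a * cycSR p k d r a (eulerSR p k d r (ofPD p k d r b))
  rw [cycSR_ofPD, eulerSR_ofPD, eulerSR_ofPD, cycSR_ofPD, eulerPD_cyc, map_mul]
  rfl

/-- The Witt components of the image of ℤ_p lie in the prime field. Consequently the values of χ are
fixed by φ. -/
theorem frobenius_zpToW (a : ℤ_[p]) : WittVector.frobenius (zpToW p k a) = zpToW p k a := by
  ext n
  rw [WittVector.coeff_frobenius_charP, zpToW, RingHom.comp_apply, WittVector.map_coeff, ← map_pow,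
    ZMod.pow_card]

theorem phiSS_zpToSS (a : ℤ_[p]) : phiSS p k d (zpToSS p k d a) = zpToSS p k d a := by
  rw [zpToSS, RingHom.comp_apply, RingHom.comp_apply, phiSS, frob, RingHom.comp_apply,
    PowerSeries.map_C]
  have e : ((MvPowerSeries.expand p (Fact.out : p.Prime).ne_zero).toRingHom.comp
      (MvPowerSeries.map WittVector.frobenius)) (MvPowerSeries.C (zpToW p k a)) =
      (MvPowerSeries.C (zpToW p k a) : MvPowerSeries (Fin d) (WittVector p k)) := by
    rw [RingHom.comp_apply, MvPowerSeries.map_C, frobenius_zpToW]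
    exact MvPowerSeries.expand_C _ _ _
  rw [e]
  exact AlgHom.commutes _ _

theorem phiSR_toSR (s : SS p k d) : phiSR p k d r (toSR p k d r s) = toSR p k d r (phiSS p k d s) := by
  rw [toSR_eq, phiSR_ofPD, phiPD_incl]
  rfl

theorem phiSR_zpToSR (a : ℤ_[p]) : phiSR p k d r (zpToSR p k d r a) = zpToSR p k d r a := by
  rw [zpToSR, RingHom.comp_apply, phiSR_toSR, phiSS_zpToSS]

/-! ### Units of S_r and locality -/

theorem p_mem_jacobson : Ideal.span {(p : SR p k d r)} ≤ Ideal.jacobson ⊥ := by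
  have := compl_isAdicComplete p (PD p k d r)
  exact IsAdicComplete.le_jacobson_bot (Ideal.span {(p : PCompl p (PD p k d r))})

theorem isUnit_add_p_mul {x : SR p k d r} (hx : IsUnit x) (y : SR p k d r) :
    IsUnit (x + p * y) := by
  obtain ⟨v, rfl⟩ := hx
  have h := p_mem_jacobson (p := p) (k := k) (d := d) (r := r)
    (Ideal.mem_span_singleton_self (p : SR p k d r))
  rw [Ideal.mem_jacobson_bot] at h
  have h1 := v.isUnit.mul (h (y * (v⁻¹ : (SR p k d r)ˣ)))
  have e : (v : SR p k d r) * (p * (y * (v⁻¹ : (SR p k d r)ˣ)) + 1) = v + p * y := by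
    linear_combination (p * y : SR p k d r) * v.mul_inv
  rwa [e] at h1

theorem isUnit_of_dvd_pow_sub {x v : SR p k d r} (hv : IsUnit v) {n : ℕ}
    (h : (p : SR p k d r) ∣ (v - x) ^ n) : IsUnit x := by
  obtain ⟨y, hy⟩ := h
  obtain ⟨q, hq⟩ := sub_dvd_pow_sub_pow v (v - x) n
  rw [hy, sub_sub_cancel] at hq
  have h1 := isUnit_add_p_mul (hv.pow n) (-y)
  rw [show v ^ n + p * -y = x * q by rw [← hq]; ring] at h1
  exact isUnit_of_mul_isUnit_left h1

/-- An element of `S_r` is a unit if it differs from a unit of `𝔖` by an element which is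
topologically nilpotent. -/
theorem exists_isUnit_of_isUnit (x : SR p k d r) :
    ∃ s : SS p k d, (IsUnit s → IsUnit x) ∧ (IsUnit (1 - s) → IsUnit (1 - x)) := by
  obtain ⟨b, y, rfl⟩ := SR_exists x 1
  obtain ⟨s, hs⟩ := exists_sub_mem_pdHullIdeal b
  obtain ⟨n, hn⟩ := exists_dvd_pow (Fact.out : p.Prime) hs
  have hn' : (p : SR p k d r) ∣ (ofPD p k d r b - toSR p k d r s) ^ n := by
    have := map_dvd (ofPD p k d r) hn
    rwa [map_natCast, map_pow, map_sub] at this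
  refine ⟨s, fun h => ?_, fun h => ?_⟩
  · rw [pow_one]
    refine isUnit_add_p_mul (isUnit_of_dvd_pow_sub (h.map (toSR p k d r)) (n := n) ?_) y
    rw [← neg_sub, neg_pow]
    exact hn'.mul_left _
  · rw [pow_one, show 1 - (ofPD p k d r b + p * y) = 1 - ofPD p k d r b + p * -y by ring]
    refine isUnit_add_p_mul (isUnit_of_dvd_pow_sub (h.map (toSR p k d r)) (n := n) ?_) _
    rw [map_sub, map_one, sub_sub_sub_cancel_left]
    exact hn'

theorem not_isUnit_p : ¬ IsUnit (p : PD p k d r) := by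
  intro h
  have h1 := h.map ((WittVector.constantCoeff (p := p) (R := k)).comp
    ((MvPowerSeries.constantCoeff (σ := Fin d)).comp (projPD p k d r)))
  rw [map_natCast, CharP.cast_eq_zero] at h1
  exact not_isUnit_zero h1

instance SR_nontrivial : Nontrivial (SR p k d r) := by
  refine ⟨⟨0, 1, fun h => not_isUnit_p (p := p) (k := k) (d := d) (r := r) ?_⟩⟩
  have h1 : AdicCompletion.evalₐ (Ideal.span {(p : PD p k d r)}) 1 0 =
    AdicCompletion.evalₐ (Ideal.span {(p : PD p k d r)}) 1 1 :=
    congrArg (AdicCompletion.evalₐ (Ideal.span {(p : PD p k d r)}) 1) h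
  rw [map_zero, map_one, eq_comm, ← map_one (Ideal.Quotient.mk _), Ideal.Quotient.eq_zero_iff_mem,
    pow_one, Ideal.mem_span_singleton] at h1
  exact isUnit_of_dvd_one h1

/-- Locality is inherited from 𝔖: modulo p, every element of S_r differs from an element of 𝔖 by a
nilpotent, and p lies in the Jacobson radical. -/
instance SR_isLocalRing : IsLocalRing (SR p k d r) := by
  refine IsLocalRing.of_isUnit_or_isUnit_one_sub_self fun x => ?_
  obtain ⟨s, h1, h2⟩ := exists_isUnit_of_isUnit x
  exact (IsLocalRing.isUnit_or_isUnit_one_sub_self s).imp h1 h2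

theorem isUnit_one_add_uSR : IsUnit (1 + uSR : SR p k d r) := by
  have h : IsUnit (1 + PowerSeries.X : SS p k d) := by
    rw [PowerSeries.isUnit_iff_constantCoeff]
    simp
  have := h.map (toSR p k d r)
  rwa [map_add, map_one] at this

end SRFacts

/-! ### A chain of ideals of `S_r` -/

section Chain

variable {p : ℕ} [Fact p.Prime] {k : Type u} [Field k] [CharP k p] [PerfectRing k p] {d r : ℕ}

variable (p k d) in
/-- The kernel of the homomorphism from `S_r` to the completion of `𝔖 / φ^j(u)`, for `j < r`. -/
def kerExt {j : ℕ} (hj : j < r) : Ideal (SR p k d r) :=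
  RingHom.ker (complMap p (extPD p k d hj))

theorem kerU_le_kerExt (h : 0 < r) : kerU p k d r ≤ kerExt p k d h :=
  ker_complMap_le (extPD_zero_eq h)

theorem phiSR_mem_kerExt {i j : ℕ} (hi : i < r) (hj : j < r) (h : j ≤ i + 1) {x : SR p k d r}
    (hx : x ∈ kerExt p k d hi) : phiSR p k d r x ∈ kerExt p k d hj :=
  complMap_mem_ker (extPD_comp_phiPD hi hj h) hx

theorem phiSR_mem_filSR (hr : 1 ≤ r) (h : r - 1 < r) {x : SR p k d r} (hx : x ∈ kerExt p k d h) :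
    phiSR p k d r x ∈ filSR p k d r :=
  complMap_mem_ker (mk_comp_phiPD hr h) hx

theorem phiSR_mem_kerU {x : SR p k d r} (hx : x ∈ kerU p k d r) :
    phiSR p k d r x ∈ kerU p k d r :=
  complMap_mem_ker projPD_comp_phiPD hx

theorem mem_kerExt_of_mul {j : ℕ} (hj : j < r) {x : SR p k d r}
    (hx : (p : SR p k d r) * x ∈ kerExt p k d hj) : x ∈ kerExt p k d hj :=
  mem_ker_complMap_of_mul (extPD p k d hj) (quotient_torsionFree (redSS_phiU j)) hx

theorem mem_filSR_of_mul {x : SR p k d r} (hx : (p : SR p k d r) * x ∈ filSR p k d r) :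
    x ∈ filSR p k d r :=
  mem_ker_complMap_of_mul _ R_torsionFree hx

theorem mem_kerU_of_mul {x : SR p k d r} (hx : (p : SR p k d r) * x ∈ kerU p k d r) :
    x ∈ kerU p k d r :=
  mem_ker_complMap_of_mul _ A_torsionFree hx

theorem p_mul_phi1SR (x : filSR p k d r) :
    (p : SR p k d r) * phi1SR p k d r x = phiSR p k d r x := ((frameSR p k d r).φ_eq x).symm

/-- The statement for φ = pφ_1 can be divided by p, as the completion of 𝔖/φ^j(u) has no p-torsion.
-/
theorem phi1SR_mem_kerExt {i j : ℕ} (hi : i < r) (hj : j < r) (h : j ≤ i + 1) (x : filSR p k d r)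
    (hx : (x : SR p k d r) ∈ kerExt p k d hi) : phi1SR p k d r x ∈ kerExt p k d hj := by
  apply mem_kerExt_of_mul
  rw [p_mul_phi1SR]
  exact phiSR_mem_kerExt hi hj h hx

theorem phi1SR_mem_filSR (hr : 1 ≤ r) (h : r - 1 < r) (x : filSR p k d r)
    (hx : (x : SR p k d r) ∈ kerExt p k d h) : phi1SR p k d r x ∈ filSR p k d r := by
  apply mem_filSR_of_mul
  rw [p_mul_phi1SR]
  exact phiSR_mem_filSR hr h hx

theorem cycSR_sub_mem_kerExt {j : ℕ} (hj : j < r) (b : ℤ_[p]) (s : SR p k d r) :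
    cycSR p k d r (1 + p ^ r * b) s - s ∈ kerExt p k d hj :=
  complMap_sub_mem_ker (extPD_comp_cycPD hj b) s

theorem cycSR_sub_mem_filSR (hr : 1 ≤ r) (b : ℤ_[p]) (s : SR p k d r) :
    cycSR p k d r (1 + p ^ r * b) s - s ∈ filSR p k d r :=
  complMap_sub_mem_ker (mk_comp_cycPD hr b) s

theorem cycSR_sub_mem_kerU (a : ℤ_[p]) (s : SR p k d r) :
    cycSR p k d r a s - s ∈ kerU p k d r :=
  complMap_sub_mem_ker (projPD_comp_cycPD a) s

theorem phiSR_iterate_mem_kerExt {x : SR p k d r} (hx : x ∈ kerU p k d r) {j : ℕ} (hj : j < r) :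
    (phiSR p k d r)^[j] x ∈ kerExt p k d hj := by
  induction j with
  | zero => exact kerU_le_kerExt hj hx
  | succ j ih =>
    rw [Function.iterate_succ_apply']
    exact phiSR_mem_kerExt _ hj le_rfl (ih (Nat.lt_of_succ_lt hj))

/-- The frame `S_r` with the derivation `(1 + u) d/du` and the kernel of `u ↦ 0`. -/
theorem diffFrameSR (hr : 1 ≤ r) :
    DiffFrame (frameSR p k d r) p (kerU p k d r) (eulerSR p k d r) where
  ϖ_eq := rfl
  torsionFree x hx := p_mul_cancel (by rw [hx, mul_zero])
  haus _ hx := SR_haus hx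
  prec f hf := compl_prec (p := p) (B := PD p k d r) f hf
  leibniz := eulerSR_mul
  der_φ := eulerSR_phi
  U_torsionFree _ hx := mem_kerU_of_mul hx
  U_closed _ hx := mem_ker_complMap_of_closed (p := p) (projPD p k d r) hx
  φ_U _ hx := phiSR_mem_kerU hx
  exists_φ_fil := by
    -- The first r-1 Frobenii carry U to the kernel belonging to φ^{r-1}(u); one more lands in Fil¹,
    -- because E_r divides φ^r(u).
    refine ⟨r, fun x hx => ?_⟩
    have h : r - 1 < r := Nat.sub_lt hr one_pos
    have h1 := phiSR_mem_filSR hr h (phiSR_iterate_mem_kerExt hx h)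
    rw [← Function.iterate_succ_apply' (phiSR p k d r), Nat.succ_eq_add_one, Nat.sub_add_cancel hr] at h1
    exact h1

theorem derSR_pow_mul (n : ℕ) (y : SR p k d r) :
    derSR p k d r ((p : SR p k d r) ^ n * y) = (p : SR p k d r) ^ n * derSR p k d r y := by
  have h : ∀ z : SR p k d r, (p : SR p k d r) ^ n * z = (p ^ n) • z := fun z => by simp
  rw [h, h, map_nsmul]

/-- The derivative at `u = 0` of an element of `Fil¹` that vanishes on `φ^{r-1}(u) = 0` is
divisible by `p ^ r`. -/
theorem exists_eulerSR_sub_mem (hp : 2 < p) (hr : 1 ≤ r) (h : r - 1 < r) {x : SR p k d r}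
    (hx : x ∈ kerExt p k d h) (hx' : x ∈ filSR p k d r) :
    ∃ y, eulerSR p k d r x - (p : SR p k d r) ^ r * y ∈ kerU p k d r := by
  obtain ⟨b, y, rfl⟩ := SR_exists x r
  obtain ⟨c, hc⟩ := dvd_of_complMap_eq_zero (Ideal.Quotient.mk (pdIdeal p k d r)) hx'
  obtain ⟨c, rfl⟩ := Ideal.Quotient.mk_surjective c
  rw [← map_natCast (Ideal.Quotient.mk _), ← map_pow, ← map_mul, Ideal.Quotient.eq] at hc
  -- The approximation of x modulo p^r is adjusted by a multiple of p^r so that its part in the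
  -- envelope lies exactly in the divided power ideal.
  have e : ofPD p k d r b + (p : SR p k d r) ^ r * y = ofPD p k d r (b - (p : PD p k d r) ^ r * c) +
      (p : SR p k d r) ^ r * (ofPD p k d r c + y) := by
    rw [map_sub, map_mul, map_pow, map_natCast]
    ring
  rw [e] at hx ⊢
  generalize b - (p : PD p k d r) ^ r * c = b at hc hx
  generalize ofPD p k d r c + y = y at hx
  have hd := dvd_of_complMap_eq_zero (extPD p k d h) hx
  obtain ⟨v, hv⟩ := pow_dvd_proj_der hp hr h hc hd
  refine ⟨(1 + uSR) * (derSR p k d r y + toSR p k d r (PowerSeries.C v)), ?_⟩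
  have e2 : eulerSR p k d r (ofPD p k d r b + (p : SR p k d r) ^ r * y) - (p : SR p k d r) ^ r *
      ((1 + uSR) * (derSR p k d r y + toSR p k d r (PowerSeries.C v))) = (1 + uSR) *
      ofPD p k d r (derPD p k d r b - (p : PD p k d r) ^ r * inclPD p k d r (PowerSeries.C v)) := by
    rw [eulerSR_apply, map_add, derSR_ofPD, derSR_pow_mul, map_sub, map_mul, map_pow, map_natCast,
      ← toSR_eq]
    ring
  rw [e2]
  refine Ideal.mul_mem_left _ _ ?_
  have e3 : projPD p k d r (derPD p k d r b -
      (p : PD p k d r) ^ r * inclPD p k d r (PowerSeries.C v)) = 0 := by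
    rw [map_sub, map_mul, map_pow, map_natCast, projPD_incl, hv]
    simp
  refine RingHom.mem_ker.2 ((complMap_algebraMap (p := p) (projPD p k d r) _).trans ?_)
  rw [e3, map_zero]

end Chain

/-! ### The cyclotomic extension `F_∞ / F` -/

section GaloisFacts

open Polynomial

/-- Both primitive roots have the cyclotomic polynomial as minimal polynomial, hence are conjugate
in the normal extension. -/
theorem exists_algEquiv_apply_eq_pow {K L : Type*} [Field K] [Field L] [Algebra K L] [Normal K L]
    {n m : ℕ} [NeZero (n : K)] (h : Irreducible (cyclotomic n K)) {ζ : L}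
    (hζ : IsPrimitiveRoot ζ n) (hm : m.Coprime n) : ∃ γ : L ≃ₐ[K] L, γ ζ = ζ ^ m := by
  have hconj : IsConjRoot K (ζ ^ m) ζ := by
    rw [IsConjRoot, ← hζ.minpoly_eq_cyclotomic_of_irreducible h,
      ← (hζ.pow_of_coprime _ hm).minpoly_eq_cyclotomic_of_irreducible h]
  exact isConjRoot_iff_exists_algEquiv.1 hconj

theorem mem_fixingSubgroup_adjoin {K L : Type*} [Field K] [Field L] [Algebra K L] {s : Set L}
    {γ : L ≃ₐ[K] L} (h : ∀ x ∈ s, γ x = x) :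
    γ ∈ (IntermediateField.adjoin K s).fixingSubgroup := by
  have hle : IntermediateField.adjoin K s ≤
      IntermediateField.fixedField (Subgroup.zpowers γ) := by
    rw [IntermediateField.adjoin_le_iff]
    intro x hx
    rw [SetLike.mem_coe, IntermediateField.mem_fixedField_iff]
    intro g hg
    have hle : Subgroup.zpowers γ ≤ MulAction.stabilizer (L ≃ₐ[K] L) x := by
      rw [Subgroup.zpowers_le, MulAction.mem_stabilizer_iff, AlgEquiv.smul_def, h x hx]
    exact MulAction.mem_stabilizer_iff.1 (hle hg)
  exact (IntermediateField.le_iff_le _ _).1 hle (Subgroup.mem_zpowers γ)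

variable {p : ℕ} [Fact p.Prime] {k : Type u} [Field k] [CharP k p] [PerfectRing k p]

theorem p_prime_W : Prime (p : WittVector p k) := (WittVector.irreducible p).prime

/-- The cyclotomic polynomials of `p`-power order are irreducible over `F = W(k)[1/p]`. -/
theorem irreducible_cyclotomic (n : ℕ) : Irreducible (cyclotomic (p ^ (n + 1)) (FF p k)) := by
  -- The polynomial Φ(X+1) is Eisenstein at p over ℤ. It remains so over W(k), since p stays prime
  -- there and the constant term Φ(1) is p.
  have hE := cyclotomic_prime_pow_comp_X_add_one_isEisensteinAt p n
  have hmZ : ((cyclotomic (p ^ (n + 1)) ℤ).comp (X + 1)).Monic := by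
    rw [show (X + 1 : ℤ[X]) = X + C 1 by simp]
    exact (cyclotomic.monic _ ℤ).comp_X_add_C 1
  have hmap : ((cyclotomic (p ^ (n + 1)) ℤ).comp (X + 1)).map (Int.castRingHom (WittVector p k)) =
      (cyclotomic (p ^ (n + 1)) (WittVector p k)).comp (X + 1) := by
    rw [Polynomial.map_comp, map_cyclotomic_int]
    simp
  set f := (cyclotomic (p ^ (n + 1)) (WittVector p k)).comp (X + 1) with hf
  have hm : f.Monic := hmap ▸ hmZ.map _
  have hdeg : f.natDegree = ((cyclotomic (p ^ (n + 1)) ℤ).comp (X + 1)).natDegree := by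
    rw [← hmap, hmZ.natDegree_map]
  have hpr : (Ideal.span {(p : WittVector p k)}).IsPrime :=
    (Ideal.span_singleton_prime p_prime_W.ne_zero).2 p_prime_W
  have hE' : f.IsEisensteinAt (Ideal.span {(p : WittVector p k)}) := by
    refine hm.isEisensteinAt_of_mem_of_notMem hpr.ne_top (fun {i} hi => ?_) ?_
    · rw [← hmap, coeff_map]
      have := hE.mem (hdeg ▸ hi)
      rw [Submodule.mem_span_singleton] at this
      obtain ⟨c, hc⟩ := this
      rw [← hc]
      exact Ideal.mem_span_singleton.2 ⟨(c : WittVector p k), by simp [mul_comm]⟩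
    · have h0 : f.coeff 0 = p := by
        rw [coeff_zero_eq_eval_zero, hf, eval_comp, eval_add, eval_X, eval_one, zero_add,
          eval_one_cyclotomic_prime_pow]
      rw [h0, Ideal.span_singleton_pow, Ideal.mem_span_singleton, sq]
      rintro ⟨c, hc⟩
      refine p_prime_W.not_isUnit (isUnit_of_dvd_one (a := (p : WittVector p k)) ⟨c, ?_⟩)
      apply mul_left_cancel₀ (p_prime_W (p := p) (k := k)).ne_zero
      rw [mul_one, ← mul_assoc]
      exact hc
  have hpos : 0 < f.natDegree := by
    rw [hdeg, show (X + 1 : ℤ[X]) = X + C 1 by simp, natDegree_comp, natDegree_X_add_C, mul_one,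
      natDegree_cyclotomic]
    exact Nat.totient_pos.2 (pow_pos (Fact.out : p.Prime).pos _)
  have hirr := hE'.irreducible hpr hm.isPrimitive hpos
  rw [hm.irreducible_iff_irreducible_map_fraction_map (K := FF p k), hf, Polynomial.map_comp,
    map_cyclotomic] at hirr
  have e : (X + 1 : (WittVector p k)[X]).map (algebraMap (WittVector p k) (FF p k)) = X + C 1 := by
    simp
  rw [e] at hirr
  exact (MulEquiv.irreducible_iff (algEquivAevalXAddC (1 : FF p k)).toMulEquiv).1 hirr

instance normal_Finf : Normal (FF p k) (Finf p k) := by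
  rw [IntermediateField.normal_iff_forall_map_le]
  intro σ
  rw [IntermediateField.adjoin_map]
  refine IntermediateField.adjoin.mono _ _ _ ?_
  rintro _ ⟨ζ, ⟨n, hn⟩, rfl⟩
  exact ⟨n, by rw [← map_pow, hn, map_one]⟩

theorem exists_isPrimitiveRoot (n : ℕ) : ∃ ζ : Finf p k, IsPrimitiveRoot ζ (p ^ n) := by
  have : NeZero (p : FF p k) := ⟨Nat.cast_ne_zero.2 (Fact.out : p.Prime).ne_zero⟩
  obtain ⟨ζ, hζ⟩ := HasEnoughRootsOfUnity.exists_primitiveRoot (AlgebraicClosure (FF p k)) (p ^ n)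
  refine ⟨⟨ζ, IntermediateField.subset_adjoin _ _ ⟨n, hζ.pow_eq_one⟩⟩, ?_⟩
  exact IsPrimitiveRoot.of_map_of_injective (f := (Finf p k).val) hζ Subtype.val_injective

instance hasEnoughRootsOfUnity_Finf (n : ℕ) : HasEnoughRootsOfUnity (Finf p k) (p ^ n) where
  prim := exists_isPrimitiveRoot n
  cyc :=
    have : NeZero (p ^ n) := ⟨pow_ne_zero _ (Fact.out : p.Prime).ne_zero⟩
    rootsOfUnity.isCyclic _ _

theorem apply_eq_pow (σ : Finf p k ≃ₐ[FF p k] Finf p k) {n : ℕ} {ζ : Finf p k}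
    (h : ζ ^ p ^ n = 1) : σ ζ = ζ ^ ((chi σ).toZModPow n).val :=
  cyclotomicCharacter.spec p (σ : Finf p k ≃+* Finf p k) ζ h

/-- The group `Gal(F_∞ / F)` is commutative. -/
theorem Finf_aut_mul_comm (σ τ : Finf p k ≃ₐ[FF p k] Finf p k) : σ * τ = τ * σ := by
  have h : (((σ * τ : Finf p k ≃ₐ[FF p k] Finf p k)) : Finf p k →ₐ[FF p k] Finf p k) =
      ((τ * σ : Finf p k ≃ₐ[FF p k] Finf p k) : Finf p k →ₐ[FF p k] Finf p k) := by
    refine IntermediateField.algHom_ext_of_eq_adjoin _ rfl fun x hx => ?_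
    obtain ⟨n, hn⟩ := hx
    set y : Finf p k := ⟨x, IntermediateField.subset_adjoin _ _ ⟨n, hn⟩⟩
    have hy : y ^ p ^ n = 1 := Subtype.ext hn
    change σ (τ y) = τ (σ y)
    rw [apply_eq_pow τ hy, apply_eq_pow σ hy, map_pow, map_pow, apply_eq_pow τ hy,
      apply_eq_pow σ hy, ← pow_mul, ← pow_mul, mul_comm]
  exact AlgEquiv.ext fun x => DFunLike.congr_fun h x

theorem coprime_one_add_pow {r : ℕ} (hr : 1 ≤ r) (n : ℕ) : Nat.Coprime (1 + p ^ r) (p ^ n) := by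
  have h : Nat.Coprime p (1 + p ^ r) := by
    rw [(Nat.coprime_add_iff_left (dvd_pow_self p (Nat.one_le_iff_ne_zero.1 hr)))]
    exact Nat.coprime_one_right p
  exact h.symm.pow_right n

theorem exists_apply_eq_pow {r : ℕ} (hr : 1 ≤ r) {ζ : Finf p k}
    (hζ : IsPrimitiveRoot ζ (p ^ (r + 1))) :
    ∃ γ : Finf p k ≃ₐ[FF p k] Finf p k, γ ζ = ζ ^ (1 + p ^ r) := by
  have : NeZero ((p ^ (r + 1) : ℕ) : FF p k) :=
    ⟨Nat.cast_ne_zero.2 (pow_ne_zero _ (Fact.out : p.Prime).ne_zero)⟩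
  exact exists_algEquiv_apply_eq_pow (K := FF p k) (L := Finf p k) (n := p ^ (r + 1))
    (irreducible_cyclotomic r) hζ (coprime_one_add_pow hr _)

/-- Since p(1 + p^r) ≡ p modulo p^{r+1}, γ fixes ζ^p, which generates the group of p^r-th roots of
unity. -/
theorem mem_Gam_of_apply_eq_pow {r : ℕ} {ζ : Finf p k} (hζ : IsPrimitiveRoot ζ (p ^ (r + 1)))
    {γ : Finf p k ≃ₐ[FF p k] Finf p k} (hγ : γ ζ = ζ ^ (1 + p ^ r)) : γ ∈ Gam p k r := by
  have hpp : p.Prime := Fact.out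
  have hfix : γ (ζ ^ p) = ζ ^ p := by
    rw [map_pow, hγ, ← pow_mul, add_mul, one_mul, ← pow_succ, pow_add, hζ.pow_eq_one, mul_one]
  have hprim : IsPrimitiveRoot (ζ ^ p) (p ^ r) :=
    hζ.pow (pow_pos hpp.pos _) (by rw [pow_succ, mul_comm])
  refine mem_fixingSubgroup_adjoin fun η hη => ?_
  have : NeZero (p ^ r) := ⟨pow_ne_zero _ hpp.ne_zero⟩
  obtain ⟨i, -, rfl⟩ := hprim.eq_pow_of_pow_eq_one hη
  rw [map_pow, hfix]

theorem isUnit_one_add_p_mul (c : ℤ_[p]) : IsUnit (1 + p * c) := by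
  rcases IsLocalRing.isUnit_or_isUnit_one_sub_self (1 + (p : ℤ_[p]) * c) with h | h
  · exact h
  · rw [sub_add_cancel_left, IsUnit.neg_iff] at h
    exact absurd (isUnit_of_mul_isUnit_left h) PadicInt.p_nonunit

theorem exists_chi_eq_of_apply_eq_pow {r : ℕ} {ζ : Finf p k}
    (hζ : IsPrimitiveRoot ζ (p ^ (r + 1)))
    {γ : Finf p k ≃ₐ[FF p k] Finf p k} (hγ : γ ζ = ζ ^ (1 + p ^ r)) :
    ∃ a : ℤ_[p], IsUnit a ∧ chi γ = 1 + p ^ r * a := by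
  have h1 := apply_eq_pow γ hζ.pow_eq_one
  rw [hγ] at h1
  have : NeZero (p ^ (r + 1)) := ⟨pow_ne_zero _ (Fact.out : p.Prime).ne_zero⟩
  have h0 : (((chi γ).toZModPow (r + 1)).val : ZMod (p ^ (r + 1))) = (1 + p ^ r : ℕ) := by
    rw [ZMod.natCast_eq_natCast_iff]
    have h3 := (hζ.isOfFinOrder (NeZero.ne _)).pow_eq_pow_iff_modEq.1 h1.symm
    rwa [← hζ.eq_orderOf] at h3
  rw [ZMod.natCast_zmod_val] at h0
  -- The order of ζ is p^{r+1}, so its image fixes χ(γ) modulo p^{r+1}. Writing the error as p^{r+1}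
  -- c, the required unit is 1 + pc.
  have h2 : chi γ - (1 + p ^ r) ∈ RingHom.ker (PadicInt.toZModPow (p := p) (r + 1)) := by
    rw [RingHom.mem_ker, map_sub, h0]
    simp
  rw [PadicInt.ker_toZModPow, Ideal.mem_span_singleton] at h2
  obtain ⟨c, hc⟩ := h2
  exact ⟨1 + p * c, isUnit_one_add_p_mul c, by rw [eq_add_of_sub_eq hc]; ring⟩

/-- For `r ≥ 1` there is an element of `Γ_r` with `χ(γ) - 1` of `p`-adic valuation `r`. -/
theorem exists_mem_Gam {r : ℕ} (hr : 1 ≤ r) :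
    ∃ γ ∈ Gam p k r, ∃ a : ℤ_[p], IsUnit a ∧ chi γ = 1 + p ^ r * a := by
  obtain ⟨ζ, hζ⟩ := exists_isPrimitiveRoot (p := p) (k := k) (r + 1)
  obtain ⟨γ, hγ⟩ := exists_apply_eq_pow hr hζ
  exact ⟨γ, mem_Gam_of_apply_eq_pow hζ hγ, exists_chi_eq_of_apply_eq_pow hζ hγ⟩

end GaloisFacts

/-! ### Existence and uniqueness of the connection -/

section Main

variable {p : ℕ} [Fact p.Prime] {k : Type u} [Field k] [CharP k p] [PerfectRing k p] {d r : ℕ}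

theorem derSR_uSR : derSR p k d r uSR = 1 := by
  rw [uSR, toSR_eq, derSR_ofPD, derPD_incl, PowerSeries.derivative_X, map_one, map_one]

theorem eulerSR_uSR : eulerSR p k d r uSR = 1 + uSR := by
  rw [eulerSR_apply, derSR_uSR, mul_one]

theorem one_add_uSR_mul_derSR_phi : (1 + uSR) * derSR p k d r (phiSR p k d r uSR) =
    (p : SR p k d r) * phiSR p k d r (1 + uSR) := by
  rw [← eulerSR_apply, eulerSR_phi, eulerSR_uSR]

theorem one_add_uSR_mul_derSR_gam (γ : Finf p k ≃ₐ[FF p k] Finf p k) :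
    (1 + uSR) * derSR p k d r (gamSR d r γ uSR) =
      zpToSR p k d r (chi γ) * gamSR d r γ (1 + uSR) := by
  rw [← eulerSR_apply, gamSR, eulerSR_cyc, eulerSR_uSR]

theorem isDer_smul {M : Type*} [AddCommGroup M] [Module (SR p k d r) M] {N : M →+ M}
    (hN : IsDer (derSR p k d r) N) :
    IsDer (eulerSR p k d r) ((DistribSMul.toAddMonoidHom M (1 + uSR : SR p k d r)).comp N) := by
  intro s m
  change (1 + uSR : SR p k d r) • N (s • m) = eulerSR p k d r s • m + s • (1 + uSR : SR p k d r) • N m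
  rw [hN, eulerSR_apply]
  module

namespace ConnGammaWindow

/-- The contraction of the connection with the derivation `(1 + u) d/du`. -/
def euler (P : ConnGammaWindow p k d r) : P.M →+ P.M :=
  (DistribSMul.toAddMonoidHom P.M (1 + uSR : SR p k d r)).comp P.N

theorem euler_apply (P : ConnGammaWindow p k d r) (m : P.M) :
    P.euler m = (1 + uSR : SR p k d r) • P.N m := rfl

theorem isDer_euler (P : ConnGammaWindow p k d r) : IsDer (eulerSR p k d r) P.euler :=
  isDer_smul P.leibniz

theorem euler_Φ (P : ConnGammaWindow p k d r) (m : P.M) :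
    P.euler (P.Φ m) = (p : SR p k d r) • P.Φ (P.euler m) := by
  rw [euler_apply, euler_apply, P.horizontal_Φ, smul_smul, one_add_uSR_mul_derSR_phi,
    LinearMap.map_smulₛₗ, mul_smul]
  rfl

theorem euler_act (P : ConnGammaWindow p k d r) (γ : Gam p k r) (m : P.M) :
    P.euler (P.act γ m) =
      zpToSR p k d r (chi (γ : Finf p k ≃ₐ[FF p k] Finf p k)) • P.act γ (P.euler m) := by
  rw [euler_apply, euler_apply, P.horizontal_act, smul_smul, one_add_uSR_mul_derSR_gam,
    P.act_smul, mul_smul]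

end ConnGammaWindow

theorem zpToSR_one_add (a : ℤ_[p]) :
    zpToSR p k d r (1 + p ^ r * a) = 1 + (p : SR p k d r) ^ r * zpToSR p k d r a := by
  rw [map_add, map_one, map_mul, map_pow, map_natCast]

/-- Equivariant homomorphisms of windows are horizontal. -/
theorem hom_map_N (hr : 1 ≤ r) (P Q : ConnGammaWindow p k d r)
    (f : GammaWindow.Hom P.toGammaWindow Q.toGammaWindow) (m : P.M) :
    f.lin (P.N m) = Q.N (f.lin m) := by
  obtain ⟨γ, hγ, a, ha, hχ⟩ := exists_mem_Gam (p := p) (k := k) hr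
  have key : ∀ (R : ConnGammaWindow p k d r) (m : R.M), R.euler (R.act ⟨γ, hγ⟩ m) =
      (1 + (p : SR p k d r) ^ r * zpToSR p k d r a) • R.act ⟨γ, hγ⟩ (R.euler m) := fun R m => by
    rw [R.euler_act, hχ, zpToSR_one_add]
  have h := (diffFrameSR hr).hom_horizontal f.toWindowHom (f.map_act ⟨γ, hγ⟩) (P.strict ⟨γ, hγ⟩)
    (Q.strict ⟨γ, hγ⟩) (ha.map (zpToSR p k d r)) P.isDer_euler Q.isDer_euler P.euler_Φ Q.euler_Φ
    (key P) (key Q) m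
  rw [ConnGammaWindow.euler_apply, ConnGammaWindow.euler_apply, map_smul] at h
  exact (isUnit_one_add_uSR.smul_left_cancel).1 h

/-- A strict action of `γ` with `χ(γ) ≡ 1` modulo `p ^ r` is trivial modulo the intersection of
`Fil¹ S_r` and the kernel of `S_r → 𝔖 / φ^{r-1}(u)`. -/
theorem act_sub_mem_inf (hr : 1 ≤ r) (h : r - 1 < r) (P : GammaWindow p k d r) (γ : Gam p k r)
    {a : ℤ_[p]} (hχ : chi (γ : Finf p k ≃ₐ[FF p k] Finf p k) = 1 + p ^ r * a) (m : P.M) :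
    P.act γ m - m ∈ (kerExt p k d h ⊓ filSR p k d r) • (⊤ : Submodule (SR p k d r) P.M) := by
  -- Strictness is the case j = 0; each pass through `act_sub_mem` raises j by one. From j = r-1 a
  -- further pass keeps that kernel and also reaches Fil¹.
  have key : ∀ j (hj : j < r) (m : P.M),
      P.act γ m - m ∈ kerExt p k d hj • (⊤ : Submodule (SR p k d r) P.M) := by
    intro j
    induction j with
    | zero => exact fun hj m => Submodule.smul_mono_left (kerU_le_kerExt hj) (P.strict γ m)
    | succ j ih =>
      intro hj m
      have hj' : j < r := Nat.lt_of_succ_lt hj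
      refine act_sub_mem (τ := gamSR d r (γ : Finf p k ≃ₐ[FF p k] Finf p k)) (P.act_smul γ)
        (P.act_fil γ) (P.act_Φ γ) (P.act_Φ₁ γ) (K := kerExt p k d hj')
        (fun x hx => phiSR_mem_kerExt hj' hj le_rfl hx)
        (fun x hx => phi1SR_mem_kerExt hj' hj le_rfl x hx) (fun s => ?_) (ih hj') m
      rw [gamSR, hχ]
      exact cycSR_sub_mem_kerExt hj a s
  refine act_sub_mem (τ := gamSR d r (γ : Finf p k ≃ₐ[FF p k] Finf p k)) (P.act_smul γ)
    (P.act_fil γ) (P.act_Φ γ) (P.act_Φ₁ γ) (K := kerExt p k d h)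
    (K' := kerExt p k d h ⊓ filSR p k d r)
    (fun x hx => ⟨phiSR_mem_kerExt h h (Nat.le_succ _) hx, phiSR_mem_filSR hr h hx⟩)
    (fun x hx => ⟨phi1SR_mem_kerExt h h (Nat.le_succ _) x hx, phi1SR_mem_filSR hr h x hx⟩)
    (fun s => ?_) (key _ h) m
  rw [gamSR, hχ]
  exact ⟨cycSR_sub_mem_kerExt h a s, cycSR_sub_mem_filSR hr a s⟩

/-- A window with a strict action carries a horizontal operator over `(1 + u) d/du`. -/
theorem exists_euler (hp : 2 < p) (hr : 1 ≤ r) (P : GammaWindow p k d r) :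
    ∃ N : P.M →+ P.M, IsDer (eulerSR p k d r) N ∧
      (∀ m, N (P.Φ m) = (p : SR p k d r) • P.Φ (N m)) ∧
      ∀ (σ : Gam p k r) (m : P.M), N (P.act σ m) =
        zpToSR p k d r (chi (σ : Finf p k ≃ₐ[FF p k] Finf p k)) • P.act σ (N m) := by
  obtain ⟨γ, hγ, a, ha, hχ⟩ := exists_mem_Gam (p := p) (k := k) hr
  have h : r - 1 < r := Nat.sub_lt hr one_pos
  have D := diffFrameSR (p := p) (k := k) (d := d) hr
  have ha' := ha.map (zpToSR p k d r)
  -- The exponent r in χ(γ) - 1 = p^r a matches the divisibility by p^r of the derivatives of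
  -- elements of K modulo U.
  obtain ⟨N, hN, hNΦ, hNγ⟩ := D.exists_der (τ := gamSR d r γ) (g := P.act ⟨γ, hγ⟩)
    (K := kerExt p k d h ⊓ filSR p k d r)
    (P.act_smul ⟨γ, hγ⟩) (P.strict ⟨γ, hγ⟩) (cycSR_sub_mem_kerU _) (P.act_Φ ⟨γ, hγ⟩) ha'
    (phiSR_zpToSR a)
    (fun s => by rw [gamSR, eulerSR_cyc, hχ, zpToSR_one_add])
    (fun x hx => exists_eulerSR_sub_mem hp hr h hx.1 hx.2)
    (act_sub_mem_inf hr h P ⟨γ, hγ⟩ hχ)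
  refine ⟨N, hN, hNΦ, fun σ => ?_⟩
  refine D.commutator_eq_zero (P.strict ⟨γ, hγ⟩) ha' hN hNΦ hNγ (P.act_smul σ)
    (cycSR_sub_mem_kerU _) (P.act_Φ σ) (phiSR_zpToSR _) (eulerSR_cyc _) fun m => ?_
  have hc : (⟨γ, hγ⟩ : Gam p k r) * σ = σ * ⟨γ, hγ⟩ := Subtype.ext (Finf_aut_mul_comm _ _)
  have := congrArg (fun τ => P.act τ m) hc
  rw [map_mul, map_mul] at this
  exact this

/-- Every window with a strict action of `Γ_r` carries a connection. -/
theorem exists_connGammaWindow (hp : 2 < p) (hr : 1 ≤ r) (P : GammaWindow p k d r) :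
    ∃ Q : ConnGammaWindow p k d r, Q.toGammaWindow = P := by
  obtain ⟨N, hN, hNΦ, hNσ⟩ := exists_euler hp hr P
  obtain ⟨v, hv⟩ := isUnit_one_add_uSR (p := p) (k := k) (d := d) (r := r)
  have hinv : ((v⁻¹ : (SR p k d r)ˣ) : SR p k d r) * (1 + uSR) = 1 := by rw [← hv, v.inv_mul]
  let N' : P.M →+ P.M :=
    (DistribSMul.toAddMonoidHom P.M ((v⁻¹ : (SR p k d r)ˣ) : SR p k d r)).comp N
  have hN' : ∀ m, N' m = ((v⁻¹ : (SR p k d r)ˣ) : SR p k d r) • N m := fun _ => rfl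
  have hN'' : ∀ m, N m = (1 + uSR : SR p k d r) • N' m := fun m => by
    rw [hN', smul_smul, mul_comm, hinv, one_smul]
  have cancel : ∀ m m' : P.M, (1 + uSR : SR p k d r) • m = (1 + uSR : SR p k d r) • m' → m = m' :=
    fun m m' => isUnit_one_add_uSR.smul_left_cancel.1
  refine ⟨{ toGammaWindow := P
            N := N'
            leibniz := fun s m => ?_
            horizontal_Φ := fun m => ?_
            horizontal_act := fun σ m => ?_ }, rfl⟩
  · apply cancel
    rw [← hN'', hN, eulerSR_apply, hN'', smul_add, mul_smul, smul_comm s]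
  · apply cancel
    rw [← hN'', hNΦ, smul_smul, one_add_uSR_mul_derSR_phi, mul_smul, hN'', LinearMap.map_smulₛₗ]
    rfl
  · apply cancel
    rw [← hN'', hNσ, smul_smul, one_add_uSR_mul_derSR_gam, mul_smul, hN'', P.act_smul]

/-- A morphism is determined by its underlying linear map, which gives faithfulness. Fullness is
automatic horizontality. Every window is literally the image of one with connection, so the identity
witnesses essential surjectivity. -/
theorem forgetConnection_isEquivalence (hp : 2 < p) (hr : 1 ≤ r) :
    (forgetConnection p k d r).IsEquivalence where
  faithful := ⟨fun {P Q} f g h => by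
    have h' : f.toGammaHom = g.toGammaHom := h
    exact ConnGammaWindow.Hom.ext (congrArg (fun q => q.lin) h')⟩
  full := ⟨fun {P Q} f => ⟨{ toGammaHom := f, map_N := hom_map_N hr P Q f }, rfl⟩⟩
  essSurj := ⟨fun P => by
    obtain ⟨Q, rfl⟩ := exists_connGammaWindow hp hr P
    exact ⟨Q, ⟨Iso.refl _⟩⟩⟩

end Main

end CycWin

end

theorem mainTheorem10 (p : ℕ) [Fact p.Prime] (hp : 2 < p) (k : Type*) [Field k] [CharP k p]
    [PerfectRing k p] (d r : ℕ) (hr : 1 ≤ r) :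
    (CycWin.forgetConnection p k d r).IsEquivalence := by
  exact CycWin.forgetConnection_isEquivalence hp hr
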